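/- Let $\mathfrak g=\mathfrak{su}(2)$ with the pairing $\langle\cdot,\cdot\rangle=-\kappa B$, where $B$ is the Killing form (which is negative definite) and $\kappa>0$ is a fixed normalisation. Let $M=L(\mathfrak g,\mathfrak{su}(2))$ be the space of linear maps. A frame $\mathcal F=(e_1,e_2,e_3)$, i.e. an orthonormal basis of the target $\mathfrak{su}(2)$, identifies $M$ with $\mathfrak g^3$: $x\mapsto(a,b,c)=(a_1,a_2,a_3)$, where $\langle a_i,\zeta\rangle=\langle e_i,x(\zeta)\rangle$. Put $\Phi(a,b,c)=\langle a,[b,c]\rangle$, $M_o=\{\Phi\neq0\}$, and on $M_o$ $$A=\frac1\Phi\big([a,b]\otimes[a,b]+[b,c]\otimes[b,c]+[c,a]\otimes[c,a]\big),$$ regarded through the pairing as a symmetric bilinear form $A_{\xi,\eta}$ on $\mathfrak g$. With $l^i_\xi=\langle\xi,a_i\rangle$, let $\pi_{\mathcal F}$ be the bivector field on $M_o$ given by $\{l^1_\xi,l^1_\eta\}=l^1_{[\xi,\eta]}$, $\{l^1_\xi,l^2_\eta\}=\{l^2_\xi,l^1_\eta\}=l^2_{[\xi,\eta]}$, $\{l^1_\xi,l^3_\eta\}=\{l^3_\xi,l^1_\eta\}=l^3_{[\xi,\eta]}$,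 $\{l^2_\xi,l^2_\eta\}=\{l^3_\xi,l^3_\eta\}=-l^1_{[\xi,\eta]}$, $\{l^2_\xi,l^3_\eta\}=-\{l^3_\xi,l^2_\eta\}=A_{\xi,\eta}$. Write $\hat\xi=([\xi,a],[\xi,b],[\xi,c])$ for the generators of the adjoint action and $X=([b,c],[c,a],[a,b])$ for the gradient of $\Phi$. A leaf of $\pi_{\mathcal F}$ is a maximal connected injectively immersed integral manifold in $M_o$ of the distribution $\pi_{\mathcal F}^\#(T^*M)$. Then through every point of $M_o$ there passes a leaf of $\pi_{\mathcal F}$. Every leaf $S$ of $\pi_{\mathcal F}$ is 4-dimensional, and is also a leaf of $\pi_{\mathcal T}$ for every frame $\mathcal T$ of the same orientation as $\mathcal F$. There is an $\mathfrak{su}(2)$-valued two-form $\Omega$ on $S$ such that for every frame $\mathcal T=(e_1',e_2',e_3')$ of the same orientation, $\langle e_1',\Omega\rangle$ is the two-form on $S$ inverse to $\pi_{\mathcal T}$, and $\Omega$ is hypersymplectic: it is closed, $\omega_\xi=\langle\xi,\Omega\rangle$ is nondegenerate for all $\xi\ne0$, and $\omega_\xi^{-1}=k_1\omega_{\xi_1}^{-1}+k_2\omega_{\xi_2}^{-1}$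 whenever $\xi=k_1\xi_1+k_2\xi_2$ with $\xi,\xi_1,\xi_2$ unit vectors. Put $\omega_i=\langle e_i,\Omega\rangle$ and let $\omega_i^\flat:TS\to T^*S$ be $v\mapsto\omega_i(v,\cdot)$. The pseudo-metric $g=\omega_3^\flat(\omega_1^\flat)^{-1}\omega_2^\flat$ is the same for all frames of the orientation of $\mathcal F$. It satisfies $g(\hat\xi,\hat\xi)=-A_{\xi,\xi}$ for all $\xi\in\mathfrak g$ and $g(X,X)=-\Phi$ ($\hat\xi$ and $X$ being tangent to $S$), and $g$ is definite on $S$. Consequently $S$ is hyperkähler: for one of the signs $\varepsilon=\pm1$, $\varepsilon g$ is a smooth Riemannian metric which, for every frame of the orientation of $\mathcal F$, is Kähler with respect to each of the complex structures $I=g^{-1}\omega_1^\flat$, $J=g^{-1}\omega_2^\flat$, $K=g^{-1}\omega_3^\flat$, and $I^2=J^2=K^2=IJK=-1$. -/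

import Mathlib

open Set
open scoped ContDiff Manifold Matrix

noncomputable section

namespace HyperLie

/-! ### The Lie algebra `su(2)` and the space `M = L(𝔤, su(2))`, for `𝔤 = su(2)` -/

section MatrixLieAlgebra

attribute [local instance] LieRing.ofAssociativeRing

/-- Traceless skew-Hermitian `2 × 2` matrices, as a real Lie subalgebra. -/
def su2Alg : LieSubalgebra ℝ (Matrix (Fin 2) (Fin 2) ℂ) where
  carrier := {x | xᴴ = -x ∧ x.trace = 0}
  add_mem' := by
    rintro x y ⟨hx, hx'⟩ ⟨hy, hy'⟩
    refine ⟨?_, by rw [Matrix.trace_add, hx', hy', add_zero]⟩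
    rw [Matrix.conjTranspose_add, hx, hy, neg_add]
  zero_mem' := by simp
  smul_mem' := by
    rintro c x ⟨hx, hx'⟩
    refine ⟨?_, by rw [Matrix.trace_smul, hx', smul_zero]⟩
    rw [Matrix.conjTranspose_smul, hx]
    simp
  lie_mem' := by
    rintro x y ⟨hx, _⟩ ⟨hy, _⟩
    refine ⟨?_, ?_⟩
    · rw [Ring.lie_def, Matrix.conjTranspose_sub, Matrix.conjTranspose_mul,
        Matrix.conjTranspose_mul, hx, hy]
      simp
    · rw [Ring.lie_def, Matrix.trace_sub, Matrix.trace_mul_comm, sub_self]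

/-- The real Lie algebra `su(2)`. -/
def su2 : Type := su2Alg

instance : LieRing su2 := inferInstanceAs (LieRing su2Alg)
instance : LieAlgebra ℝ su2 := inferInstanceAs (LieAlgebra ℝ su2Alg)
instance : FiniteDimensional ℝ su2 :=
  inferInstanceAs (FiniteDimensional ℝ su2Alg.toSubmodule)

/-- The underlying matrix. -/
def su2.toMatrix : su2 →ₗ[ℝ] Matrix (Fin 2) (Fin 2) ℂ := su2Alg.toSubmodule.subtype

attribute [local instance] Matrix.normedAddCommGroup Matrix.normedSpace

/-- An auxiliary norm (the largest absolute value of a matrix entry). It only serves to give the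
finite-dimensional space `su(2)` its usual topology and smooth structure. -/
instance : NormedAddCommGroup su2 :=
  NormedAddCommGroup.induced su2 (Matrix (Fin 2) (Fin 2) ℂ) su2.toMatrix
    (fun _ _ h => Subtype.ext h)

instance : NormedSpace ℝ su2 :=
  NormedSpace.induced ℝ su2 (Matrix (Fin 2) (Fin 2) ℂ) su2.toMatrix

end MatrixLieAlgebra

/-- The invariant pairing on `su(2)`: the Killing form (which is negative definite) multiplied by
`-κ`, where `κ > 0`. -/
def pair (κ : ℝ) (x y : su2) : ℝ := -κ * killingForm ℝ su2 x y

/-- The pairing as a continuous linear functional in its second argument. -/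
def pairCLM (κ : ℝ) (x : su2) : su2 →L[ℝ] ℝ :=
  LinearMap.toContinuousLinearMap ((-κ) • killingForm ℝ su2 x)

/-- `L(𝔤, su(2))` for `𝔤 = su(2)` (all linear maps are continuous). -/
abbrev MSpace : Type := su2 →L[ℝ] su2

/-- A frame: an orthonormal basis `(e₁, e₂, e₃)` of `su(2)`. -/
structure Frame (κ : ℝ) where
  vec : Fin 3 → su2
  orthonormal : ∀ i j, pair κ (vec i) (vec j) = if i = j then 1 else 0

variable {κ : ℝ}

/-- Two frames have the same orientation when the orthogonal matrix that relates them has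
positive determinant, i.e. is in `SO(3)`. -/
def Frame.SameOrientation (F T : Frame κ) : Prop :=
  0 < (Matrix.of fun i j => pair κ (F.vec i) (T.vec j)).det

/-- The inverse `Ψ_F⁻¹ : 𝔤 × 𝔤 × 𝔤 → L(𝔤, su(2))` of the identification attached to a frame:
`(a₁, a₂, a₃)` goes to `ζ ↦ ∑ i, ⟨aᵢ, ζ⟩ eᵢ`. -/
def Frame.ofTriple (F : Frame κ) (a : Fin 3 → su2) : MSpace :=
  ∑ i, (pairCLM κ (a i)).smulRight (F.vec i)

/-- The identification `Ψ_F : L(𝔤, su(2)) → 𝔤 × 𝔤 × 𝔤`: the `i`-th component `aᵢ` of `x` is the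
element of `𝔤` with `⟨aᵢ, ζ⟩ = ⟨eᵢ, x ζ⟩` for all `ζ`. It is written here in the orthonormal basis
of `𝔤 = su(2)` given by the vectors of `F`. -/
def Frame.triple (F : Frame κ) (x : MSpace) (i : Fin 3) : su2 :=
  ∑ k, pair κ (F.vec i) (x (F.vec k)) • F.vec k

/-! ### The function `Φ`, the tensor `A`, and the bivector fields -/

/-- `Φ(a, b, c) = ⟨a, [b, c]⟩`. -/
def Phi (F : Frame κ) (x : MSpace) : ℝ :=
  pair κ (F.triple x 0) ⁅F.triple x 1, F.triple x 2⁆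

/-- The open set where `Φ ≠ 0`. -/
def Mo (F : Frame κ) : Set MSpace := {x | Phi F x ≠ 0}

/-- `A_{ξ, η}` at `(a, b, c)`, for
`A = Φ⁻¹ ([a, b] ⊗ [a, b] + [b, c] ⊗ [b, c] + [c, a] ⊗ [c, a])`. -/
def A (F : Frame κ) (x : MSpace) (ξ η : su2) : ℝ :=
  let a := F.triple x 0
  let b := F.triple x 1
  let c := F.triple x 2
  (1 / Phi F x) *
    (pair κ ξ ⁅a, b⁆ * pair κ η ⁅a, b⁆ + pair κ ξ ⁅b, c⁆ * pair κ η ⁅b, c⁆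
      + pair κ ξ ⁅c, a⁆ * pair κ η ⁅c, a⁆)

/-- The linear function `l^i_ξ` on `L(𝔤, su(2))`: `l^i_ξ (a₁, a₂, a₃) = ⟨ξ, aᵢ⟩ = ⟨eᵢ, x ξ⟩`. -/
def linFun (F : Frame κ) (i : Fin 3) (ξ : su2) : MSpace →L[ℝ] ℝ :=
  (pairCLM κ (F.vec i)).comp (ContinuousLinearMap.apply ℝ su2 ξ)

/-- The table of brackets `{l^i_ξ, l^j_η}` at the point `x`. -/
def bracket (F : Frame κ) (x : MSpace) (ξ η : su2) : Fin 3 → Fin 3 → ℝ :=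
  let l := fun i => linFun F i ⁅ξ, η⁆ x
  !![l 0, l 1, l 2;
     l 1, -l 0, A F x ξ η;
     l 2, -A F x ξ η, -l 0]

/-- The components `u₁, u₂, u₃ ∈ 𝔤` of a covector `α` on `L(𝔤, su(2))`, i.e.
`α = l¹_{u₁} + l²_{u₂} + l³_{u₃}`. -/
def covecComp (F : Frame κ) (α : MSpace →L[ℝ] ℝ) (i : Fin 3) : su2 :=
  ∑ k, α ((pairCLM κ (F.vec k)).smulRight (F.vec i)) • F.vec k

/-- The bivector `π_F` at `x`, as a bilinear function of covectors. -/
def bivector (F : Frame κ) (x : MSpace) (α β : MSpace →L[ℝ] ℝ) : ℝ :=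
  ∑ i, ∑ j, bracket F x (covecComp F α i) (covecComp F β j) i j

/-- `v = π_F^#(α)` at `x`, where `⟨π^#(α), β⟩ = π(α, β)`. -/
def IsSharp (F : Frame κ) (x : MSpace) (α : MSpace →L[ℝ] ℝ) (v : MSpace) : Prop :=
  ∀ β : MSpace →L[ℝ] ℝ, β v = bivector F x α β

/-- The characteristic subspace `π_F^#(T_x^* M)`. -/
def charSpace (F : Frame κ) (x : MSpace) : Set MSpace := {v | ∃ α, IsSharp F x α v}

/-- The generator `ξ̂ = ([ξ, a], [ξ, b], [ξ, c])` of the diagonal adjoint action. -/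
def hat (F : Frame κ) (ξ : su2) (x : MSpace) : MSpace :=
  F.ofTriple fun i => ⁅ξ, F.triple x i⁆

/-- The gradient field `X = ([b, c], [c, a], [a, b])` of `Φ`. -/
def gradPhi (F : Frame κ) (x : MSpace) : MSpace :=
  F.ofTriple ![⁅F.triple x 1, F.triple x 2⁆, ⁅F.triple x 2, F.triple x 0⁆,
    ⁅F.triple x 0, F.triple x 1⁆]

/-! ### Symplectic leaves -/

/-- The model space `ℝᵈ`. -/
abbrev Eu (d : ℕ) : Type := EuclideanSpace ℝ (Fin d)

/-- The tangent space of a `d`-dimensional manifold. -/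
abbrev Tg (d : ℕ) {S : Type} [TopologicalSpace S] [ChartedSpace (Eu d) S] (p : S) : Type :=
  TangentSpace 𝓘(ℝ, Eu d) p

/-- The derivative of a map from a manifold to `L(𝔤, su(2))`. -/
def dmap {d : ℕ} {S : Type} [TopologicalSpace S] [ChartedSpace (Eu d) S] (ι : S → MSpace)
    (p : S) : Tg d p →L[ℝ] MSpace :=
  mfderiv 𝓘(ℝ, Eu d) 𝓘(ℝ, MSpace) ι p

/-- A connected integral manifold in `M_o` of the characteristic distribution of `π_F`: an
injectively immersed connected manifold whose tangent spaces are the characteristic subspaces. -/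
structure IsIntegralManifold (F : Frame κ) (d : ℕ) {S : Type} [TopologicalSpace S]
    [ChartedSpace (Eu d) S] [IsManifold 𝓘(ℝ, Eu d) ∞ S] (ι : S → MSpace) : Prop where
  connected : ConnectedSpace S
  smooth : ContMDiff 𝓘(ℝ, Eu d) 𝓘(ℝ, MSpace) ∞ ι
  injective : Function.Injective ι
  mem : ∀ p, ι p ∈ Mo F
  immersion : ∀ p, Function.Injective (dmap (d := d) ι p)
  tangent : ∀ p, range (dmap (d := d) ι p) = charSpace F (ι p)

/-- A symplectic leaf of `π_F` on `M_o`: a maximal connected integral manifold of the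
characteristic distribution. -/
structure IsLeaf (F : Frame κ) (d : ℕ) {S : Type} [TopologicalSpace S]
    [ChartedSpace (Eu d) S] [IsManifold 𝓘(ℝ, Eu d) ∞ S] (ι : S → MSpace) : Prop where
  integral : IsIntegralManifold F d ι
  maximal : ∀ (d' : ℕ) (N : Type) [TopologicalSpace N] [ChartedSpace (Eu d') N]
    [IsManifold 𝓘(ℝ, Eu d') ∞ N] (j : N → MSpace),
    IsIntegralManifold F d' j → range ι ⊆ range j → range j = range ι

/-! ### Two-forms, hypersymplectic and hyperkähler structures on a manifold -/

section Manifold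

variable (d : ℕ) (S : Type) [TopologicalSpace S] [ChartedSpace (Eu d) S]

/-- Fields of `V`-valued bilinear forms on the tangent spaces. -/
abbrev BilField (V : Type) [NormedAddCommGroup V] [NormedSpace ℝ V] : Type :=
  ∀ p : S, Tg d p →L[ℝ] Tg d p →L[ℝ] V

/-- Fields of endomorphisms of the tangent spaces. -/
abbrev EndField : Type := ∀ p : S, Tg d p →L[ℝ] Tg d p

variable {d S}

/-- The expression of a field of bilinear forms in a chart, i.e. its pullback to `ℝᵈ` under the
inverse of the chart. -/
def inChart {V : Type} [NormedAddCommGroup V] [NormedSpace ℝ V] (θ : BilField d S V)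
    (e : OpenPartialHomeomorph S (Eu d)) (u : Eu d) : Eu d →L[ℝ] Eu d →L[ℝ] V :=
  let D : Eu d →L[ℝ] Eu d := mfderiv 𝓘(ℝ, Eu d) 𝓘(ℝ, Eu d) e.symm u
  let B : Eu d →L[ℝ] Eu d →L[ℝ] V := θ (e.symm u)
  B.bilinearComp D D

/-- A smooth closed `V`-valued two-form. In every chart of the atlas, the exterior derivative is
`dθ(v₁, v₂, v₃) = ∂_{v₁} θ(v₂, v₃) + ∂_{v₂} θ(v₃, v₁) + ∂_{v₃} θ(v₁, v₂)` for constant `vᵢ`. -/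
structure IsClosedTwoForm {V : Type} [NormedAddCommGroup V] [NormedSpace ℝ V]
    (θ : BilField d S V) : Prop where
  alternating : ∀ p v, θ p v v = 0
  smooth : ∀ e ∈ atlas (Eu d) S, ContDiffOn ℝ ∞ (inChart θ e) e.target
  closed : ∀ e ∈ atlas (Eu d) S, ∀ u ∈ e.target, ∀ v₁ v₂ v₃ : Eu d,
    fderiv ℝ (inChart θ e) u v₁ v₂ v₃ + fderiv ℝ (inChart θ e) u v₂ v₃ v₁
      + fderiv ℝ (inChart θ e) u v₃ v₁ v₂ = 0

/-- `ω_ξ = ⟨ξ, Ω⟩`. For fixed `p` this is also the bundle map `ω_ξ^b : T_p S → T_p^* S`,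
`⟨ω_ξ^b(v), w⟩ = ω_ξ(v, w)`. -/
def component (κ : ℝ) (Ω : BilField d S su2) (ξ : su2) : BilField d S ℝ :=
  fun p => (ContinuousLinearMap.compL ℝ (Eu d) su2 ℝ (pairCLM κ ξ)).comp (Ω p)

/-- A hypersymplectic structure: a closed nondegenerate `su(2)`-valued two-form `Ω` such that
`ξ ↦ ω_ξ⁻¹` is linear on unit vectors. -/
structure IsHypersymplectic (κ : ℝ) (Ω : BilField d S su2) : Prop where
  closed : IsClosedTwoForm Ω
  nondegenerate : ∀ ξ : su2, ξ ≠ 0 → ∀ p, (component κ Ω ξ p).IsInvertible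
  linear : ∀ ξ ξ₁ ξ₂ : su2, pair κ ξ ξ = 1 → pair κ ξ₁ ξ₁ = 1 → pair κ ξ₂ ξ₂ = 1 →
    ∀ k₁ k₂ : ℝ, ξ = k₁ • ξ₁ + k₂ • ξ₂ → ∀ p,
      (component κ Ω ξ p).inverse
        = k₁ • (component κ Ω ξ₁ p).inverse + k₂ • (component κ Ω ξ₂ p).inverse

/-- The pseudo-metric `g = ω₃^b ∘ (ω₁^b)⁻¹ ∘ ω₂^b` of a hypersymplectic structure, for a frame. -/
def pseudoMetric (Ω : BilField d S su2) (F : Frame κ) : BilField d S ℝ := fun p =>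
  (component κ Ω (F.vec 2) p).comp
    ((component κ Ω (F.vec 0) p).inverse.comp (component κ Ω (F.vec 1) p))

/-- The bundle maps `I, J, K = g⁻¹ ∘ ωᵢ^b`, for `i = 1, 2, 3`. -/
def almostComplex (Ω : BilField d S su2) (F : Frame κ) (i : Fin 3) : EndField d S := fun p =>
  (pseudoMetric Ω F p).inverse.comp (component κ Ω (F.vec i) p)

/-- Smooth vector fields. -/
def IsSmoothField (X : ∀ p : S, Tg d p) [IsManifold 𝓘(ℝ, Eu d) ∞ S] : Prop :=
  ContMDiff 𝓘(ℝ, Eu d) 𝓘(ℝ, Eu d).tangent ∞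
    (fun p => (⟨p, X p⟩ : TangentBundle 𝓘(ℝ, Eu d) S))

/-- A complex structure: a smooth field `J` of endomorphisms with `J² = -1` and vanishing Nijenhuis
tensor. -/
structure IsComplexStructure [IsManifold 𝓘(ℝ, Eu d) ∞ S] (J : EndField d S) : Prop where
  smooth : ContMDiff 𝓘(ℝ, Eu d) (𝓘(ℝ, Eu d).prod 𝓘(ℝ, Eu d →L[ℝ] Eu d)) ∞
    (fun p => Bundle.TotalSpace.mk' (Eu d →L[ℝ] Eu d)
      (E := fun p : S => Tg d p →L[ℝ] Tg d p) p (J p))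
  square : ∀ p v, J p (J p v) = -v
  integrable : ∀ X Y : (∀ p : S, Tg d p), IsSmoothField X → IsSmoothField Y → ∀ p,
    VectorField.mlieBracket 𝓘(ℝ, Eu d) (fun q => J q (X q)) (fun q => J q (Y q)) p
      - J p (VectorField.mlieBracket 𝓘(ℝ, Eu d) (fun q => J q (X q)) Y p)
      - J p (VectorField.mlieBracket 𝓘(ℝ, Eu d) X (fun q => J q (Y q)) p)
      - VectorField.mlieBracket 𝓘(ℝ, Eu d) X Y p = 0

variable (d S) in
/-- Smooth Riemannian metrics on a manifold. -/
abbrev RMetric [IsManifold 𝓘(ℝ, Eu d) ∞ S] : Type :=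
  Bundle.ContMDiffRiemannianMetric 𝓘(ℝ, Eu d) ∞ (Eu d) (fun p : S => Tg d p)

/-- The Riemannian metric `h` is Kähler with respect to the complex structure `J`: it is
Hermitian, and the two-form `h(J·, ·)` is closed. -/
structure IsKahler [IsManifold 𝓘(ℝ, Eu d) ∞ S] (h : RMetric d S) (J : EndField d S) : Prop where
  complex : IsComplexStructure J
  hermitian : ∀ p v w, h.inner p (J p v) (J p w) = h.inner p v w
  closed : IsClosedTwoForm (fun p => (h.inner p).comp (J p) : BilField d S ℝ)

/-- Hyperkähler structures: a Riemannian metric that is Kähler with respect to three complex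
structures with `I² = J² = K² = IJK = -1`. -/
structure IsHyperkahler [IsManifold 𝓘(ℝ, Eu d) ∞ S] (h : RMetric d S) (I J K : EndField d S) :
    Prop where
  kahlerI : IsKahler h I
  kahlerJ : IsKahler h J
  kahlerK : IsKahler h K
  quaternion : ∀ p v, I p (J p (K p v)) = -v

/-- `θ` is the form induced by the Poisson structure `π_F` on the immersed manifold `ι : S → M`:
`θ^b` is inverse to `π_F^#`, that is, `θ(v, w) = ⟨α, w⟩` whenever `v = π_F^#(α)`. -/
def IsInducedForm (F : Frame κ) (ι : S → MSpace) (θ : BilField d S ℝ) : Prop :=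
  ∀ p (v w : Tg d p) (α : MSpace →L[ℝ] ℝ),
    IsSharp F (ι p) α (dmap ι p v) → θ p v w = α (dmap ι p w)

end Manifold

end HyperLie

end

open HyperLie
open scoped ContDiff Manifold

open Set
open scoped ContDiff Manifold Matrix

noncomputable section

namespace HyperLie

/-! ### Frames of `su(2)` -/

/-! Everything rests on one description of the characteristic distribution: on `Mo F` the image of
`π_F^#` is spanned by X and the generators ξ̂ (`mem_charSpace_iff`), and `(ξ, s) ↦ ξ̂ + sX` is
injective, so its dimension is 3 + 1 = 4. As a linear map, ξ̂ is `-x ∘ ad ξ`, and X is a multiple of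
the cofactor map of x. Hence a frame enters only through its structure constant `Frame.mu`, which
depends only on the orientation. Frames of one orientation therefore have the same distribution and
the same leaves, although their bivectors differ.

The distribution is also the kernel of the derivative of the Gram matrix of (a, b, c) modulo scalar
matrices (`mem_ker_integralsD`): the adjoint action preserves the Gram matrix, and X changes it by a
multiple of the identity. These five functions form a submersion on `Mo F`, and the connected
components of its level sets are leaves (`exists_leaf`).

On a leaf with inclusion y, let σ and τ be the coordinates ξ and s of a tangent vector. Symmetry of
the second derivative of y gives a Maurer–Cartan equation for σ (`maurerCartan`). It shows that the
form Ω, defined pointwise by `formE`, equals d(y ∘ σ), so Ω is closed. Paired with the first vector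
of any frame of the given orientation, Ω inverts the bivector of that frame (`formAt_induced`).

For the metric, send ξ̂ + sX to the quaternion q = Φs + X(ξ). The identity Φ · x[ζ, η] = Xζ × Xη
turns ω_ξ into Φ⁻¹⟨qξ, q'⟩ (`formAt_eq`). With G = -Φ⁻¹⟨·, ·⟩ and ρ_ξ the right multiplication by
-ξ, this reads ω_ξ = Gρ_ξ. Nondegeneracy, linearity of ω_ξ⁻¹ on unit vectors, g = G and the
quaternion relations follow by algebra. The metric is definite because Φ has constant sign on a
connected leaf. Each of I, J, K is a ratio of two of the closed forms, so Hitchin's lemma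
(`nijenhuis_eq_zero`) makes it integrable. -/

lemma finrank_su2_le : Module.finrank ℝ su2 ≤ 3 := by
  have key : ∀ x : su2, (su2.toMatrix x) ∈ su2Alg := fun x => x.2
  -- These three real numbers determine a traceless skew-Hermitian matrix. Only the upper bound on
  -- the dimension is needed, since a frame supplies three independent vectors.
  let f : su2 →ₗ[ℝ] (Fin 3 → ℝ) :=
    { toFun := fun x => ![(su2.toMatrix x 0 0).im, (su2.toMatrix x 0 1).re,
        (su2.toMatrix x 0 1).im]
      map_add' := fun x y => by ext i; fin_cases i <;> simp
      map_smul' := fun c x => by ext i; fin_cases i <;> simp }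
  have hf : Function.Injective f := by
    rw [← LinearMap.ker_eq_bot, LinearMap.ker_eq_bot']
    intro x hx
    obtain ⟨h1, h2⟩ := key x
    have e00 := congrFun (congrFun h1 0) 0
    have e01 := congrFun (congrFun h1 0) 1
    have e10 := congrFun (congrFun h1 1) 0
    have a0 := congrFun hx 0
    have a1 := congrFun hx 1
    have a2 := congrFun hx 2
    simp [f, Matrix.conjTranspose_apply] at e00 e01 e10 a0 a1 a2
    simp only [Matrix.trace_fin_two] at h2
    rw [Complex.ext_iff] at e00 e01 e10 h2
    simp at e00 e01 e10 h2
    have : su2.toMatrix x = 0 := by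
      ext i j
      fin_cases i <;> fin_cases j <;> simp [Complex.ext_iff] <;> (try constructor) <;> linarith
    exact Subtype.ext this
  have := LinearMap.finrank_le_finrank_of_injective hf
  simpa using this

/-! ### The invariant pairing -/

section Pair
variable (κ : ℝ)

lemma pair_comm (x y : su2) : pair κ x y = pair κ y x := by
  simp only [pair, killingForm]; rw [LieModule.traceForm_comm]

lemma pair_lie (x y z : su2) : pair κ ⁅x, y⁆ z = pair κ x ⁅y, z⁆ := by
  simp only [pair, killingForm]; rw [LieModule.traceForm_apply_lie_apply]

@[simp] lemma pair_add_right (x y z : su2) : pair κ x (y + z) = pair κ x y + pair κ x z := by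
  simp [pair]; ring
@[simp] lemma pair_add_left (x y z : su2) : pair κ (x + y) z = pair κ x z + pair κ y z := by
  simp [pair]; ring
@[simp] lemma pair_smul_right (r : ℝ) (x y : su2) : pair κ x (r • y) = r * pair κ x y := by
  simp [pair]; ring
@[simp] lemma pair_smul_left (r : ℝ) (x y : su2) : pair κ (r • x) y = r * pair κ x y := by
  simp [pair]; ring
@[simp] lemma pair_neg_right (x y : su2) : pair κ x (-y) = - pair κ x y := by simp [pair]
@[simp] lemma pair_neg_left (x y : su2) : pair κ (-x) y = - pair κ x y := by simp [pair]
@[simp] lemma pair_sub_right (x y z : su2) : pair κ x (y - z) = pair κ x y - pair κ x z := by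
  simp [pair]; ring
@[simp] lemma pair_sub_left (x y z : su2) : pair κ (x - y) z = pair κ x z - pair κ y z := by
  simp [pair]; ring
@[simp] lemma pair_zero_right (x : su2) : pair κ x 0 = 0 := by simp [pair]
@[simp] lemma pair_zero_left (x : su2) : pair κ 0 x = 0 := by simp [pair]

@[simp] lemma pairCLM_apply (x y : su2) : pairCLM κ x y = pair κ x y := by
  simp [pairCLM, pair]

lemma pair_sum_right {ι : Type*} (s : Finset ι) (x : su2) (f : ι → su2) :
    pair κ x (∑ i ∈ s, f i) = ∑ i ∈ s, pair κ x (f i) := by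
  simp only [← pairCLM_apply, map_sum]

end Pair

variable {κ : ℝ}

namespace Frame
variable (F : Frame κ)

lemma linearIndependent : LinearIndependent ℝ F.vec := by
  rw [Fintype.linearIndependent_iff]
  intro g hg i
  have := congrArg (pair κ (F.vec i)) hg
  simpa [pair_sum_right, F.orthonormal] using this

/-- A frame as a basis. -/
def basis : Module.Basis (Fin 3) ℝ su2 :=
  basisOfLinearIndependentOfCardEqFinrank F.linearIndependent
    (le_antisymm (by simpa using F.linearIndependent.fintype_card_le_finrank)
      (by simpa using finrank_su2_le))

@[simp] lemma basis_apply (i : Fin 3) : F.basis i = F.vec i := by simp [basis]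

lemma finrank_su2 (F : Frame κ) : Module.finrank ℝ su2 = 3 := by
  simpa using Module.finrank_eq_card_basis F.basis

lemma basis_repr (u : su2) (i : Fin 3) : F.basis.repr u i = pair κ (F.vec i) u := by
  conv_rhs => rw [← F.basis.sum_repr u]
  simp [pair_sum_right, F.orthonormal]

lemma sum_pair_smul (u : su2) : ∑ i, pair κ (F.vec i) u • F.vec i = u := by
  conv_rhs => rw [← F.basis.sum_repr u]
  simp [F.basis_repr]

lemma expand (u : su2) : u = pair κ (F.vec 0) u • F.vec 0 + pair κ (F.vec 1) u • F.vec 1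
    + pair κ (F.vec 2) u • F.vec 2 := by
  conv_lhs => rw [← F.sum_pair_smul u]
  simp [Fin.sum_univ_three]

lemma ext_pair {u v : su2} (h : ∀ i, pair κ (F.vec i) u = pair κ (F.vec i) v) : u = v := by
  rw [← F.sum_pair_smul u, ← F.sum_pair_smul v]; simp [h]

lemma pair_eq (u v : su2) : pair κ u v = pair κ (F.vec 0) u * pair κ (F.vec 0) v
    + pair κ (F.vec 1) u * pair κ (F.vec 1) v + pair κ (F.vec 2) u * pair κ (F.vec 2) v := by
  conv_lhs => rw [F.expand u]
  simp

lemma pair_self_nonneg (F : Frame κ) (u : su2) : 0 ≤ pair κ u u := by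
  rw [F.pair_eq]; nlinarith [sq_nonneg (pair κ (F.vec 0) u), sq_nonneg (pair κ (F.vec 1) u),
    sq_nonneg (pair κ (F.vec 2) u)]

lemma pair_self_eq_zero (F : Frame κ) {u : su2} (h : pair κ u u = 0) : u = 0 := by
  rw [F.pair_eq] at h
  have h0 := mul_self_nonneg (pair κ (F.vec 0) u)
  have h1 := mul_self_nonneg (pair κ (F.vec 1) u)
  have h2 := mul_self_nonneg (pair κ (F.vec 2) u)
  have e0 : pair κ (F.vec 0) u = 0 := mul_self_eq_zero.1 (by linarith)
  have e1 : pair κ (F.vec 1) u = 0 := mul_self_eq_zero.1 (by linarith)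
  have e2 : pair κ (F.vec 2) u = 0 := mul_self_eq_zero.1 (by linarith)
  rw [F.expand u, e0, e1, e2]
  simp

/-- The structure constant `⟨[e₁, e₂], e₃⟩` of the frame. -/
def mu : ℝ := pair κ ⁅F.vec 0, F.vec 1⁆ (F.vec 2)

lemma pair_lie_self_left (u v : su2) : pair κ u ⁅u, v⁆ = 0 := by
  rw [← pair_lie, lie_self, pair_zero_left]

lemma pair_lie_self_right (u v : su2) : pair κ u ⁅v, u⁆ = 0 := by
  rw [← lie_skew, pair_neg_right, pair_lie_self_left, neg_zero]

/-- Invariance of the pairing makes ⟨[eᵢ, eⱼ], eₖ⟩ totally antisymmetric, so a single constant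
governs all brackets of frame vectors. -/
lemma lie01 : ⁅F.vec 0, F.vec 1⁆ = F.mu • F.vec 2 := by
  apply F.ext_pair
  intro i
  fin_cases i
  · simp [pair_lie_self_left, F.orthonormal]
  · simp [pair_lie_self_right, F.orthonormal]
  · simp [mu, F.orthonormal, pair_comm]

lemma lie12 : ⁅F.vec 1, F.vec 2⁆ = F.mu • F.vec 0 := by
  apply F.ext_pair
  intro i
  fin_cases i
  · simp [mu, F.orthonormal, pair_lie]
  · simp [pair_lie_self_left, F.orthonormal]
  · simp [pair_lie_self_right, F.orthonormal]

lemma lie20 : ⁅F.vec 2, F.vec 0⁆ = F.mu • F.vec 1 := by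
  apply F.ext_pair
  intro i
  fin_cases i
  · simp [pair_lie_self_right, F.orthonormal]
  · simp only [mu, Fin.mk_one, pair_smul_right, F.orthonormal]
    rw [← pair_lie, pair_comm, ← pair_lie, pair_comm, ← pair_lie]; simp
  · simp [pair_lie_self_left, F.orthonormal]

lemma lie10 : ⁅F.vec 1, F.vec 0⁆ = -(F.mu • F.vec 2) := by rw [← lie_skew, lie01]
lemma lie21 : ⁅F.vec 2, F.vec 1⁆ = -(F.mu • F.vec 0) := by rw [← lie_skew, lie12]
lemma lie02 : ⁅F.vec 0, F.vec 2⁆ = -(F.mu • F.vec 1) := by rw [← lie_skew, lie20]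

/-- The bracket is `mu` times the cross product of frame coordinates; this reduces later bracket
identities to polynomial ones. -/
lemma lie_eq (u v : su2) : ⁅u, v⁆ =
    (F.mu * (pair κ (F.vec 1) u * pair κ (F.vec 2) v - pair κ (F.vec 2) u * pair κ (F.vec 1) v))
      • F.vec 0 +
    (F.mu * (pair κ (F.vec 2) u * pair κ (F.vec 0) v - pair κ (F.vec 0) u * pair κ (F.vec 2) v))
      • F.vec 1 +
    (F.mu * (pair κ (F.vec 0) u * pair κ (F.vec 1) v - pair κ (F.vec 1) u * pair κ (F.vec 0) v))
      • F.vec 2 := by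
  conv_lhs => rw [F.expand u, F.expand v]
  simp only [add_lie, lie_add, smul_lie, lie_smul, lie_self, lie01, lie12, lie20, lie10, lie21,
    lie02]
  module

lemma pair_vec (i j : Fin 3) : pair κ (F.vec i) (F.vec j) = if i = j then 1 else 0 :=
  F.orthonormal i j

lemma pair_lie0 (u v : su2) : pair κ (F.vec 0) ⁅u, v⁆ =
    F.mu * (pair κ (F.vec 1) u * pair κ (F.vec 2) v - pair κ (F.vec 2) u * pair κ (F.vec 1) v) := by
  rw [F.lie_eq u v]; simp [F.pair_vec]
lemma pair_lie1 (u v : su2) : pair κ (F.vec 1) ⁅u, v⁆ =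
    F.mu * (pair κ (F.vec 2) u * pair κ (F.vec 0) v - pair κ (F.vec 0) u * pair κ (F.vec 2) v) := by
  rw [F.lie_eq u v]; simp [F.pair_vec]
lemma pair_lie2 (u v : su2) : pair κ (F.vec 2) ⁅u, v⁆ =
    F.mu * (pair κ (F.vec 0) u * pair κ (F.vec 1) v - pair κ (F.vec 1) u * pair κ (F.vec 0) v) := by
  rw [F.lie_eq u v]; simp [F.pair_vec]

/-- If the constant vanished, the algebra would be abelian and its Killing form zero, contrary to
⟨e₁, e₁⟩ = 1. -/
lemma mu_ne_zero : F.mu ≠ 0 := by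
  intro h
  have hb : ∀ u v : su2, ⁅u, v⁆ = 0 := fun u v => by rw [F.lie_eq]; simp [h]
  have h1 := F.orthonormal 0 0
  have h2 : LieModule.toEnd ℝ su2 su2 (F.vec 0) = 0 := by
    ext v; simp [hb]
  rw [pair, killingForm, LieModule.traceForm_apply_apply, h2] at h1
  simp at h1

/-- A triple product is multiplied by the determinant of the change of frame. That matrix is
orthogonal, so a positive determinant is 1. This is the only way in which the orientation is used.
-/
lemma mu_eq_of_sameOrientation {F T : Frame κ} (h : F.SameOrientation T) : T.mu = F.mu := by
  have ho := T.orthonormal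
  have h00 := ho 0 0
  have h01 := ho 0 1
  have h02 := ho 0 2
  have h11 := ho 1 1
  have h12 := ho 1 2
  have h22 := ho 2 2
  have hmu : T.mu = F.mu * (Matrix.of fun i j => pair κ (F.vec i) (T.vec j)).det := by
    rw [Frame.mu, F.pair_eq, F.pair_lie0, F.pair_lie1, F.pair_lie2, Matrix.det_fin_three]
    simp only [Matrix.of_apply]; ring
  have hR : (Matrix.of fun i j => pair κ (F.vec i) (T.vec j))ᵀ *
      (Matrix.of fun i j => pair κ (F.vec i) (T.vec j)) = 1 := by
    ext i j
    rw [Matrix.mul_apply, Fin.sum_univ_three, Matrix.one_apply, ← T.orthonormal i j, F.pair_eq]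
    rfl
  have hd := congrArg Matrix.det hR
  rw [Matrix.det_mul, Matrix.det_transpose, Matrix.det_one] at hd
  have : (Matrix.of fun i j => pair κ (F.vec i) (T.vec j)).det = 1 := by
    have h' : 0 < (Matrix.of fun i j => pair κ (F.vec i) (T.vec j)).det := h
    nlinarith
  rw [hmu, this, mul_one]

end Frame

/-! ### The identification with triples -/

namespace Frame
variable (F : Frame κ)

lemma pair_triple (x : MSpace) (i : Fin 3) (ζ : su2) :
    pair κ (F.triple x i) ζ = pair κ (F.vec i) (x ζ) := by
  conv_rhs => rw [F.expand ζ]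
  rw [F.pair_eq]
  simp [triple, Fin.sum_univ_three, F.pair_vec]
  ring

lemma pair_triple' (x : MSpace) (i : Fin 3) (ζ : su2) :
    pair κ ζ (F.triple x i) = pair κ (F.vec i) (x ζ) := by
  rw [pair_comm, pair_triple]

lemma ofTriple_apply (a : Fin 3 → su2) (ζ : su2) :
    F.ofTriple a ζ = ∑ i, pair κ (a i) ζ • F.vec i := by
  simp [ofTriple]

lemma pair_ofTriple (a : Fin 3 → su2) (ζ : su2) (i : Fin 3) :
    pair κ (F.vec i) (F.ofTriple a ζ) = pair κ (a i) ζ := by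
  rw [ofTriple_apply]
  simp [pair_sum_right, F.pair_vec]

lemma ext_space {x y : MSpace}
    (h : ∀ i ζ, pair κ (F.vec i) (x ζ) = pair κ (F.vec i) (y ζ)) : x = y := by
  ext1 ζ
  exact F.ext_pair fun i => h i ζ

lemma eq_of_pair (F : Frame κ) {u v : su2} (h : ∀ ζ, pair κ u ζ = pair κ v ζ) : u = v :=
  F.ext_pair fun i => by rw [pair_comm, h, pair_comm]

@[simp] lemma triple_ofTriple (a : Fin 3 → su2) : F.triple (F.ofTriple a) = a := by
  ext1 i
  exact F.eq_of_pair fun ζ => by rw [pair_triple, pair_ofTriple]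

@[simp] lemma ofTriple_triple (x : MSpace) : F.ofTriple (F.triple x) = x :=
  F.ext_space fun i ζ => by rw [pair_ofTriple, pair_triple]

lemma triple_injective {x y : MSpace} (h : ∀ i, F.triple x i = F.triple y i) : x = y := by
  rw [← F.ofTriple_triple x, ← F.ofTriple_triple y, funext h]

lemma triple_add (x y : MSpace) (i : Fin 3) : F.triple (x + y) i = F.triple x i + F.triple y i :=
  F.eq_of_pair fun ζ => by simp [pair_triple]

lemma triple_smul (r : ℝ) (x : MSpace) (i : Fin 3) : F.triple (r • x) i = r • F.triple x i :=
  F.eq_of_pair fun ζ => by simp [pair_triple]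

end Frame

/-- Invariance moves `ad ξ` from each component aᵢ to the argument ζ; the right-hand side no longer
mentions the frame. -/
lemma hat_apply (F : Frame κ) (ξ : su2) (x : MSpace) (ζ : su2) : hat F ξ x ζ = -x ⁅ξ, ζ⁆ := by
  apply F.ext_pair
  intro i
  rw [hat, F.pair_ofTriple, ← lie_skew, pair_neg_left, pair_lie, F.pair_triple, pair_neg_right]

lemma hat_add (F : Frame κ) (ξ η : su2) (x : MSpace) : hat F (ξ + η) x = hat F ξ x + hat F η x := by
  ext1 ζ; simp [hat_apply]; abel

lemma hat_smul (F : Frame κ) (r : ℝ) (ξ : su2) (x : MSpace) : hat F (r • ξ) x = r • hat F ξ x := by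
  ext1 ζ; simp [hat_apply]

lemma hat_eq (F T : Frame κ) (ξ : su2) (x : MSpace) : hat F ξ x = hat T ξ x := by
  ext1 ζ; simp [hat_apply]

lemma triple_hat (F : Frame κ) (ξ : su2) (x : MSpace) (i : Fin 3) :
    F.triple (hat F ξ x) i = ⁅ξ, F.triple x i⁆ := by simp [hat]

lemma triple_gradPhi0 (F : Frame κ) (x : MSpace) :
    F.triple (gradPhi F x) 0 = ⁅F.triple x 1, F.triple x 2⁆ := by simp [gradPhi]
lemma triple_gradPhi1 (F : Frame κ) (x : MSpace) :
    F.triple (gradPhi F x) 1 = ⁅F.triple x 2, F.triple x 0⁆ := by simp [gradPhi]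
lemma triple_gradPhi2 (F : Frame κ) (x : MSpace) :
    F.triple (gradPhi F x) 2 = ⁅F.triple x 0, F.triple x 1⁆ := by simp [gradPhi]

/-- In a three-dimensional space, four vectors are dependent. -/
lemma Phi_smul (F : Frame κ) (x : MSpace) (u : su2) : Phi F x • u =
    pair κ u ⁅F.triple x 1, F.triple x 2⁆ • F.triple x 0 +
    pair κ u ⁅F.triple x 2, F.triple x 0⁆ • F.triple x 1 +
    pair κ u ⁅F.triple x 0, F.triple x 1⁆ • F.triple x 2 := by
  apply F.ext_pair
  intro i
  simp only [Phi, pair_add_right, pair_smul_right, F.pair_eq (F.triple x 0), F.pair_eq u,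
    F.pair_lie0, F.pair_lie1, F.pair_lie2]
  fin_cases i <;> simp only [Fin.zero_eta, Fin.mk_one, Fin.reduceFinMk] <;> ring

lemma pair_cyc (u v w : su2) : pair κ u ⁅v, w⁆ = pair κ v ⁅w, u⁆ := by
  rw [pair_comm, pair_lie]

/-- The vector `A u`, dual to the linear form `A_{u, ·}`. -/
def Avec (F : Frame κ) (x : MSpace) (u : su2) : su2 :=
  (Phi F x)⁻¹ • (pair κ u ⁅F.triple x 1, F.triple x 2⁆ • ⁅F.triple x 1, F.triple x 2⁆ +
    pair κ u ⁅F.triple x 2, F.triple x 0⁆ • ⁅F.triple x 2, F.triple x 0⁆ +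
    pair κ u ⁅F.triple x 0, F.triple x 1⁆ • ⁅F.triple x 0, F.triple x 1⁆)

lemma A_eq_pair (F : Frame κ) (x : MSpace) (ξ η : su2) : A F x ξ η = pair κ (Avec F x ξ) η := by
  simp only [A, Avec, pair_smul_left, pair_add_left, pair_comm κ η]
  ring

lemma A_comm (F : Frame κ) (x : MSpace) (ξ η : su2) : A F x ξ η = A F x η ξ := by
  simp only [A]; ring

/-! ### Covectors and the map `π^#` -/

lemma pair_covecComp (F : Frame κ) (α : MSpace →L[ℝ] ℝ) (i : Fin 3) (u : su2) :
    pair κ (covecComp F α i) u = α ((pairCLM κ u).smulRight (F.vec i)) := by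
  have h : (pairCLM κ u).smulRight (F.vec i) =
      ∑ k, pair κ (F.vec k) u • (pairCLM κ (F.vec k)).smulRight (F.vec i) := by
    ext1 ζ
    simp only [ContinuousLinearMap.smulRight_apply, pairCLM_apply, sum_apply,
      smul_apply, smul_smul, ← Finset.sum_smul]
    rw [F.pair_eq u ζ, Fin.sum_univ_three]
  rw [h, map_sum, pair_comm, covecComp, pair_sum_right]
  simp [pair_comm κ u, mul_comm]

lemma covec_apply (F : Frame κ) (α : MSpace →L[ℝ] ℝ) (w : MSpace) :
    α w = ∑ i, pair κ (covecComp F α i) (F.triple w i) := by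
  simp only [pair_covecComp]
  conv_lhs => rw [← F.ofTriple_triple w]
  simp [Frame.ofTriple]

lemma covecComp_eq (F : Frame κ) {α : MSpace →L[ℝ] ℝ} {u : Fin 3 → su2}
    (h : ∀ w, α w = ∑ i, pair κ (u i) (F.triple w i)) (i : Fin 3) : covecComp F α i = u i := by
  apply F.eq_of_pair
  intro ζ
  rw [pair_covecComp, h]
  have : (pairCLM κ ζ).smulRight (F.vec i) = F.ofTriple (Pi.single i ζ) := by
    ext1 η
    rw [F.ofTriple_apply, Finset.sum_eq_single i]
    · simp
    · intro j _ hj; simp [hj]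
    · simp
  rw [this, F.triple_ofTriple, Finset.sum_eq_single i]
  · simp
  · intro j _ hj; simp [hj]
  · simp

lemma exists_covec (F : Frame κ) (u : Fin 3 → su2) : ∃ α : MSpace →L[ℝ] ℝ,
    (∀ w, α w = ∑ i, pair κ (u i) (F.triple w i)) ∧ ∀ i, covecComp F α i = u i := by
  have h : ∀ w, (∑ i, linFun F i (u i)) w = ∑ i, pair κ (u i) (F.triple w i) := by
    intro w
    simp [linFun, F.pair_triple']
  exact ⟨_, h, covecComp_eq F h⟩

/-- The components of `π^#(α)` for a covector `α` with components `u`. -/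
def sharpComp (F : Frame κ) (x : MSpace) (u : Fin 3 → su2) : Fin 3 → su2 :=
  ![⁅F.triple x 0, u 0⁆ + ⁅F.triple x 1, u 1⁆ + ⁅F.triple x 2, u 2⁆,
    ⁅F.triple x 1, u 0⁆ - ⁅F.triple x 0, u 1⁆ - Avec F x (u 2),
    ⁅F.triple x 2, u 0⁆ + Avec F x (u 1) - ⁅F.triple x 0, u 2⁆]

lemma linFun_lie (F : Frame κ) (x : MSpace) (i : Fin 3) (ξ η : su2) :
    linFun F i ⁅ξ, η⁆ x = pair κ ⁅F.triple x i, ξ⁆ η := by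
  rw [pair_lie, F.pair_triple]; simp [linFun]

lemma bivector_eq (F : Frame κ) (x : MSpace) (α β : MSpace →L[ℝ] ℝ) :
    bivector F x α β =
      ∑ j, pair κ (sharpComp F x (covecComp F α) j) (covecComp F β j) := by
  simp only [bivector, bracket, sharpComp, Fin.sum_univ_three, linFun_lie, A_eq_pair]
  simp only [Matrix.of_apply, Matrix.cons_val', Matrix.cons_val_zero, Matrix.cons_val_one,
    Matrix.cons_val, pair_add_left, pair_sub_left, Matrix.cons_val_fin_one]
  ring

lemma bivector_swap (F : Frame κ) (x : MSpace) (α β : MSpace →L[ℝ] ℝ) :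
    bivector F x α β = -bivector F x β α := by
  have h : ∀ (ξ η : su2) (i : Fin 3), linFun F i ⁅ξ, η⁆ x = -linFun F i ⁅η, ξ⁆ x := by
    intro ξ η i; rw [← lie_skew]
    simp [linFun, -lie_skew]
  simp only [bivector, bracket, Fin.sum_univ_three]
  simp only [Matrix.of_apply, Matrix.cons_val', Matrix.cons_val_zero, Matrix.cons_val_one,
    Matrix.cons_val, Matrix.cons_val_fin_one]
  rw [h (covecComp F α 0) (covecComp F β 0), h (covecComp F α 0) (covecComp F β 1),
    h (covecComp F α 0) (covecComp F β 2), h (covecComp F α 1) (covecComp F β 0),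
    h (covecComp F α 1) (covecComp F β 1), h (covecComp F α 2) (covecComp F β 0),
    h (covecComp F α 2) (covecComp F β 2), A_comm F x (covecComp F α 1),
    A_comm F x (covecComp F α 2)]
  ring

lemma isSharp_iff (F : Frame κ) (x : MSpace) (α : MSpace →L[ℝ] ℝ) (v : MSpace) :
    IsSharp F x α v ↔ ∀ j, F.triple v j = sharpComp F x (covecComp F α) j := by
  constructor
  · intro h j
    apply F.eq_of_pair
    intro ζ
    obtain ⟨β, h1, h2⟩ := exists_covec F (Pi.single j ζ)
    have := h β
    rw [h1, bivector_eq, Finset.sum_eq_single j, Finset.sum_eq_single j] at this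
    · simpa [h2, pair_comm κ ζ] using this
    · intro i _ hi; simp [h2, hi]
    · simp
    · intro i _ hi; simp [hi]
    · simp
  · intro h β
    rw [bivector_eq, covec_apply F β]
    simp [h, pair_comm]

/-- The tangent vector `ξ̂ + s X`. -/
def gen (F : Frame κ) (x : MSpace) (ξ : su2) (s : ℝ) : MSpace := hat F ξ x + s • gradPhi F x

/-- The vector [b, c] is orthogonal to b and c and pairs with a to Φ, and cyclically. So A sends the
basis a, b, c to [b, c], [c, a], [a, b], and the denominator Φ disappears. -/
lemma Avec_eq (F : Frame κ) {x : MSpace} (hx : Phi F x ≠ 0) (p q r : ℝ) :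
    Avec F x (p • F.triple x 0 + q • F.triple x 1 + r • F.triple x 2) =
      p • ⁅F.triple x 1, F.triple x 2⁆ + q • ⁅F.triple x 2, F.triple x 0⁆ +
        r • ⁅F.triple x 0, F.triple x 1⁆ := by
  have h1 : pair κ (F.triple x 1) ⁅F.triple x 2, F.triple x 0⁆ = Phi F x := by
    rw [Phi, pair_cyc, pair_cyc]
  have h2 : pair κ (F.triple x 2) ⁅F.triple x 0, F.triple x 1⁆ = Phi F x := pair_cyc _ _ _
  have h0 : pair κ (F.triple x 0) ⁅F.triple x 1, F.triple x 2⁆ = Phi F x := rfl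
  simp only [Avec, pair_add_left, pair_smul_left, Frame.pair_lie_self_left,
    Frame.pair_lie_self_right, h0, h1, h2, mul_zero, add_zero, zero_add]
  rw [smul_add, smul_add]
  simp only [smul_smul]
  congr 2 <;> congr 1 <;> field_simp

lemma exists_expand (F : Frame κ) {x : MSpace} (hx : Phi F x ≠ 0) (u : su2) :
    ∃ p q r : ℝ, u = p • F.triple x 0 + q • F.triple x 1 + r • F.triple x 2 := by
  have h := Phi_smul F x u
  refine ⟨(Phi F x)⁻¹ * pair κ u ⁅F.triple x 1, F.triple x 2⁆,
    (Phi F x)⁻¹ * pair κ u ⁅F.triple x 2, F.triple x 0⁆,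
    (Phi F x)⁻¹ * pair κ u ⁅F.triple x 0, F.triple x 1⁆, ?_⟩
  simp only [mul_smul, ← smul_add, ← h]
  rw [inv_smul_smul₀ hx]

lemma exists_gen_of_isSharp (F : Frame κ) {x : MSpace} (hx : Phi F x ≠ 0)
    {α : MSpace →L[ℝ] ℝ} {v : MSpace} (h : IsSharp F x α v) : ∃ ξ s, v = gen F x ξ s := by
  rw [isSharp_iff] at h
  obtain ⟨p, q, r, h1⟩ := exists_expand F hx (covecComp F α 1)
  obtain ⟨p', q', r', h2⟩ := exists_expand F hx (covecComp F α 2)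
  -- Comparing coefficients in the first component gives p, p' and s = r - q'. The multiple of a in
  -- ξ is invisible there and is fixed by the coefficient of [a, b] in the second component.
  refine ⟨-covecComp F α 0 + p • F.triple x 1 - q • F.triple x 0 + p' • F.triple x 2
    - r' • F.triple x 0, r - q', F.triple_injective fun i => ?_⟩
  have e10 : ⁅F.triple x 1, F.triple x 0⁆ = -⁅F.triple x 0, F.triple x 1⁆ := (lie_skew _ _).symm
  have e21 : ⁅F.triple x 2, F.triple x 1⁆ = -⁅F.triple x 1, F.triple x 2⁆ := (lie_skew _ _).symm
  have e02 : ⁅F.triple x 0, F.triple x 2⁆ = -⁅F.triple x 2, F.triple x 0⁆ := (lie_skew _ _).symm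
  have ea : ∀ i, ⁅covecComp F α 0, F.triple x i⁆ = -⁅F.triple x i, covecComp F α 0⁆ :=
    fun i => (lie_skew _ _).symm
  rw [gen, F.triple_add, F.triple_smul, triple_hat, h i]
  fin_cases i
  · simp only [Fin.zero_eta, triple_gradPhi0, sharpComp, Matrix.cons_val_zero]
    rw [h1, h2]
    simp only [add_lie, lie_add, sub_lie, neg_lie, smul_lie, lie_smul, lie_self, ea, e10, e21]
    module
  · simp only [Fin.mk_one, triple_gradPhi1, sharpComp, Matrix.cons_val_one, Matrix.cons_val_zero]
    rw [h2, Avec_eq F hx, h1]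
    simp only [add_lie, lie_add, sub_lie, neg_lie, smul_lie, lie_smul, lie_self, ea, e21, e02]
    module
  · simp only [Fin.reduceFinMk, triple_gradPhi2, sharpComp, Matrix.cons_val]
    rw [h1, Avec_eq F hx, h2]
    simp only [add_lie, lie_add, sub_lie, neg_lie, smul_lie, lie_smul, lie_self, ea, e02]
    module

/-- An explicit preimage under `π^#`: -ξ in the first slot produces ξ̂, and sc in the second
produces sX, because A sends c to [a, b]. -/
lemma exists_isSharp_gen (F : Frame κ) {x : MSpace} (hx : Phi F x ≠ 0) (ξ : su2) (s : ℝ) :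
    ∃ α, IsSharp F x α (gen F x ξ s) ∧ ∀ w, α w =
      -pair κ (F.vec 0) (w ξ) + s * pair κ (F.vec 1) (w (F.triple x 2)) := by
  obtain ⟨α, h1, h2⟩ := exists_covec F ![-ξ, s • F.triple x 2, 0]
  refine ⟨α, ?_, fun w => ?_⟩
  · have hA : Avec F x (s • F.triple x 2) = s • ⁅F.triple x 0, F.triple x 1⁆ := by
      simpa using Avec_eq F hx 0 0 s
    have hA0 : Avec F x 0 = 0 := by simpa using Avec_eq F hx 0 0 0
    have e02 : ⁅F.triple x 0, F.triple x 2⁆ = -⁅F.triple x 2, F.triple x 0⁆ := (lie_skew _ _).symm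
    have ea : ∀ i, ⁅ξ, F.triple x i⁆ = -⁅F.triple x i, ξ⁆ := fun i => (lie_skew _ _).symm
    rw [isSharp_iff, funext h2]
    intro j
    rw [gen, F.triple_add, F.triple_smul, triple_hat, ea]
    fin_cases j
    · simp [triple_gradPhi0, sharpComp]
    · simp only [Fin.mk_one, triple_gradPhi1, sharpComp, Matrix.cons_val_one, Matrix.cons_val,
        Matrix.cons_val_zero, hA0, lie_neg, lie_smul, e02]
      module
    · simp [triple_gradPhi2, sharpComp, hA]
  · rw [h1, Fin.sum_univ_three]
    simp [F.pair_triple']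

lemma mem_charSpace_iff (F : Frame κ) {x : MSpace} (hx : Phi F x ≠ 0) (v : MSpace) :
    v ∈ charSpace F x ↔ ∃ ξ s, v = gen F x ξ s := by
  constructor
  · rintro ⟨α, h⟩; exact exists_gen_of_isSharp F hx h
  · rintro ⟨ξ, s, rfl⟩
    obtain ⟨α, h, _⟩ := exists_isSharp_gen F hx ξ s
    exact ⟨α, h⟩

/-- Two covectors with the same image under `π^#` agree on the characteristic space. -/
lemma covec_eq_on_charSpace (F : Frame κ) {x : MSpace} {α α' : MSpace →L[ℝ] ℝ} {v w : MSpace}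
    (h : IsSharp F x α v) (h' : IsSharp F x α' v) (hw : w ∈ charSpace F x) : α w = α' w := by
  obtain ⟨γ, hγ⟩ := hw
  rw [hγ α, hγ α', bivector_swap, bivector_swap F x γ α', ← h γ, ← h' γ]

/-! ### Independence of the frame -/

/-- The adjoint of `x`. -/
def adj (F : Frame κ) (x : MSpace) (u : su2) : su2 := ∑ k, pair κ u (x (F.vec k)) • F.vec k

lemma pair_adj (F : Frame κ) (x : MSpace) (u ζ : su2) : pair κ (adj F x u) ζ = pair κ u (x ζ) := by
  conv_rhs => rw [F.expand ζ]
  rw [F.pair_eq]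
  simp [adj, Fin.sum_univ_three, F.pair_vec]
  ring

/-- X is, up to the factor `mu`, the cofactor map of x, which is characterised by its effect on
brackets. Apart from that factor the formula is independent of the frame. -/
lemma pair_lie_gradPhi (F : Frame κ) (x : MSpace) (u v ζ : su2) :
    pair κ ⁅u, v⁆ (gradPhi F x ζ) = F.mu * pair κ ⁅adj F x u, adj F x v⁆ ζ := by
  have h : ∀ u, adj F x u = pair κ (F.vec 0) u • F.triple x 0 + pair κ (F.vec 1) u • F.triple x 1
      + pair κ (F.vec 2) u • F.triple x 2 := fun u => F.eq_of_pair fun ζ => by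
    simp [pair_adj, F.pair_triple, F.pair_eq u (x ζ)]
  have e10 : ⁅F.triple x 1, F.triple x 0⁆ = -⁅F.triple x 0, F.triple x 1⁆ := (lie_skew _ _).symm
  have e21 : ⁅F.triple x 2, F.triple x 1⁆ = -⁅F.triple x 1, F.triple x 2⁆ := (lie_skew _ _).symm
  have e02 : ⁅F.triple x 0, F.triple x 2⁆ = -⁅F.triple x 2, F.triple x 0⁆ := (lie_skew _ _).symm
  rw [h, h, F.pair_eq ⁅u, v⁆]
  simp only [gradPhi, F.pair_ofTriple, F.pair_lie0, F.pair_lie1, F.pair_lie2, add_lie, lie_add,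
    smul_lie, lie_smul, lie_self, e10, e21, e02, pair_add_left, pair_smul_left, pair_neg_left,
    smul_neg, smul_zero, Matrix.cons_val_zero, Matrix.cons_val_one, Matrix.cons_val,
    pair_zero_left]
  ring

lemma gradPhi_triple (F : Frame κ) (x : MSpace) (i : Fin 3) :
    gradPhi F x (F.triple x i) = Phi F x • F.vec i := by
  have h1 : pair κ (F.triple x 1) ⁅F.triple x 2, F.triple x 0⁆ = Phi F x := by
    rw [Phi, pair_cyc, pair_cyc]
  have h2 : pair κ (F.triple x 2) ⁅F.triple x 0, F.triple x 1⁆ = Phi F x := pair_cyc _ _ _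
  have h0 : pair κ (F.triple x 0) ⁅F.triple x 1, F.triple x 2⁆ = Phi F x := rfl
  apply F.ext_pair
  intro j
  rw [gradPhi, F.pair_ofTriple, pair_comm]
  fin_cases i <;> fin_cases j <;>
    simp [F.pair_vec, Frame.pair_lie_self_left, Frame.pair_lie_self_right, h0, h1, h2]

/-- Cramer's rule: cofactor map times adjoint is the determinant, here Φ. It transfers frame
independence from X to Φ. -/
lemma gradPhi_adj (F : Frame κ) (x : MSpace) (u : su2) :
    gradPhi F x (adj F x u) = Phi F x • u := by
  have h : adj F x u = pair κ (F.vec 0) u • F.triple x 0 + pair κ (F.vec 1) u • F.triple x 1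
      + pair κ (F.vec 2) u • F.triple x 2 := F.eq_of_pair fun ζ => by
    simp [pair_adj, F.pair_triple, F.pair_eq u (x ζ)]
  rw [h]
  conv_rhs => rw [F.expand u]
  simp only [map_add, map_smul, gradPhi_triple]
  module

section SameOrientation
variable {F T : Frame κ} (h : T.mu = F.mu)

lemma adj_eq (F T : Frame κ) (x : MSpace) : adj T x = adj F x := by
  ext1 u; exact F.eq_of_pair fun ζ => by rw [pair_adj, pair_adj]

include h in
lemma gradPhi_eq (x : MSpace) : gradPhi T x = gradPhi F x := by
  ext1 ζ
  have key : ∀ u v : su2, pair κ ⁅u, v⁆ (gradPhi T x ζ) = pair κ ⁅u, v⁆ (gradPhi F x ζ) := by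
    intro u v
    rw [pair_lie_gradPhi, pair_lie_gradPhi, adj_eq F T, h]
  apply F.ext_pair
  intro i
  apply mul_left_cancel₀ F.mu_ne_zero
  rw [← pair_smul_left, ← pair_smul_left]
  fin_cases i
  · simpa [F.lie12] using key (F.vec 1) (F.vec 2)
  · simpa [F.lie20] using key (F.vec 2) (F.vec 0)
  · simpa [F.lie01] using key (F.vec 0) (F.vec 1)

include h in
lemma Phi_eq (x : MSpace) : Phi T x = Phi F x := by
  have h1 := gradPhi_adj T x (T.vec 0)
  rw [gradPhi_eq h, adj_eq F T, gradPhi_adj] at h1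
  have := congrArg (pair κ (T.vec 0)) h1
  simpa [T.pair_vec] using this.symm

include h in
lemma gen_eq (x : MSpace) (ξ : su2) (s : ℝ) : gen T x ξ s = gen F x ξ s := by
  rw [gen, gen, gradPhi_eq h, hat_eq T F]

include h in
lemma Mo_eq : Mo T = Mo F := by
  ext x; simp [Mo, Phi_eq h]

include h in
-- Both spaces are spanned by the ξ̂ and X, which the two frames share.
lemma charSpace_eq {x : MSpace} (hx : Phi F x ≠ 0) : charSpace T x = charSpace F x := by
  ext v
  rw [mem_charSpace_iff F hx, mem_charSpace_iff T (by rwa [Phi_eq h])]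
  simp only [gen_eq h]

end SameOrientation

/-! ### Coordinates on the characteristic space -/

section Smooth

/-- The Lie bracket as a continuous bilinear map. -/
def lieCLM : su2 →L[ℝ] su2 →L[ℝ] su2 :=
  LinearMap.toContinuousLinearMap
    ((LinearMap.toContinuousLinearMap (E := su2) (F' := su2) (𝕜 := ℝ)).toLinearMap.comp
      (LinearMap.mk₂ ℝ (fun u v : su2 => ⁅u, v⁆) add_lie smul_lie lie_add
        fun r u v => lie_smul r u v))

@[simp] lemma lieCLM_apply (u v : su2) : lieCLM u v = ⁅u, v⁆ := rfl

lemma contDiff_triple (F : Frame κ) (i : Fin 3) : ContDiff ℝ ∞ fun x => F.triple x i := by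
  simp only [Frame.triple, ← pairCLM_apply]
  fun_prop

variable {E : Type*} [NormedAddCommGroup E] [NormedSpace ℝ E]

lemma _root_.ContDiffOn.su2_lie {s : Set E} {f g : E → su2} (hf : ContDiffOn ℝ ∞ f s)
    (hg : ContDiffOn ℝ ∞ g s) : ContDiffOn ℝ ∞ (fun x => ⁅f x, g x⁆) s := by
  simp only [← lieCLM_apply]
  exact (lieCLM.contDiff.comp_contDiffOn hf).clm_apply hg

lemma _root_.ContDiffOn.su2_pair {s : Set E} {f g : E → su2} (hf : ContDiffOn ℝ ∞ f s)
    (hg : ContDiffOn ℝ ∞ g s) : ContDiffOn ℝ ∞ (fun x => pair κ (f x) (g x)) s := by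
  let P : su2 →L[ℝ] su2 →L[ℝ] ℝ := LinearMap.toContinuousLinearMap
    ((LinearMap.toContinuousLinearMap (E := su2) (F' := ℝ) (𝕜 := ℝ)).toLinearMap.comp
      ((-κ) • killingForm ℝ su2))
  exact (P.contDiff.comp_contDiffOn hf).clm_apply hg

lemma contDiff_Phi (F : Frame κ) : ContDiff ℝ ∞ (Phi F) := by
  have h := fun i => (contDiff_triple F i).contDiffOn (s := univ)
  exact contDiffOn_univ.1 ((h 0).su2_pair ((h 1).su2_lie (h 2)))

lemma contDiff_gradPhi (F : Frame κ) : ContDiff ℝ ∞ (gradPhi F) := by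
  have h := fun i => (contDiff_triple F i).contDiffOn (s := univ)
  have h' : ContDiffOn ℝ ∞ (gradPhi F) univ := by
    refine contDiffOn_clm_apply.2 fun ζ => ?_
    simp only [gradPhi, F.ofTriple_apply, Fin.sum_univ_three, Matrix.cons_val_zero,
      Matrix.cons_val_one, Matrix.cons_val]
    refine ContDiffOn.add (ContDiffOn.add ?_ ?_) ?_
    · exact (((h 1).su2_lie (h 2)).su2_pair contDiffOn_const).smul contDiffOn_const
    · exact (((h 2).su2_lie (h 0)).su2_pair contDiffOn_const).smul contDiffOn_const
    · exact (((h 0).su2_lie (h 1)).su2_pair contDiffOn_const).smul contDiffOn_const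
  exact contDiffOn_univ.1 h'

lemma isOpen_Mo (F : Frame κ) : IsOpen (Mo F) :=
  isOpen_ne_fun (contDiff_Phi F).continuous continuous_const

end Smooth

/-! ### The coordinates (σ, τ) of the distribution and the ambient two-form -/

section Forms
variable (F : Frame κ)

/-- A one-form on `M_o` which recovers `ξ` from `ξ̂ + s X`. -/
def sigma (x : MSpace) : MSpace →L[ℝ] su2 :=
  (Phi F x)⁻¹ • ((linFun F 1 (F.triple x 2)).smulRight (F.triple x 0) +
    (linFun F 2 (F.triple x 0)).smulRight (F.triple x 1) +
    (linFun F 0 (F.triple x 1)).smulRight (F.triple x 2))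

/-- A one-form on `M_o` which recovers `s` from `ξ̂ + s X`. -/
def tau (x : MSpace) : MSpace →L[ℝ] ℝ := (Phi F x)⁻¹ • linFun F 0 (F.triple x 0)

lemma linFun_eq (i : Fin 3) (ζ : su2) (v : MSpace) :
    linFun F i ζ v = pair κ (F.triple v i) ζ := by
  rw [F.pair_triple]; simp [linFun]

lemma sigma_apply (x v : MSpace) : sigma F x v =
    (Phi F x)⁻¹ • (pair κ (F.triple v 1) (F.triple x 2) • F.triple x 0 +
      pair κ (F.triple v 2) (F.triple x 0) • F.triple x 1 +
      pair κ (F.triple v 0) (F.triple x 1) • F.triple x 2) := by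
  simp [sigma, linFun_eq]

lemma tau_apply (x v : MSpace) :
    tau F x v = (Phi F x)⁻¹ * pair κ (F.triple v 0) (F.triple x 0) := by
  simp [tau, linFun_eq]

lemma triple_gen0 (x : MSpace) (ξ : su2) (s : ℝ) : F.triple (gen F x ξ s) 0 =
    ⁅ξ, F.triple x 0⁆ + s • ⁅F.triple x 1, F.triple x 2⁆ := by
  rw [gen, F.triple_add, F.triple_smul, triple_hat, triple_gradPhi0]
lemma triple_gen1 (x : MSpace) (ξ : su2) (s : ℝ) : F.triple (gen F x ξ s) 1 =
    ⁅ξ, F.triple x 1⁆ + s • ⁅F.triple x 2, F.triple x 0⁆ := by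
  rw [gen, F.triple_add, F.triple_smul, triple_hat, triple_gradPhi1]
lemma triple_gen2 (x : MSpace) (ξ : su2) (s : ℝ) : F.triple (gen F x ξ s) 2 =
    ⁅ξ, F.triple x 2⁆ + s • ⁅F.triple x 0, F.triple x 1⁆ := by
  rw [gen, F.triple_add, F.triple_smul, triple_hat, triple_gradPhi2]

variable {F}

/-- Invariance gives ⟨[ξ, b], c⟩ = ⟨ξ, [b, c]⟩, and the part along X drops out because [c, a] is
orthogonal to c, and cyclically. `Phi_smul` then rebuilds ξ from these three pairings. -/
lemma sigma_gen {x : MSpace} (hx : Phi F x ≠ 0) (ξ : su2) (s : ℝ) :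
    sigma F x (gen F x ξ s) = ξ := by
  rw [sigma_apply, inv_smul_eq_iff₀ hx, Phi_smul, triple_gen0, triple_gen1, triple_gen2]
  simp only [pair_add_left, pair_smul_left, pair_lie,
    Frame.pair_lie_self_right, mul_zero, add_zero]

lemma tau_gen {x : MSpace} (hx : Phi F x ≠ 0) (ξ : su2) (s : ℝ) :
    tau F x (gen F x ξ s) = s := by
  rw [tau_apply, triple_gen0, pair_comm]
  simp only [pair_add_right, pair_smul_right, Frame.pair_lie_self_right, zero_add]
  rw [← Phi]; field_simp

lemma gen_injective {x : MSpace} (hx : Phi F x ≠ 0) {ξ η : su2} {s t : ℝ}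
    (h : gen F x ξ s = gen F x η t) : ξ = η ∧ s = t :=
  ⟨by rw [← sigma_gen hx ξ s, h, sigma_gen hx], by rw [← tau_gen hx ξ s, h, tau_gen hx]⟩

lemma mem_charSpace_iff_eq {x : MSpace} (hx : Phi F x ≠ 0) (v : MSpace) :
    v ∈ charSpace F x ↔ v = gen F x (sigma F x v) (tau F x v) := by
  rw [mem_charSpace_iff F hx]
  constructor
  · rintro ⟨ξ, s, rfl⟩; rw [sigma_gen hx, tau_gen hx]
  · intro h; exact ⟨_, _, h⟩

variable (F) in
/-- The map `(ξ, s) ↦ ξ̂ + s X`. -/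
def genL (x : MSpace) : (su2 × ℝ) →ₗ[ℝ] MSpace where
  toFun p := gen F x p.1 p.2
  map_add' p q := by simp only [gen, Prod.fst_add, Prod.snd_add, hat_add, add_smul]; abel
  map_smul' r p := by
    simp only [gen, Prod.smul_fst, Prod.smul_snd, hat_smul, smul_add, smul_smul, smul_eq_mul,
      RingHom.id_apply]

@[simp] lemma genL_apply (x : MSpace) (p : su2 × ℝ) : genL F x p = gen F x p.1 p.2 := rfl

lemma genL_injective {x : MSpace} (hx : Phi F x ≠ 0) : Function.Injective (genL F x) :=
  fun _ _ h => Prod.ext (gen_injective hx h).1 (gen_injective hx h).2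

lemma range_genL {x : MSpace} (hx : Phi F x ≠ 0) :
    (LinearMap.range (genL F x) : Set MSpace) = charSpace F x := by
  ext v
  rw [mem_charSpace_iff F hx]
  simp [eq_comm]

lemma finrank_range_genL {x : MSpace} (hx : Phi F x ≠ 0) :
    Module.finrank ℝ (LinearMap.range (genL F x)) = 4 := by
  rw [LinearMap.finrank_range_of_inj (genL_injective hx), Module.finrank_prod, F.finrank_su2]
  simp

/-- A tangent vector is determined by the 3 × 3 matrix ⟨vᵢ, aⱼ⟩. The hypotheses say that its
symmetric part is scalar; the antisymmetric part is then produced by σ and the common diagonal entry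
by τ. -/
lemma eq_gen_of_pair {x : MSpace} (hx : Phi F x ≠ 0) {v : MSpace}
    (h01 : pair κ (F.triple v 0) (F.triple x 1) + pair κ (F.triple v 1) (F.triple x 0) = 0)
    (h12 : pair κ (F.triple v 1) (F.triple x 2) + pair κ (F.triple v 2) (F.triple x 1) = 0)
    (h20 : pair κ (F.triple v 2) (F.triple x 0) + pair κ (F.triple v 0) (F.triple x 2) = 0)
    (h0 : pair κ (F.triple v 0) (F.triple x 0) = pair κ (F.triple v 1) (F.triple x 1))
    (h1 : pair κ (F.triple v 1) (F.triple x 1) = pair κ (F.triple v 2) (F.triple x 2)) :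
    v = gen F x (sigma F x v) (tau F x v) := by
  have key : ∀ u w : su2, (∀ i, pair κ u (F.triple x i) = pair κ w (F.triple x i)) → u = w := by
    intro u w h
    apply F.eq_of_pair
    intro ζ
    obtain ⟨p, q, r, rfl⟩ := exists_expand F hx ζ
    simp [h]
  have k0 : pair κ (F.triple x 0) ⁅F.triple x 1, F.triple x 2⁆ = Phi F x := rfl
  have k1 : pair κ (F.triple x 1) ⁅F.triple x 2, F.triple x 0⁆ = Phi F x := by
    rw [Phi, pair_cyc, pair_cyc]
  have k2 : pair κ (F.triple x 2) ⁅F.triple x 0, F.triple x 1⁆ = Phi F x := pair_cyc _ _ _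
  have e10 : ⁅F.triple x 1, F.triple x 0⁆ = -⁅F.triple x 0, F.triple x 1⁆ := (lie_skew _ _).symm
  have e21 : ⁅F.triple x 2, F.triple x 1⁆ = -⁅F.triple x 1, F.triple x 2⁆ := (lie_skew _ _).symm
  have e02 : ⁅F.triple x 0, F.triple x 2⁆ = -⁅F.triple x 2, F.triple x 0⁆ := (lie_skew _ _).symm
  replace h01 := eq_neg_of_add_eq_zero_right h01
  replace h12 := eq_neg_of_add_eq_zero_right h12
  replace h20 := eq_neg_of_add_eq_zero_right h20
  rw [← h0] at h1
  refine F.triple_injective fun i => key _ _ fun j => ?_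
  have hc : ∀ u v w : su2, pair κ ⁅u, v⁆ w = pair κ w ⁅u, v⁆ := fun u v w => pair_comm κ _ _
  fin_cases i <;> fin_cases j <;>
    simp only [Fin.zero_eta, Fin.mk_one, Fin.reduceFinMk, triple_gen0, triple_gen1, triple_gen2,
      sigma_apply, tau_apply, pair_add_left, pair_smul_left, smul_lie, add_lie, lie_self, e10, e21,
      e02, hc, pair_neg_left, pair_zero_left, k0, k1, k2, h01, h12, h20, ← h0, ← h1,
      Frame.pair_lie_self_left, Frame.pair_lie_self_right] <;>
    field_simp <;> ring

variable (F) in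
/-- The `su(2)`-valued two-form on `M_o` which induces `Ω` on the leaves. -/
def formE (x : MSpace) : MSpace →L[ℝ] MSpace →L[ℝ] su2 :=
  let T : MSpace →L[ℝ] MSpace →L[ℝ] su2 :=
    (ContinuousLinearMap.compL ℝ MSpace su2 su2).flip (sigma F x)
  T - T.flip + (ContinuousLinearMap.compL ℝ MSpace su2 su2 x).comp
    (lieCLM.bilinearComp (sigma F x) (sigma F x))

/-- These are the terms of d(x ∘ σ) after dσ(v, w) has been replaced by [σ v, σ w], as the
Maurer–Cartan equation permits on an integral manifold. -/
lemma formE_apply (x v w : MSpace) : formE F x v w =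
    v (sigma F x w) - w (sigma F x v) + x ⁅sigma F x v, sigma F x w⁆ := by
  simp [formE]

lemma formE_gen {x : MSpace} (hx : Phi F x ≠ 0) (ξ η : su2) (s t : ℝ) :
    formE F x (gen F x ξ s) (gen F x η t) =
      -x ⁅ξ, η⁆ + s • gradPhi F x η - t • gradPhi F x ξ := by
  rw [formE_apply, sigma_gen hx, sigma_gen hx]
  simp only [gen, add_apply, smul_apply, hat_apply]
  rw [← lie_skew, map_neg]
  abel

end Forms

/-! ### Cross products of values of X -/

section Cross
variable (T : Frame κ) (x : MSpace)

/-- With its two companions this says Φ · x[ξ, η] = Xξ × Xη: the cofactor map of the cofactor map is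
the determinant times x. -/
lemma Phi_mul_pair0 (ξ η : su2) : Phi T x * pair κ (T.vec 0) (x ⁅ξ, η⁆) =
    pair κ (T.vec 1) (gradPhi T x ξ) * pair κ (T.vec 2) (gradPhi T x η) -
    pair κ (T.vec 2) (gradPhi T x ξ) * pair κ (T.vec 1) (gradPhi T x η) := by
  rw [← T.pair_triple]
  simp only [Phi, gradPhi, T.pair_ofTriple, Matrix.cons_val_zero, Matrix.cons_val_one,
    Matrix.cons_val, T.pair_eq (T.triple x _) ⁅_, _⁆, T.pair_eq ⁅_, _⁆, T.pair_lie0, T.pair_lie1,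
    T.pair_lie2]
  ring

lemma Phi_mul_pair1 (ξ η : su2) : Phi T x * pair κ (T.vec 1) (x ⁅ξ, η⁆) =
    pair κ (T.vec 2) (gradPhi T x ξ) * pair κ (T.vec 0) (gradPhi T x η) -
    pair κ (T.vec 0) (gradPhi T x ξ) * pair κ (T.vec 2) (gradPhi T x η) := by
  rw [← T.pair_triple]
  simp only [Phi, gradPhi, T.pair_ofTriple, Matrix.cons_val_zero,
    Matrix.cons_val, T.pair_eq (T.triple x _) ⁅_, _⁆, T.pair_eq ⁅_, _⁆, T.pair_lie0, T.pair_lie1,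
    T.pair_lie2]
  ring

lemma Phi_mul_pair2 (ξ η : su2) : Phi T x * pair κ (T.vec 2) (x ⁅ξ, η⁆) =
    pair κ (T.vec 0) (gradPhi T x ξ) * pair κ (T.vec 1) (gradPhi T x η) -
    pair κ (T.vec 1) (gradPhi T x ξ) * pair κ (T.vec 0) (gradPhi T x η) := by
  rw [← T.pair_triple]
  simp only [Phi, gradPhi, T.pair_ofTriple, Matrix.cons_val_zero, Matrix.cons_val_one,
    T.pair_eq (T.triple x _) ⁅_, _⁆, T.pair_eq ⁅_, _⁆, T.pair_lie0, T.pair_lie1,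
    T.pair_lie2]
  ring

lemma A_eq_gradPhi (ξ η : su2) :
    A T x ξ η = (Phi T x)⁻¹ * pair κ (gradPhi T x ξ) (gradPhi T x η) := by
  rw [T.pair_eq (gradPhi T x ξ)]
  simp only [A, gradPhi, T.pair_ofTriple, Matrix.cons_val_zero, Matrix.cons_val_one,
    Matrix.cons_val, pair_comm κ ξ, pair_comm κ η]
  ring

end Cross

/-! ### The quadratic first integrals -/

section Integrals
variable (F : Frame κ)

/-- The function `⟨aᵢ, aⱼ⟩`. -/
def gram (i j : Fin 3) (x : MSpace) : ℝ := pair κ (F.triple x i) (F.triple x j)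

/-- The Gram matrix of `(a, b, c)` modulo multiples of the identity. -/
def integrals (x : MSpace) : Fin 5 → ℝ :=
  ![gram F 0 1 x, gram F 1 2 x, gram F 2 0 x, gram F 0 0 x - gram F 1 1 x,
    gram F 1 1 x - gram F 2 2 x]

/-- The derivative of `gram`. -/
def gramD (i j : Fin 3) (x : MSpace) : MSpace →L[ℝ] ℝ :=
  linFun F i (F.triple x j) + linFun F j (F.triple x i)

lemma gramD_apply (i j : Fin 3) (x v : MSpace) : gramD F i j x v =
    pair κ (F.triple v i) (F.triple x j) + pair κ (F.triple v j) (F.triple x i) := by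
  simp [gramD, linFun_eq]

/-- The derivative of `integrals`. -/
def integralsD (x : MSpace) : MSpace →L[ℝ] Fin 5 → ℝ :=
  ContinuousLinearMap.pi ![gramD F 0 1 x, gramD F 1 2 x, gramD F 2 0 x,
    gramD F 0 0 x - gramD F 1 1 x, gramD F 1 1 x - gramD F 2 2 x]

lemma hasFDerivAt_gram (i j : Fin 3) (x : MSpace) :
    HasFDerivAt (gram F i j) (gramD F i j x) x := by
  have e : gram F i j = fun x => ∑ k, linFun F i (F.vec k) x * linFun F j (F.vec k) x := by
    ext1 x
    rw [gram, F.pair_eq, Fin.sum_univ_three]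
    simp only [linFun_eq, pair_comm κ (F.triple x _) (F.vec _)]
  rw [e]
  have h := HasFDerivAt.fun_sum (u := Finset.univ) fun (k : Fin 3) _ =>
    ((linFun F i (F.vec k)).hasFDerivAt (x := x)).mul ((linFun F j (F.vec k)).hasFDerivAt (x := x))
  refine h.congr_fderiv ?_
  ext1 v
  rw [gramD_apply, F.pair_eq, F.pair_eq (F.triple v j), Fin.sum_univ_three]
  simp only [add_apply, smul_apply, linFun_eq, smul_eq_mul, pair_comm κ _ (F.vec _)]
  ring

lemma contDiff_gram (i j : Fin 3) : ContDiff ℝ ∞ (gram F i j) :=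
  contDiffOn_univ.1 ((contDiff_triple F i).contDiffOn.su2_pair (contDiff_triple F j).contDiffOn)

lemma contDiff_integrals : ContDiff ℝ ∞ (integrals F) := by
  rw [contDiff_pi]
  intro i
  have h := contDiff_gram F
  fin_cases i
  · exact h 0 1
  · exact h 1 2
  · exact h 2 0
  · exact (h 0 0).sub (h 1 1)
  · exact (h 1 1).sub (h 2 2)

lemma hasFDerivAt_integrals (x : MSpace) : HasFDerivAt (integrals F) (integralsD F x) x := by
  rw [hasFDerivAt_pi']
  have h := fun i j => hasFDerivAt_gram F i j x
  intro i
  fin_cases i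
  · exact h 0 1
  · exact h 1 2
  · exact h 2 0
  · exact (h 0 0).sub (h 1 1)
  · exact (h 1 1).sub (h 2 2)

variable {F}

/-- The adjoint action preserves all ⟨aᵢ, aⱼ⟩, while along sX the Gram matrix changes by 2sΦ times
the identity, which the five functions do not see. The converse is `eq_gen_of_pair`. -/
lemma mem_ker_integralsD {x : MSpace} (hx : Phi F x ≠ 0) (v : MSpace) :
    integralsD F x v = 0 ↔ v ∈ charSpace F x := by
  have k0 : pair κ (F.triple x 0) ⁅F.triple x 1, F.triple x 2⁆ = Phi F x := rfl
  have k1 : pair κ (F.triple x 1) ⁅F.triple x 2, F.triple x 0⁆ = Phi F x := by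
    rw [Phi, pair_cyc, pair_cyc]
  have k2 : pair κ (F.triple x 2) ⁅F.triple x 0, F.triple x 1⁆ = Phi F x := pair_cyc _ _ _
  constructor
  · intro h
    have h0 := congrFun h 0
    have h1 := congrFun h 1
    have h2 := congrFun h 2
    have h3 := congrFun h 3
    have h4 := congrFun h 4
    simp [integralsD, gramD_apply] at h0 h1 h2 h3 h4
    rw [mem_charSpace_iff_eq hx]
    apply eq_gen_of_pair hx <;> linarith
  · rw [mem_charSpace_iff F hx]
    rintro ⟨ξ, s, rfl⟩
    ext i
    have e10 : ⁅F.triple x 1, F.triple x 0⁆ = -⁅F.triple x 0, F.triple x 1⁆ :=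
      (lie_skew _ _).symm
    have e21 : ⁅F.triple x 2, F.triple x 1⁆ = -⁅F.triple x 1, F.triple x 2⁆ :=
      (lie_skew _ _).symm
    have e02 : ⁅F.triple x 0, F.triple x 2⁆ = -⁅F.triple x 2, F.triple x 0⁆ :=
      (lie_skew _ _).symm
    have hc : ∀ u v w : su2, pair κ ⁅u, v⁆ w = pair κ u ⁅v, w⁆ := fun u v w => pair_lie κ _ _ _
    fin_cases i <;>
      simp [integralsD, gramD_apply, triple_gen0, triple_gen1, triple_gen2, hc, e10, e21, e02,
        -lie_skew, Frame.pair_lie_self_left, k0, k1, k2]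

lemma integralsD_surjective {x : MSpace} (hx : Phi F x ≠ 0) :
    Function.Surjective (integralsD F x) := by
  intro y
  have k0 : pair κ ⁅F.triple x 1, F.triple x 2⁆ (F.triple x 0) = Phi F x := pair_comm κ _ _
  have k1 : pair κ ⁅F.triple x 2, F.triple x 0⁆ (F.triple x 1) = Phi F x := by
    rw [pair_comm, Phi, pair_cyc, pair_cyc]
  have k2 : pair κ ⁅F.triple x 0, F.triple x 1⁆ (F.triple x 2) = Phi F x := by
    rw [pair_comm]; exact pair_cyc _ _ _
  have z1 : ∀ u v : su2, pair κ ⁅u, v⁆ u = 0 := fun u v => by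
    rw [pair_comm, Frame.pair_lie_self_left]
  have z2 : ∀ u v : su2, pair κ ⁅u, v⁆ v = 0 := fun u v => by
    rw [pair_comm, Frame.pair_lie_self_right]
  -- The vectors [b, c]/Φ, [c, a]/Φ, [a, b]/Φ are dual to a, b, c, so each value can be prescribed
  -- separately. The halves compensate for the factor 2 in the derivative of ⟨aᵢ, aᵢ⟩.
  refine ⟨F.ofTriple fun i => (Phi F x)⁻¹ • (![y 0 • ⁅F.triple x 2, F.triple x 0⁆ +
    (y 3 / 2) • ⁅F.triple x 1, F.triple x 2⁆, y 1 • ⁅F.triple x 0, F.triple x 1⁆,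
    y 2 • ⁅F.triple x 1, F.triple x 2⁆ - (y 4 / 2) • ⁅F.triple x 0, F.triple x 1⁆] i), ?_⟩
  ext i
  fin_cases i <;>
    simp [integralsD, gramD_apply, -lie_skew, k0, k1, k2, z1, z2] <;> field_simp <;> ring

end Integrals

/-! ### Quaternionic linear algebra on a characteristic space -/

section Quaternionic
open scoped Quaternion RealInnerProductSpace

variable {E : Type*} [NormedAddCommGroup E] [NormedSpace ℝ E]

/-- The imaginary quaternion with coordinates of `ξ` in a frame. -/
def imQuat (T : Frame κ) (ξ : su2) : ℍ[ℝ] :=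
  ⟨0, pair κ (T.vec 0) ξ, pair κ (T.vec 1) ξ, pair κ (T.vec 2) ξ⟩

lemma imQuat_re (T : Frame κ) (ξ : su2) : (imQuat T ξ).re = 0 := rfl
lemma imQuat_imI (T : Frame κ) (ξ : su2) : (imQuat T ξ).imI = pair κ (T.vec 0) ξ := rfl
lemma imQuat_imJ (T : Frame κ) (ξ : su2) : (imQuat T ξ).imJ = pair κ (T.vec 1) ξ := rfl
lemma imQuat_imK (T : Frame κ) (ξ : su2) : (imQuat T ξ).imK = pair κ (T.vec 2) ξ := rfl

/-- Right multiplication by `-q`, transported to `E`. -/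
def rightMul (ψ : E ≃L[ℝ] ℍ[ℝ]) (q : ℍ[ℝ]) : E →L[ℝ] E :=
  (ψ.symm : ℍ[ℝ] →L[ℝ] E).comp
    (((ContinuousLinearMap.mul ℝ ℍ[ℝ]).flip (-q)).comp (ψ : E →L[ℝ] ℍ[ℝ]))

/-- Right multiplications compose in reverse order. The sign makes the composite for i, j, k equal
to v ↦ -vkji = -v, as required for IJK = -1. -/
lemma apply_rightMul (ψ : E ≃L[ℝ] ℍ[ℝ]) (q : ℍ[ℝ]) (v : E) :
    ψ (rightMul ψ q v) = -(ψ v * q) := by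
  simp [rightMul]

/-- The multiple by `c` of the metric transported from the quaternions. -/
lemma exists_metric [FiniteDimensional ℝ E] (ψ : E ≃L[ℝ] ℍ[ℝ]) {c : ℝ} (hc : c ≠ 0) :
    ∃ G : E ≃L[ℝ] (E →L[ℝ] ℝ), ∀ v w, G v w = c * inner ℝ (ψ v) (ψ w) := by
  let g : E →L[ℝ] (E →L[ℝ] ℝ) := c • (innerSL ℝ).bilinearComp (ψ : E →L[ℝ] ℍ[ℝ]) (ψ : E →L[ℝ] ℍ[ℝ])
  have hg : ∀ v w, g v w = c * inner ℝ (ψ v) (ψ w) := fun v w => by simp [g]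
  have hinj : Function.Injective g.toLinearMap := by
    rw [← LinearMap.ker_eq_bot, LinearMap.ker_eq_bot']
    intro v hv
    have h1 : g v v = 0 := by
      have := DFunLike.congr_fun (F := E →L[ℝ] ℝ) hv v
      simpa using this
    rw [hg] at h1
    have h2 : inner ℝ (ψ v) (ψ v) = 0 := by simpa [hc] using h1
    simpa using h2
  have hdim : Module.finrank ℝ E = Module.finrank ℝ (E →L[ℝ] ℝ) := by
    rw [← (LinearMap.toContinuousLinearMap (E := E) (F' := ℝ) (𝕜 := ℝ)).finrank_eq]
    exact (Subspace.dual_finrank_eq).symm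
  exact ⟨(LinearEquiv.ofInjectiveOfFinrankEq g.toLinearMap hinj hdim).toContinuousLinearEquiv, hg⟩

end Quaternionic

/-! ### The quaternionic structure of a single tangent space -/

section Pointwise
open scoped Quaternion

variable {E : Type*} [NormedAddCommGroup E] [NormedSpace ℝ E] {F : Frame κ}
  {x : MSpace} (hx : Phi F x ≠ 0) {D : E →L[ℝ] MSpace}
  (hinj : Function.Injective D) (hD : range D = charSpace F x)

variable (F x D) in
/-- The two-form `formE` on `E`, paired with `ξ`. -/
def formAt (ξ : su2) : E →L[ℝ] E →L[ℝ] ℝ :=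
  (ContinuousLinearMap.compL ℝ E su2 ℝ (pairCLM κ ξ)).comp ((formE F x).bilinearComp D D)

lemma formAt_apply (ξ : su2) (v w : E) :
    formAt F x D ξ v w = pair κ ξ (formE F x (D v) (D w)) := by simp [formAt]

include hx hD in
lemma apply_eq_gen (v : E) : D v = gen F x (sigma F x (D v)) (tau F x (D v)) := by
  rw [← mem_charSpace_iff_eq hx, ← hD]; exact mem_range_self v

include hx hD in
lemma exists_eq_gen (ξ : su2) (s : ℝ) : ∃ v, D v = gen F x ξ s := by
  have : gen F x ξ s ∈ range D := by rw [hD, mem_charSpace_iff F hx]; exact ⟨_, _, rfl⟩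
  exact this

include hx hinj hD in
lemma finrank_eq_four : Module.finrank ℝ E = 4 := by
  have h : LinearMap.range D.toLinearMap = LinearMap.range (genL F x) := by
    apply SetLike.coe_injective
    rw [range_genL hx, ← hD]; rfl
  rw [← LinearMap.finrank_range_of_inj (f := D.toLinearMap) hinj, h, finrank_range_genL hx]

/-- The quaternion with real part `Φ s` and imaginary part `X(ξ)`. -/
def quat (F T : Frame κ) (x v : MSpace) : ℍ[ℝ] :=
  ⟨Phi F x * tau F x v, pair κ (T.vec 0) (gradPhi F x (sigma F x v)),
    pair κ (T.vec 1) (gradPhi F x (sigma F x v)), pair κ (T.vec 2) (gradPhi F x (sigma F x v))⟩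

lemma quat_re (F T : Frame κ) (x v : MSpace) : (quat F T x v).re = Phi F x * tau F x v := rfl
lemma quat_imI (F T : Frame κ) (x v : MSpace) :
    (quat F T x v).imI = pair κ (T.vec 0) (gradPhi F x (sigma F x v)) := rfl
lemma quat_imJ (F T : Frame κ) (x v : MSpace) :
    (quat F T x v).imJ = pair κ (T.vec 1) (gradPhi F x (sigma F x v)) := rfl
lemma quat_imK (F T : Frame κ) (x v : MSpace) :
    (quat F T x v).imK = pair κ (T.vec 2) (gradPhi F x (sigma F x v)) := rfl

include hx in
-- The coordinates of X(u) are the pairings of u with [b, c], [c, a], [a, b], and by `Phi_smul`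
-- these determine Φu.
lemma gradPhi_injective : Function.Injective (gradPhi F x) := by
  intro u w h
  apply F.eq_of_pair
  intro ζ
  have key : ∀ u, ∀ i, pair κ ⁅F.triple x (i + 1), F.triple x (i + 2)⁆ u =
      pair κ (F.vec i) (gradPhi F x u) := by
    intro u i
    rw [gradPhi, F.pair_ofTriple]
    fin_cases i <;> rfl
  have h' := Phi_smul F x
  have e : Phi F x • u = Phi F x • w := by
    rw [h' u, h' w]
    simp only [pair_comm κ u, pair_comm κ w]
    have a0 := key u 0
    have a1 := key u 1
    have a2 := key u 2
    have b0 := key w 0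
    have b1 := key w 1
    have b2 := key w 2
    rw [h] at a0 a1 a2
    simp only [Fin.isValue, zero_add, Fin.reduceAdd] at a0 a1 a2 b0 b1 b2
    rw [a0, a1, a2, b0, b1, b2]
  rw [smul_right_injective su2 hx e]

include hx hinj hD in
lemma exists_quat_equiv [FiniteDimensional ℝ E] (T : Frame κ) :
    ∃ ψ : E ≃L[ℝ] ℍ[ℝ], ∀ v, ψ v = quat F T x (D v) := by
  let f : E →ₗ[ℝ] ℍ[ℝ] :=
    { toFun := fun v => quat F T x (D v)
      map_add' := fun v w => by ext <;> simp [quat_re, quat_imI, quat_imJ, quat_imK, mul_add]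
      map_smul' := fun r v => by ext <;> simp [quat_re, quat_imI, quat_imJ, quat_imK]; ring }
  have hf : Function.Injective f := by
    rw [← LinearMap.ker_eq_bot, LinearMap.ker_eq_bot']
    intro v hv
    have h0 : Phi F x * tau F x (D v) = 0 := congrArg QuaternionAlgebra.re hv
    have h1 : pair κ (T.vec 0) (gradPhi F x (sigma F x (D v))) = 0 :=
      congrArg QuaternionAlgebra.imI hv
    have h2 : pair κ (T.vec 1) (gradPhi F x (sigma F x (D v))) = 0 :=
      congrArg QuaternionAlgebra.imJ hv
    have h3 : pair κ (T.vec 2) (gradPhi F x (sigma F x (D v))) = 0 :=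
      congrArg QuaternionAlgebra.imK hv
    have hs : tau F x (D v) = 0 := by simpa [hx] using h0
    have hX : gradPhi F x (sigma F x (D v)) = 0 := by
      rw [T.expand (gradPhi F x _), h1, h2, h3]; simp
    have hσ : sigma F x (D v) = 0 := gradPhi_injective hx (by rw [hX, map_zero])
    apply hinj
    rw [apply_eq_gen hx hD v, hs, hσ]
    ext1 ζ; simp [gen, hat_apply]
  have hdim : Module.finrank ℝ E = Module.finrank ℝ ℍ[ℝ] := by
    rw [finrank_eq_four hx hinj hD, Quaternion.finrank_eq_four]
  exact ⟨(LinearEquiv.ofInjectiveOfFinrankEq f hf hdim).toContinuousLinearEquiv, fun v => rfl⟩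

include hx hD in
-- In the quaternionic product the real parts give the terms with s and t. The imaginary parts give
-- -⟨ξ, Xζ × Xη⟩, which is -Φ⟨ξ, x[ζ, η]⟩.
lemma formAt_eq {T : Frame κ} (hT : T.mu = F.mu) (ξ : su2) (v w : E) : formAt F x D ξ v w =
    (Phi F x)⁻¹ * inner ℝ (quat F T x (D v) * imQuat T ξ) (quat F T x (D w)) := by
  rw [formAt_apply]
  have hv := apply_eq_gen hx hD v
  have hw := apply_eq_gen hx hD w
  generalize sigma F x (D v) = ζ, tau F x (D v) = s at hv
  generalize sigma F x (D w) = η, tau F x (D w) = t at hw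
  rw [hv, hw, formE_gen hx]
  have h0 := Phi_mul_pair0 T x ζ η
  have h1 := Phi_mul_pair1 T x ζ η
  have h2 := Phi_mul_pair2 T x ζ η
  rw [Phi_eq hT, gradPhi_eq hT] at h0 h1 h2
  rw [eq_inv_mul_iff_mul_eq₀ hx, T.pair_eq]
  simp only [Quaternion.inner_def, quat_re, quat_imI, quat_imJ, quat_imK,
    imQuat_re, imQuat_imI, imQuat_imJ, imQuat_imK, sigma_gen hx, tau_gen hx, pair_sub_right,
    pair_add_right, pair_smul_right, pair_neg_right, Quaternion.re_mul, Quaternion.imI_mul,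
    Quaternion.imJ_mul, Quaternion.imK_mul, Quaternion.re_star, Quaternion.imI_star,
    Quaternion.imJ_star, Quaternion.imK_star]
  linear_combination (-pair κ (T.vec 0) ξ) * h0 - pair κ (T.vec 1) ξ * h1 -
    pair κ (T.vec 2) ξ * h2

/-- The quaternionic structure of a characteristic space. -/
structure QuatData (F T : Frame κ) (x : MSpace) (D : E →L[ℝ] MSpace) where
  /-- the metric -/
  G : E ≃L[ℝ] (E →L[ℝ] ℝ)
  /-- the complex structures -/
  ρ : su2 → E →L[ℝ] E
  form : ∀ ξ, formAt F x D ξ = (G : E →L[ℝ] (E →L[ℝ] ℝ)).comp (ρ ξ)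
  metric : ∀ v w, G v w = -(Phi F x)⁻¹ * (Phi F x * tau F x (D v) * (Phi F x * tau F x (D w)) +
    pair κ (gradPhi F x (sigma F x (D v))) (gradPhi F x (sigma F x (D w))))
  square : ∀ ξ v, ρ ξ (ρ ξ v) = -(pair κ ξ ξ • v)
  linear : ∀ (a b : ℝ) ξ η, ρ (a • ξ + b • η) = a • ρ ξ + b • ρ η
  quaternion : ∀ v, ρ (T.vec 0) (ρ (T.vec 1) (ρ (T.vec 2) v)) = -v
  isometry : ∀ ξ v w, G (ρ ξ v) (ρ ξ w) = pair κ ξ ξ * G v w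

include hx hinj hD in
lemma nonempty_quatData [FiniteDimensional ℝ E] {T : Frame κ} (hT : T.mu = F.mu) :
    Nonempty (QuatData F T x D) := by
  obtain ⟨ψ, hψ⟩ := exists_quat_equiv hx hinj hD T
  -- The minus sign in -Φ⁻¹ cancels the one built into `rightMul`, so that ω_ξ = Gρ_ξ.
  obtain ⟨G, hG⟩ := exists_metric ψ (neg_ne_zero.2 (inv_ne_zero hx))
  refine ⟨⟨G, fun ξ => rightMul ψ (imQuat T ξ), ?_, ?_, ?_, ?_, ?_, ?_⟩⟩
  · intro ξ
    ext v w
    rw [formAt_eq hx hD hT]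
    simp only [ContinuousLinearMap.comp_apply, ContinuousLinearEquiv.coe_coe, hG, apply_rightMul,
      inner_neg_left, ← hψ]
    ring
  · intro v w
    rw [hG, hψ, hψ, T.pair_eq]
    congr 1
    simp [Quaternion.inner_def, quat_re, quat_imI, quat_imJ, quat_imK]
    ring
  · intro ξ v
    apply ψ.injective
    rw [apply_rightMul, apply_rightMul, map_neg, map_smul, T.pair_eq]
    ext <;> simp [imQuat_re, imQuat_imI, imQuat_imJ, imQuat_imK] <;> ring
  · intro a b ξ η
    ext1 v
    apply ψ.injective
    simp only [add_apply, smul_apply, map_add, map_smul, apply_rightMul]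
    ext <;> simp [imQuat_re, imQuat_imI, imQuat_imJ, imQuat_imK] <;> ring
  · intro v
    apply ψ.injective
    rw [apply_rightMul, apply_rightMul, apply_rightMul, map_neg]
    ext <;> simp [imQuat_re, imQuat_imI, imQuat_imJ, imQuat_imK, T.pair_vec]
  · intro ξ v w
    rw [hG, hG, apply_rightMul, apply_rightMul, T.pair_eq]
    simp [Quaternion.inner_def, imQuat_re, imQuat_imI, imQuat_imJ, imQuat_imK]
    ring

namespace QuatData
variable {T : Frame κ} (Q : QuatData F T x D)

/-- Since ω_ξ = Gρ_ξ and ρ_ξ² = -|ξ|², the inverse is -|ξ|⁻²ρ_ξG⁻¹. On unit vectors the factor is 1,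
whence the hypersymplectic linearity. -/
lemma inverse_formAt {ξ : su2} (hξ : pair κ ξ ξ ≠ 0) : (formAt F x D ξ).IsInvertible ∧
    (formAt F x D ξ).inverse =
      -((pair κ ξ ξ)⁻¹ • (Q.ρ ξ).comp (Q.G.symm : (E →L[ℝ] ℝ) →L[ℝ] E)) := by
  have h1 : (formAt F x D ξ).comp
      (-((pair κ ξ ξ)⁻¹ • (Q.ρ ξ).comp (Q.G.symm : (E →L[ℝ] ℝ) →L[ℝ] E))) = .id _ _ := by
    ext1 α
    rw [Q.form]
    simp [Q.square, smul_smul, hξ]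
  have h2 : (-((pair κ ξ ξ)⁻¹ • (Q.ρ ξ).comp (Q.G.symm : (E →L[ℝ] ℝ) →L[ℝ] E))).comp
      (formAt F x D ξ) = .id _ _ := by
    ext1 v
    rw [Q.form]
    simp [Q.square, smul_smul, hξ]
  exact ⟨.of_inverse h1 h2, ContinuousLinearMap.inverse_eq h1 h2⟩

lemma inverse_formAt_of_unit {ξ : su2} (hξ : pair κ ξ ξ = 1) :
    (formAt F x D ξ).inverse = -(Q.ρ ξ).comp (Q.G.symm : (E →L[ℝ] ℝ) →L[ℝ] E) := by
  rw [(Q.inverse_formAt (by rw [hξ]; norm_num)).2, hξ]; simp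

lemma square_vec (i : Fin 3) (v : E) : Q.ρ (T.vec i) (Q.ρ (T.vec i) v) = -v := by
  rw [Q.square, T.pair_vec]; simp

/-- Conjugating IJK = -1 by K permutes the factors cyclically. -/
lemma quaternion' (v : E) : Q.ρ (T.vec 2) (Q.ρ (T.vec 0) (Q.ρ (T.vec 1) v)) = -v := by
  have h := congrArg (Q.ρ (T.vec 2)) (Q.quaternion (Q.ρ (T.vec 2) v))
  rw [Q.square_vec] at h
  simp only [map_neg, Q.square_vec] at h
  simpa using congrArg Neg.neg h

/-- Gρ₃ · (-ρ₁G⁻¹) · Gρ₂ = -Gρ₃ρ₁ρ₂ = G. -/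
lemma pseudoMetric_eq : (formAt F x D (T.vec 2)).comp
    ((formAt F x D (T.vec 0)).inverse.comp (formAt F x D (T.vec 1))) =
      (Q.G : E →L[ℝ] (E →L[ℝ] ℝ)) := by
  rw [Q.inverse_formAt_of_unit (by simp [T.pair_vec]), Q.form, Q.form]
  ext1 v
  simp [Q.quaternion']

lemma almostComplex_eq (ξ : su2) :
    (Q.G : E →L[ℝ] (E →L[ℝ] ℝ)).inverse.comp (formAt F x D ξ) = Q.ρ ξ := by
  rw [Q.form, ContinuousLinearMap.inverse_equiv]
  ext1 v
  simp

end QuatData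

include hx hD in
-- Covectors with the same image under `π^#` agree on tangent vectors, so α may be replaced by the
-- explicit preimage from `exists_isSharp_gen`.
lemma formAt_induced {T : Frame κ} (hT : T.mu = F.mu) {v w : E} {α : MSpace →L[ℝ] ℝ}
    (h : IsSharp T x α (D v)) : formAt F x D (T.vec 0) v w = α (D w) := by
  have hx' : Phi T x ≠ 0 := by rwa [Phi_eq hT]
  have hc : ∀ u, D u ∈ charSpace T x := fun u => by
    rw [charSpace_eq hT hx, ← hD]; exact mem_range_self u
  have hv := apply_eq_gen hx hD v
  obtain ⟨α', h1, h2⟩ := exists_isSharp_gen T hx' (sigma F x (D v)) (tau F x (D v))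
  rw [gen_eq hT, ← hv] at h1
  rw [covec_eq_on_charSpace T h h1 (hc w), h2, formAt_apply]
  have hw := apply_eq_gen hx hD w
  generalize sigma F x (D v) = ζ, tau F x (D v) = s at hv
  generalize sigma F x (D w) = η, tau F x (D w) = t at hw
  rw [hv, hw, formE_gen hx]
  have e1 : pair κ (T.vec 1) (gen F x η t (T.triple x 2)) =
      pair κ (T.vec 0) (gradPhi F x η) := by
    rw [← gen_eq hT, ← gradPhi_eq hT, ← T.pair_triple, triple_gen1, gradPhi, T.pair_ofTriple]
    simp only [pair_add_left, pair_smul_left, pair_lie, Frame.pair_lie_self_right, mul_zero,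
      add_zero, Matrix.cons_val_zero]
    rw [pair_comm, pair_lie]
  rw [e1]
  simp only [gen, add_apply, smul_apply, hat_apply, pair_add_right, pair_sub_right,
    pair_smul_right, pair_neg_right]
  rw [← lie_skew ζ η, map_neg, pair_neg_right]
  ring

end Pointwise

/-! ### The Nijenhuis tensor in a vector space -/

section VectorSpace
open Filter Topology VectorField
variable {E : Type*} [NormedAddCommGroup E] [NormedSpace ℝ E]

/-- The Nijenhuis tensor of an almost complex structure in terms of its derivative. -/
lemma nijenhuis_eq {J : E → E →L[ℝ] E} {X Y : E → E} {u : E} (hJ : DifferentiableAt ℝ J u)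
    (hX : DifferentiableAt ℝ X u) (hY : DifferentiableAt ℝ Y u) (hJ2 : ∀ v, J u (J u v) = -v) :
    lieBracket ℝ (fun z => J z (X z)) (fun z => J z (Y z)) u
      - J u (lieBracket ℝ (fun z => J z (X z)) Y u)
      - J u (lieBracket ℝ X (fun z => J z (Y z)) u) - lieBracket ℝ X Y u =
    fderiv ℝ J u (J u (X u)) (Y u) - fderiv ℝ J u (J u (Y u)) (X u)
      + J u (fderiv ℝ J u (Y u) (X u)) - J u (fderiv ℝ J u (X u) (Y u)) := by
  have h1 : ∀ {X : E → E}, DifferentiableAt ℝ X u → ∀ v, fderiv ℝ (fun z => J z (X z)) u v =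
      fderiv ℝ J u v (X u) + J u (fderiv ℝ X u v) := by
    intro X hX v
    rw [fderiv_clm_apply hJ hX]
    simp [add_comm]
  simp only [lieBracket_eq, h1 hX, h1 hY, map_sub, map_add, hJ2]
  abel

/-- Hitchin's lemma: if `b(v, w) = a(J v, w)` for closed two-forms `a` and `b`, with `a`
nondegenerate and `J² = -1`, then the Nijenhuis tensor of `J` vanishes. -/
lemma nijenhuis_eq_zero {J : E → E →L[ℝ] E} {a b : E → E →L[ℝ] E →L[ℝ] ℝ} {u : E}
    (hJ : DifferentiableAt ℝ J u) (ha : DifferentiableAt ℝ a u)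
    (hJ2 : ∀ᶠ z in 𝓝 u, ∀ v, J z (J z v) = -v) (hab : ∀ᶠ z in 𝓝 u, ∀ v w, b z v w = a z (J z v) w)
    (ha0 : ∀ᶠ z in 𝓝 u, ∀ v, a z v v = 0) (hb0 : ∀ᶠ z in 𝓝 u, ∀ v, b z v v = 0)
    (hda : ∀ v w z, fderiv ℝ a u v w z + fderiv ℝ a u w z v + fderiv ℝ a u z v w = 0)
    (hdb : ∀ v w z, fderiv ℝ b u v w z + fderiv ℝ b u w z v + fderiv ℝ b u z v w = 0)
    (hinj : Function.Injective (a u)) (v w : E) :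
    fderiv ℝ J u (J u v) w - fderiv ℝ J u (J u w) v
      + J u (fderiv ℝ J u w v) - J u (fderiv ℝ J u v w) = 0 := by
  have hb : DifferentiableAt ℝ b u := by
    have e : b =ᶠ[𝓝 u] fun z => (a z).comp (J z) := by
      filter_upwards [hab] with z hz
      ext v w
      simp [hz]
    exact (ha.clm_comp hJ).congr_of_eventuallyEq e
  have happ : ∀ {c : E → E →L[ℝ] E →L[ℝ] ℝ}, DifferentiableAt ℝ c u → ∀ v w z,
      fderiv ℝ (fun t => c t v w) u z = fderiv ℝ c u z v w := by
    intro c hc v w z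
    rw [fderiv_clm_apply (hc.clm_apply (differentiableAt_const v)) (differentiableAt_const w),
      fderiv_clm_apply hc (differentiableAt_const v)]
    simp
  have skew : ∀ {c : E → E →L[ℝ] E →L[ℝ] ℝ}, (∀ᶠ z in 𝓝 u, ∀ v, c z v v = 0) →
      ∀ᶠ z in 𝓝 u, ∀ v w, c z v w = -c z w v := by
    intro c hc
    filter_upwards [hc] with z hz v w
    have := hz (v + w)
    simp only [map_add, add_apply, hz, zero_add, add_zero] at this
    linarith
  have skewD : ∀ {c : E → E →L[ℝ] E →L[ℝ] ℝ}, DifferentiableAt ℝ c u →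
      (∀ᶠ z in 𝓝 u, ∀ v, c z v v = 0) → ∀ z v w, fderiv ℝ c u z v w = -fderiv ℝ c u z w v := by
    intro c hc h0 z v w
    have e : (fun t => c t v w) =ᶠ[𝓝 u] fun t => -c t w v := by
      filter_upwards [skew h0] with t ht using ht v w
    rw [← happ hc, ← happ hc, e.fderiv_eq, fderiv_fun_neg]
    rfl
  have saD := skewD ha ha0
  have sbD := skewD hb hb0
  have sa := (skew ha0).self_of_nhds
  have sb := (skew hb0).self_of_nhds
  have hab' := hab.self_of_nhds
  have hJ2' := hJ2.self_of_nhds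
  -- Differentiating J² = -1: each derivative of J anticommutes with J.
  have hJD : ∀ z v, fderiv ℝ J u z (J u v) = -J u (fderiv ℝ J u z v) := by
    intro z v
    have e : (fun t => J t (J t v)) =ᶠ[𝓝 u] fun _ => -v := by
      filter_upwards [hJ2] with t ht using ht v
    have h := e.fderiv_eq (𝕜 := ℝ)
    rw [fderiv_clm_apply hJ (hJ.clm_apply (differentiableAt_const v)),
      fderiv_clm_apply hJ (differentiableAt_const v)] at h
    have := DFunLike.congr_fun (F := E →L[ℝ] E) h z
    simp at this
    exact (neg_eq_of_add_eq_zero_right this).symm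
  have hbD : ∀ z v w, fderiv ℝ b u z v w =
      fderiv ℝ a u z (J u v) w + a u (fderiv ℝ J u z v) w := by
    intro z v w
    have e : (fun t => b t v w) =ᶠ[𝓝 u] fun t => a t (J t v) w := by
      filter_upwards [hab] with t ht using ht v w
    rw [← happ hb, e.fderiv_eq, fderiv_clm_apply
      (ha.clm_apply (hJ.clm_apply (differentiableAt_const v))) (differentiableAt_const w),
      fderiv_clm_apply ha (hJ.clm_apply (differentiableAt_const v)),
      fderiv_clm_apply hJ (differentiableAt_const v)]
    simp [add_comm]
  -- Both a and b = a(J·, ·) are skew, so J is self-adjoint for a.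
  have hmove : ∀ v w, a u (J u v) w = a u v (J u w) := by
    intro v w
    rw [← hab', sb, hab', sa, neg_neg]
  -- This is the derivative of a(Jv, Jw) = -a(v, w).
  have hD4 : ∀ z v w, fderiv ℝ a u z (J u v) (J u w) + a u (fderiv ℝ J u z v) (J u w) +
      a u (J u v) (fderiv ℝ J u z w) = -fderiv ℝ a u z v w := by
    intro z v w
    have h := sbD z v (J u w)
    rw [hbD, hbD, hJ2', hJD, map_neg, map_neg] at h
    simp only [neg_apply] at h
    rw [hmove (fderiv ℝ J u z w), sa (fderiv ℝ J u z w), saD z w v] at h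
    linarith
  apply hinj
  rw [map_zero]
  ext z
  -- The Nijenhuis vector is tested against z under a. Closedness of b on (Jv, w, z) and (Jw, v, z),
  -- and of a on (Jv, Jw, z) and (v, w, z), combine so that all derivatives of a cancel.
  have e1 := hdb (J u v) w z
  have e2 := hdb (J u w) v z
  rw [sbD w z] at e1
  rw [sbD v z] at e2
  rw [hbD, hbD, hbD, hJ2', hJD, hJD] at e1 e2
  have e3 := hda (J u v) (J u w) z
  rw [saD (J u w) z] at e3
  have e4 := hda v w z
  rw [saD w z] at e4
  have e5 := hD4 z v w
  have e6 := hmove (fderiv ℝ J u z v) w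
  have e7 := hmove (fderiv ℝ J u z w) v
  have e8 := sa (fderiv ℝ J u z w) (J u v)
  have e9 := saD z w v
  simp only [map_neg, neg_apply] at e1 e2
  simp only [map_add, map_sub, add_apply, sub_apply, zero_apply]
  linarith

end VectorSpace

/-! ### Tensor fields in charts -/

section Charts
open Filter Topology VectorField
variable {d : ℕ} {S : Type} [TopologicalSpace S] [ChartedSpace (Eu d) S]

/-- The derivative of the inverse of a chart. -/
def chartD (e : OpenPartialHomeomorph S (Eu d)) (u : Eu d) : Eu d →L[ℝ] Eu d :=
  mfderiv 𝓘(ℝ, Eu d) 𝓘(ℝ, Eu d) e.symm u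

lemma inChart_apply {V : Type} [NormedAddCommGroup V] [NormedSpace ℝ V] (θ : BilField d S V)
    (e : OpenPartialHomeomorph S (Eu d)) (u v w : Eu d) :
    inChart θ e u v w = θ (e.symm u) (chartD e u v) (chartD e u w) := rfl

/-- The expression of a field of endomorphisms in a chart. -/
def inChartEnd (J : EndField d S) (e : OpenPartialHomeomorph S (Eu d)) (u : Eu d) :
    Eu d →L[ℝ] Eu d :=
  (chartD e u).inverse.comp ((show Eu d →L[ℝ] Eu d from J (e.symm u)).comp (chartD e u))

variable [IsManifold 𝓘(ℝ, Eu d) ∞ S]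

lemma isInvertible_chartD {e : OpenPartialHomeomorph S (Eu d)} (he : e ∈ atlas (Eu d) S)
    {u : Eu d} (hu : u ∈ e.target) : (chartD e u).IsInvertible := by
  have : IsManifold 𝓘(ℝ, Eu d) 1 S := .of_le (n := ∞) (by simp)
  have h := (mdifferentiable_of_mem_atlas (I := 𝓘(ℝ, Eu d)) he).symm
  exact ⟨h.mfderiv hu, rfl⟩

/-- Identifies chart expressions with coordinates in the trivialised tangent bundle, so that
smoothness of tensor fields can be tested in charts. -/
lemma chartD_eq_symmL {p q : S} (hq : q ∈ (chartAt (Eu d) p).source) :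
    chartD (chartAt (Eu d) p) (chartAt (Eu d) p q) =
      (trivializationAt (Eu d) (TangentSpace 𝓘(ℝ, Eu d)) p).symmL ℝ q := by
  have : IsManifold 𝓘(ℝ, Eu d) 1 S := .of_le (n := ∞) (by simp)
  rw [TangentBundle.symmL_trivializationAt hq]
  simp [chartD, mfld_simps]
  rfl

lemma chartD_self (p : S) :
    chartD (chartAt (Eu d) p) (chartAt (Eu d) p p) = ContinuousLinearMap.id ℝ (Eu d) := by
  have : IsManifold 𝓘(ℝ, Eu d) 1 S := .of_le (n := ∞) (by simp)
  have := mfderivWithin_range_extChartAt_symm (I := 𝓘(ℝ, Eu d)) (x := p)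
  simp only [mfld_simps] at this
  exact this

end Charts

/-! ### Smooth tensor fields, Lie brackets and integrability on a manifold -/

section Sections
open Filter Topology VectorField
variable {d : ℕ} {S : Type} [TopologicalSpace S] [ChartedSpace (Eu d) S]
  [IsManifold 𝓘(ℝ, Eu d) ∞ S]

lemma contMDiffAt_of_chart {V : Type*} [NormedAddCommGroup V] [NormedSpace ℝ V] {f : Eu d → V}
    {p : S} (hf : ContDiffOn ℝ ∞ f (chartAt (Eu d) p).target) :
    ContMDiffAt 𝓘(ℝ, Eu d) 𝓘(ℝ, V) ∞ (fun q => f (chartAt (Eu d) p q)) p := by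
  have h1 : ContMDiffAt 𝓘(ℝ, Eu d) 𝓘(ℝ, Eu d) ∞ (chartAt (Eu d) p) p :=
    contMDiffAt_of_mem_maximalAtlas (IsManifold.chart_mem_maximalAtlas p) (mem_chart_source _ p)
  have h2 : ContDiffAt ℝ ∞ f (chartAt (Eu d) p p) :=
    hf.contDiffAt ((chartAt (Eu d) p).open_target.mem_nhds (mem_chart_target _ p))
  exact h2.contMDiffAt.comp p h1

/-- A field of bilinear forms is smooth if its expressions in charts are. -/
lemma contMDiff_bilField {θ : BilField d S ℝ}
    (h : ∀ e ∈ atlas (Eu d) S, ContDiffOn ℝ ∞ (inChart θ e) e.target) :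
    ContMDiff 𝓘(ℝ, Eu d) (𝓘(ℝ, Eu d).prod 𝓘(ℝ, Eu d →L[ℝ] Eu d →L[ℝ] ℝ)) ∞
      (fun p => Bundle.TotalSpace.mk' (Eu d →L[ℝ] Eu d →L[ℝ] ℝ)
        (E := fun p : S => Tg d p →L[ℝ] Tg d p →L[ℝ] ℝ) p (θ p)) := by
  intro p
  rw [contMDiffAt_hom_bundle]
  refine ⟨contMDiffAt_id, (contMDiffAt_of_chart
    (h _ (chart_mem_atlas _ p))).congr_of_eventuallyEq ?_⟩
  filter_upwards [(chartAt (Eu d) p).open_source.mem_nhds (mem_chart_source _ p)] with q hq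
  ext v w
  rw [inChart_apply, chartD_eq_symmL hq]
  have h3 : ∀ q' : S, q' = q → ∀ v w : Eu d, (show Eu d →L[ℝ] Eu d →L[ℝ] ℝ from θ q') v w =
      (show Eu d →L[ℝ] Eu d →L[ℝ] ℝ from θ q) v w := by
    rintro _ rfl _ _; rfl
  refine (inCoordinates_apply_eq₂ (E₃ := fun _ : S => ℝ) ?_ ?_ ?_).trans
    (.trans ?_ (h3 _ ((chartAt (Eu d) p).left_inv hq) _ _).symm)
  · simpa using hq
  · simpa using hq
  · simp
  · have hs : ∀ v : Eu d, (trivializationAt (Eu d) (TangentSpace 𝓘(ℝ, Eu d)) p).symm q v =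
        (trivializationAt (Eu d) (TangentSpace 𝓘(ℝ, Eu d)) p).symmL ℝ q v := fun v =>
      (Bundle.Trivialization.symmL_apply _ (by simpa using hq) v).symm
    refine .trans ?_ (congrArg₂ (fun a b : Eu d => (show Eu d →L[ℝ] Eu d →L[ℝ] ℝ from θ q) a b)
      (hs v) (hs w))
    simp
    rfl

/-- A field of endomorphisms is smooth if its expressions in charts are. -/
lemma contMDiff_endField {J : EndField d S}
    (h : ∀ e ∈ atlas (Eu d) S, ContDiffOn ℝ ∞ (inChartEnd J e) e.target) :
    ContMDiff 𝓘(ℝ, Eu d) (𝓘(ℝ, Eu d).prod 𝓘(ℝ, Eu d →L[ℝ] Eu d)) ∞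
      (fun p => Bundle.TotalSpace.mk' (Eu d →L[ℝ] Eu d)
        (E := fun p : S => Tg d p →L[ℝ] Tg d p) p (J p)) := by
  intro p
  rw [contMDiffAt_hom_bundle]
  refine ⟨contMDiffAt_id, (contMDiffAt_of_chart
    (h _ (chart_mem_atlas _ p))).congr_of_eventuallyEq ?_⟩
  filter_upwards [(chartAt (Eu d) p).open_source.mem_nhds (mem_chart_source _ p)] with q hq
  have hb : q ∈ (trivializationAt (Eu d) (TangentSpace 𝓘(ℝ, Eu d)) p).baseSet := by simpa using hq
  have hinv : (chartD (chartAt (Eu d) p) (chartAt (Eu d) p q)).inverse =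
      (trivializationAt (Eu d) (TangentSpace 𝓘(ℝ, Eu d)) p).continuousLinearMapAt ℝ q := by
    rw [chartD_eq_symmL hq]
    apply ContinuousLinearMap.inverse_eq
    · ext1 v
      exact Bundle.Trivialization.symmL_continuousLinearMapAt _ hb v
    · ext1 v
      exact Bundle.Trivialization.continuousLinearMapAt_symmL _ hb v
  rw [inChartEnd, hinv, chartD_eq_symmL hq, (chartAt (Eu d) p).left_inv hq]
  rfl

/-- The expression of a vector field in a chart. -/
def inChartField (X : ∀ p : S, Tg d p) (e : OpenPartialHomeomorph S (Eu d)) (u : Eu d) : Eu d :=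
  (chartD e u).inverse (X (e.symm u))

/-- The preferred chart at p has identity derivative at p in the tangent coordinates, so no outer
linear map appears. -/
lemma mlieBracket_eq (X Y : ∀ p : S, Tg d p) (p : S) :
    mlieBracket 𝓘(ℝ, Eu d) X Y p =
      lieBracket ℝ (inChartField X (chartAt (Eu d) p)) (inChartField Y (chartAt (Eu d) p))
        (chartAt (Eu d) p p) := by
  have : IsManifold 𝓘(ℝ, Eu d) 1 S := .of_le (n := ∞) (by simp)
  have h0 : (show Eu d →L[ℝ] Eu d from mfderiv 𝓘(ℝ, Eu d) 𝓘(ℝ, Eu d) (extChartAt 𝓘(ℝ, Eu d) p) p) =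
      ContinuousLinearMap.id ℝ (Eu d) := mfderiv_extChartAt_self
  have h1 : ∀ v : Eu d, (show Eu d →L[ℝ] Eu d from
      mfderiv 𝓘(ℝ, Eu d) 𝓘(ℝ, Eu d) (extChartAt 𝓘(ℝ, Eu d) p) p).inverse v = v := by
    intro v; rw [h0, ContinuousLinearMap.inverse_id]; rfl
  rw [← mlieBracketWithin_univ, mlieBracketWithin_apply]
  refine (h1 _).trans ?_
  have h : ∀ X : (∀ p : S, Tg d p), mpullbackWithin 𝓘(ℝ, Eu d) 𝓘(ℝ, Eu d)
      (extChartAt 𝓘(ℝ, Eu d) p).symm X (range 𝓘(ℝ, Eu d)) =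
      inChartField X (chartAt (Eu d) p) := by
    intro X
    ext1 u
    simp only [mpullbackWithin_apply, mfld_simps]
    rfl
  rw [h, h]
  simp only [mfld_simps, preimage_univ, inter_univ, lieBracketWithin_univ]

lemma differentiableAt_inChartField {X : ∀ p : S, Tg d p} (hX : IsSmoothField X) (p : S) :
    DifferentiableAt ℝ (inChartField X (chartAt (Eu d) p)) (chartAt (Eu d) p p) := by
  have : IsManifold 𝓘(ℝ, Eu d) 2 S := .of_le (n := ∞) ENat.LEInfty.out
  have h1 := (hX.mdifferentiable (by simp) p).mdifferentiableWithinAt (s := univ)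
  have h2 := h1.differentiableWithinAt_mpullbackWithin_vectorField
  have h : mpullbackWithin 𝓘(ℝ, Eu d) 𝓘(ℝ, Eu d)
      (extChartAt 𝓘(ℝ, Eu d) p).symm X (range 𝓘(ℝ, Eu d)) =
      inChartField X (chartAt (Eu d) p) := by
    ext1 u
    simp only [mpullbackWithin_apply, mfld_simps]
    rfl
  rw [h] at h2
  simpa only [mfld_simps, preimage_univ, inter_univ, differentiableWithinAt_univ] using h2

lemma inChartField_apply (J : EndField d S) (X : ∀ p : S, Tg d p)
    {e : OpenPartialHomeomorph S (Eu d)} (he : e ∈ atlas (Eu d) S) {u : Eu d} (hu : u ∈ e.target) :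
    inChartField (fun q => J q (X q)) e u = inChartEnd J e u (inChartField X e u) := by
  exact congrArg (fun t : Eu d => (chartD e u).inverse ((show Eu d →L[ℝ] Eu d from J (e.symm u)) t))
    ((isInvertible_chartD he hu).self_apply_inverse (show Eu d from X (e.symm u))).symm

lemma inChartEnd_comp (J : EndField d S)
    {e : OpenPartialHomeomorph S (Eu d)} (he : e ∈ atlas (Eu d) S) {u : Eu d} (hu : u ∈ e.target)
    (v : Eu d) : chartD e u (inChartEnd J e u v) = J (e.symm u) (chartD e u v) :=
  (isInvertible_chartD he hu).self_apply_inverse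
    ((show Eu d →L[ℝ] Eu d from J (e.symm u)) (chartD e u v))

/-- The chart expression of an invertible field of bilinear forms is invertible. -/
lemma isInvertible_inChart {a : BilField d S ℝ} (ha : ∀ p, (a p).IsInvertible)
    {e : OpenPartialHomeomorph S (Eu d)} (he : e ∈ atlas (Eu d) S) {u : Eu d} (hu : u ∈ e.target) :
    (inChart a e u).IsInvertible := by
  obtain ⟨D, hD⟩ := isInvertible_chartD he hu
  obtain ⟨A, hA⟩ := ha (e.symm u)
  let A' : Eu d ≃L[ℝ] (Eu d →L[ℝ] ℝ) := A
  refine ⟨(D.trans A').trans (D.symm.arrowCongr (.refl ℝ ℝ)), ?_⟩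
  ext v w
  rw [inChart_apply, ← hD, ← hA]
  rfl

/-- An almost complex structure `J` with `b(v, w) = a(J v, w)` for closed two-forms `a`, `b` with
`a` nondegenerate is a complex structure. -/
lemma isComplexStructure_of_closed {J : EndField d S} {a b : BilField d S ℝ}
    (ha : IsClosedTwoForm a) (hb : IsClosedTwoForm b) (hinv : ∀ p, (a p).IsInvertible)
    (hab : ∀ p v w, b p v w = a p (J p v) w) (hJ : ∀ p v, J p (J p v) = -v) :
    IsComplexStructure J := by
  have hab' : ∀ e ∈ atlas (Eu d) S, ∀ u ∈ e.target, ∀ v w,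
      inChart b e u v w = inChart a e u (inChartEnd J e u v) w := by
    intro e he u hu v w
    rw [inChart_apply, inChart_apply, inChartEnd_comp J he hu]
    exact hab _ _ _
  have hJ' : ∀ e ∈ atlas (Eu d) S, ∀ u ∈ e.target, ∀ v,
      inChartEnd J e u (inChartEnd J e u v) = -v := by
    intro e he u hu v
    have hD := isInvertible_chartD he hu
    rw [← hD.inverse_apply_self (inChartEnd J e u _), inChartEnd_comp J he hu,
      inChartEnd_comp J he hu]
    conv_rhs => rw [← hD.inverse_apply_self v, ← map_neg]
    congr 1
    exact hJ _ _
  have hsmooth : ∀ e ∈ atlas (Eu d) S, ContDiffOn ℝ ∞ (inChartEnd J e) e.target := by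
    intro e he
    -- Smoothness of J need not be assumed, since in a chart J = a⁻¹b.
    have h1 : ContDiffOn ℝ ∞ (fun u => (inChart a e u).inverse.comp (inChart b e u)) e.target := by
      refine ContDiffOn.clm_comp (fun u hu => ?_) (hb.smooth e he)
      exact (isInvertible_inChart hinv he hu).contDiffAt_map_inverse.comp_contDiffWithinAt u
        (ha.smooth e he u hu)
    refine h1.congr fun u hu => ?_
    ext1 v
    have : inChart b e u v = inChart a e u (inChartEnd J e u v) := by
      ext w; exact hab' e he u hu v w
    rw [ContinuousLinearMap.comp_apply, this,
      (isInvertible_inChart hinv he hu).inverse_apply_self]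
  refine ⟨contMDiff_endField hsmooth, hJ, fun X Y hX hY p => ?_⟩
  have he := chart_mem_atlas (Eu d) p
  set e := chartAt (Eu d) p with hedef
  have hu : e p ∈ e.target := mem_chart_target _ p
  have hnhds : ∀ᶠ u in 𝓝 (e p), u ∈ e.target := e.open_target.mem_nhds hu
  have hdX := differentiableAt_inChartField hX p
  have hdY := differentiableAt_inChartField hY p
  have hdJ : DifferentiableAt ℝ (inChartEnd J e) (e p) :=
    ((hsmooth e he).contDiffAt hnhds).differentiableAt (by simp)
  have hda : DifferentiableAt ℝ (inChart a e) (e p) :=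
    ((ha.smooth e he).contDiffAt hnhds).differentiableAt (by simp)
  have hJX : ∀ X : (∀ p : S, Tg d p), inChartField (fun q => J q (X q)) e =ᶠ[𝓝 (e p)]
      fun u => inChartEnd J e u (inChartField X e u) := by
    intro X
    filter_upwards [hnhds] with u hu using inChartField_apply J X he hu
  have hJp : inChartEnd J e (e p) = (show Eu d →L[ℝ] Eu d from J p) := by
    have h3 : ∀ q : S, q = p →
        (show Eu d →L[ℝ] Eu d from J q) = (show Eu d →L[ℝ] Eu d from J p) := by
      rintro _ rfl; rfl
    rw [inChartEnd, hedef, chartD_self, ContinuousLinearMap.inverse_id]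
    exact h3 _ (e.left_inv (mem_chart_source _ p))
  rw [mlieBracket_eq, mlieBracket_eq, mlieBracket_eq, mlieBracket_eq, ← hedef]
  rw [(hJX X).lieBracket_vectorField_eq (hJX Y),
    (hJX X).lieBracket_vectorField_eq (EventuallyEq.refl _ (inChartField Y e)),
    (EventuallyEq.refl _ (inChartField X e)).lieBracket_vectorField_eq (hJX Y)]
  have alt : ∀ {c : BilField d S ℝ}, IsClosedTwoForm c →
      ∀ᶠ u in 𝓝 (e p), ∀ v, inChart c e u v v = 0 := by
    intro c hc
    filter_upwards with u v
    rw [inChart_apply]; exact hc.alternating _ _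
  have h0 := nijenhuis_eq_zero (a := inChart a e) (b := inChart b e) hdJ hda
    (by filter_upwards [hnhds] with u hu using hJ' e he u hu)
    (by filter_upwards [hnhds] with u hu using hab' e he u hu) (alt ha) (alt hb)
    (ha.closed e he _ hu) (hb.closed e he _ hu) (isInvertible_inChart hinv he hu).injective
    (inChartField X e (e p)) (inChartField Y e (e p))
  have h1 := (nijenhuis_eq hdJ hdX hdY (hJ' e he _ hu)).trans h0
  rw [hJp] at h1
  exact h1

end Sections

/-! ### Level sets of submersions -/

section LevelSet
open Filter Topology

variable {E G : Type} [NormedAddCommGroup E] [NormedSpace ℝ E] [FiniteDimensional ℝ E]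
  [NormedAddCommGroup G] [NormedSpace ℝ G]

/-- Near a point where the derivative of `f` is surjective, `f` is part of a coordinate system. -/
lemma exists_adapted_coordinates {f : E → G} (hf : ContDiff ℝ ∞ f) {d : ℕ} {U : Set E}
    (hU : IsOpen U) {x₀ : E} (hx₀ : x₀ ∈ U) (hsurj : Function.Surjective (fderiv ℝ f x₀))
    (hd : Module.finrank ℝ (LinearMap.ker (fderiv ℝ f x₀ : E →ₗ[ℝ] G)) = d) :
    ∃ (Ψ : OpenPartialHomeomorph E (G × Eu d)) (L : E →L[ℝ] Eu d),
      x₀ ∈ Ψ.source ∧ Ψ.source ⊆ U ∧ (∀ x, Ψ x = (f x, L x)) ∧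
      ContDiffOn ℝ ∞ Ψ.symm Ψ.target := by
  let K := LinearMap.ker (fderiv ℝ f x₀ : E →ₗ[ℝ] G)
  -- A linear extension L of this isomorphism supplies the coordinates missing from f: (Df, L) is
  -- bijective at x₀.
  let k : K ≃ₗ[ℝ] Eu d := LinearEquiv.ofFinrankEq K (Eu d) (by rw [hd]; simp)
  obtain ⟨L₀, hL₀⟩ := LinearMap.exists_extend (k : K →ₗ[ℝ] Eu d)
  have hL₀' : ∀ v : K, L₀ v = k v := fun v => LinearMap.congr_fun hL₀ v
  let L : E →L[ℝ] Eu d := LinearMap.toContinuousLinearMap L₀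
  let h : E → G × Eu d := fun x => (f x, L x)
  have hh : ContDiff ℝ ∞ h := hf.prodMk L.contDiff
  have hh' : ∀ x, HasFDerivAt h ((fderiv ℝ f x).prod L) x := fun x =>
    ((hf.differentiable (by simp)) x).hasFDerivAt.prodMk L.hasFDerivAt
  have hbij : Function.Bijective ((fderiv ℝ f x₀).prod L) := by
    constructor
    · rw [injective_iff_map_eq_zero]
      intro v hv
      have h1 : fderiv ℝ f x₀ v = 0 := congrArg Prod.fst hv
      have h2 : L₀ v = 0 := congrArg Prod.snd hv
      have h3 : k ⟨v, h1⟩ = 0 := by rw [← hL₀', h2]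
      exact congrArg Subtype.val (by simpa using h3 : (⟨v, h1⟩ : K) = 0)
    · rintro ⟨g, w⟩
      obtain ⟨x, rfl⟩ := hsurj g
      refine ⟨x + (k.symm (w - L₀ x) : K), Prod.ext ?_ ?_⟩
      · simp
      · change L₀ (x + (k.symm (w - L₀ x) : K)) = w
        rw [map_add, hL₀']
        simp
  let A : E ≃L[ℝ] G × Eu d :=
    (LinearEquiv.ofBijective ((fderiv ℝ f x₀).prod L : E →ₗ[ℝ] G × Eu d)
      hbij).toContinuousLinearEquiv
  have hA : HasFDerivAt h (A : E →L[ℝ] G × Eu d) x₀ := hh' x₀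
  let H := hh.contDiffAt.toOpenPartialHomeomorph h hA (by simp)
  -- Restricting to points where (Df, L) is invertible makes the inverse coordinates smooth on the
  -- whole target, not just near the image of x₀.
  let W : Set E := U ∩ (fun x => (fderiv ℝ f x).prod L) ⁻¹'
    range ((↑) : (E ≃L[ℝ] G × Eu d) → E →L[ℝ] G × Eu d)
  have hcont : Continuous fun x => (fderiv ℝ f x).prod L := by
    have h1 : Continuous (fderiv ℝ f) := hf.continuous_fderiv (by simp)
    have : (fun x => (fderiv ℝ f x).prod L) = fderiv ℝ h := by
      ext1 x; exact (hh' x).fderiv.symm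
    rw [this]
    exact hh.continuous_fderiv (by simp)
  have hW : IsOpen W := hU.inter (ContinuousLinearEquiv.isOpen.preimage hcont)
  refine ⟨H.restrOpen W hW, L, ?_, ?_, fun x => rfl, ?_⟩
  · exact ⟨hh.contDiffAt.mem_toOpenPartialHomeomorph_source hA (by simp), hx₀, ⟨A, rfl⟩⟩
  · exact fun x hx => hx.2.1
  · intro a ha
    obtain ⟨B, hB⟩ := ((H.restrOpen W hW).map_target ha).2.2
    have hB' : HasFDerivAt (H.restrOpen W hW) (B : E →L[ℝ] G × Eu d)
        ((H.restrOpen W hW).symm a) := by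
      rw [hB]; exact hh' _
    exact ((H.restrOpen W hW).contDiffAt_symm ha hB' hh.contDiffAt).contDiffWithinAt

variable {f : E → G} {U : Set E} {c : G} {d : ℕ}

/-- The chart of a level set obtained from an adapted coordinate system. -/
def levelChart (p : {x | x ∈ U ∧ f x = c}) (Ψ : OpenPartialHomeomorph E (G × Eu d))
    (L : E →L[ℝ] Eu d) (hU : Ψ.source ⊆ U) (hΨ : ∀ x, Ψ x = (f x, L x)) :
    OpenPartialHomeomorph {x | x ∈ U ∧ f x = c} (Eu d) :=
  have key : ∀ v, (c, v) ∈ Ψ.target → Ψ.symm (c, v) ∈ {x | x ∈ U ∧ f x = c} := fun v hv =>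
    ⟨hU (Ψ.map_target hv), congrArg Prod.fst ((hΨ _).symm.trans (Ψ.right_inv hv))⟩
  have key2 : ∀ x : {x | x ∈ U ∧ f x = c}, (c, L x) = Ψ x := fun x => by rw [hΨ, x.2.2]
  open Classical in
  { toFun := fun x => L x
    -- Outside the target the value is irrelevant; p only provides a point of the level set.
    invFun := fun v => if h : (c, v) ∈ Ψ.target then ⟨Ψ.symm (c, v), key v h⟩ else p
    source := Subtype.val ⁻¹' Ψ.source
    target := (fun v => (c, v)) ⁻¹' Ψ.target
    map_source' := fun x hx => by
      change (c, L x) ∈ Ψ.target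
      rw [key2]; exact Ψ.map_source hx
    map_target' := fun v hv => by
      have hv' : (c, v) ∈ Ψ.target := hv
      simp only [hv', dif_pos]
      exact Ψ.map_target hv
    left_inv' := fun x hx => by
      have hv' : (c, L x) ∈ Ψ.target := by rw [key2]; exact Ψ.map_source hx
      simp only [hv', dif_pos]
      apply Subtype.ext
      simp only [key2]
      exact Ψ.left_inv hx
    right_inv' := fun v hv => by
      have hv' : (c, v) ∈ Ψ.target := hv
      simp only [hv', dif_pos]
      exact congrArg Prod.snd ((hΨ _).symm.trans (Ψ.right_inv hv'))
    open_source := Ψ.open_source.preimage continuous_subtype_val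
    open_target := Ψ.open_target.preimage (by fun_prop)
    continuousOn_toFun := (L.continuous.comp continuous_subtype_val).continuousOn
    continuousOn_invFun := by
      rw [Topology.IsInducing.subtypeVal.continuousOn_iff]
      have h1 : ContinuousOn (fun v => Ψ.symm (c, v)) ((fun v => (c, v)) ⁻¹' Ψ.target) :=
        Ψ.continuousOn_symm.comp (by fun_prop) fun v hv => hv
      refine h1.congr fun v hv => ?_
      have hv' : (c, v) ∈ Ψ.target := hv
      simp [hv'] }

omit [FiniteDimensional ℝ E] [NormedSpace ℝ G] in
open Classical in
lemma levelChart_symm (p : {x | x ∈ U ∧ f x = c}) (Ψ : OpenPartialHomeomorph E (G × Eu d))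
    (L : E →L[ℝ] Eu d) (hU : Ψ.source ⊆ U) (hΨ : ∀ x, Ψ x = (f x, L x)) {v : Eu d}
    (hv : (c, v) ∈ Ψ.target) : ((levelChart p Ψ L hU hΨ).symm v : E) = Ψ.symm (c, v) := by
  change ((if h : (c, v) ∈ Ψ.target then ⟨Ψ.symm (c, v), _⟩ else p :
    {x | x ∈ U ∧ f x = c}) : E) = _
  rw [dif_pos hv]

/-- A level set of a submersion is a manifold, with the kernel of the derivative as tangent
space. -/
theorem exists_manifold_levelSet (hf : ContDiff ℝ ∞ f) (hU : IsOpen U)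
    (hsurj : ∀ x ∈ U, f x = c → Function.Surjective (fderiv ℝ f x))
    (hd : ∀ x ∈ U, f x = c → Module.finrank ℝ (LinearMap.ker (fderiv ℝ f x : E →ₗ[ℝ] G)) = d) :
    ∃ (_ : ChartedSpace (Eu d) {x | x ∈ U ∧ f x = c})
      (_ : IsManifold 𝓘(ℝ, Eu d) ∞ {x | x ∈ U ∧ f x = c}),
      ContMDiff 𝓘(ℝ, Eu d) 𝓘(ℝ, E) ∞ (Subtype.val : {x | x ∈ U ∧ f x = c} → E) ∧
      ∀ p : {x | x ∈ U ∧ f x = c},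
        Function.Injective (mfderiv 𝓘(ℝ, Eu d) 𝓘(ℝ, E)
          (Subtype.val : {x | x ∈ U ∧ f x = c} → E) p) ∧
        range (mfderiv 𝓘(ℝ, Eu d) 𝓘(ℝ, E) (Subtype.val : {x | x ∈ U ∧ f x = c} → E) p) =
          {v | fderiv ℝ f p v = 0} := by
  choose Ψ L hmem hsub hΨ hsymm using fun p : {x | x ∈ U ∧ f x = c} =>
    exists_adapted_coordinates hf hU p.2.1 (hsurj p p.2.1 p.2.2) (hd p p.2.1 p.2.2)
  let e := fun p => levelChart p (Ψ p) (L p) (hsub p) (hΨ p)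
  have hesymm : ∀ p, ∀ v ∈ (e p).target, ((e p).symm v : E) = (Ψ p).symm (c, v) :=
    fun p v hv => levelChart_symm p (Ψ p) (L p) (hsub p) (hΨ p) hv
  have hsm : ∀ p, ContDiffOn ℝ ∞ (fun v => (Ψ p).symm (c, v)) (e p).target := fun p =>
    (hsymm p).comp (contDiff_const.prodMk contDiff_id).contDiffOn fun v hv => hv
  let cs : ChartedSpace (Eu d) {x | x ∈ U ∧ f x = c} :=
    { atlas := range e
      chartAt := e
      mem_chart_source := fun p => hmem p
      chart_mem_atlas := fun p => mem_range_self p }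
  have hm : IsManifold 𝓘(ℝ, Eu d) ∞ {x | x ∈ U ∧ f x = c} := by
    apply isManifold_of_contDiffOn
    rintro _ _ ⟨p, rfl⟩ ⟨q, rfl⟩
    simp only [mfld_simps]
    refine ((L q).contDiff.comp_contDiffOn ((hsm p).mono inter_subset_left)).congr ?_
    intro v hv
    exact congrArg (L q) (hesymm p v hv.1)
  have hval : ContMDiff 𝓘(ℝ, Eu d) 𝓘(ℝ, E) ∞ (Subtype.val : {x | x ∈ U ∧ f x = c} → E) := by
    intro p
    refine (contMDiffAt_of_chart (p := p) (hsm p)).congr_of_eventuallyEq ?_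
    filter_upwards [(e p).open_source.mem_nhds (hmem p)] with q hq
    have h1 := hesymm p (e p q) ((e p).map_source hq)
    rw [(e p).left_inv hq] at h1
    exact h1
  refine ⟨cs, hm, hval, fun p => ?_⟩
  have hdiff : MDifferentiableAt 𝓘(ℝ, Eu d) 𝓘(ℝ, E)
    (Subtype.val : {x | x ∈ U ∧ f x = c} → E) p := hval.mdifferentiable (by simp) p
  have hm1 : IsManifold 𝓘(ℝ, Eu d) 1 {x | x ∈ U ∧ f x = c} := .of_le (n := ∞) (by simp)
  have hinj : Function.Injective
      (mfderiv 𝓘(ℝ, Eu d) 𝓘(ℝ, E) (Subtype.val : {x | x ∈ U ∧ f x = c} → E) p) := by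
    -- The chart at p is L composed with the inclusion, so injectivity of its derivative passes to
    -- that of the inclusion.
    have h1 := (mdifferentiable_chart (I := 𝓘(ℝ, Eu d)) p).mfderiv_injective
      (mem_chart_source (Eu d) p)
    have h2 : mfderiv 𝓘(ℝ, Eu d) 𝓘(ℝ, Eu d) (chartAt (Eu d) p) p =
        (mfderiv 𝓘(ℝ, E) 𝓘(ℝ, Eu d) (L p) (p : E)).comp
          (mfderiv 𝓘(ℝ, Eu d) 𝓘(ℝ, E) (Subtype.val : {x | x ∈ U ∧ f x = c} → E) p) :=
      mfderiv_comp p (L p).mdifferentiableAt hdiff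
    rw [h2] at h1
    exact Function.Injective.of_comp h1
  refine ⟨hinj, ?_⟩
  have h3 : ∀ v, fderiv ℝ f p
      (mfderiv 𝓘(ℝ, Eu d) 𝓘(ℝ, E) (Subtype.val : {x | x ∈ U ∧ f x = c} → E) p v) = 0 := by
    intro v
    have h4 := mfderiv_comp (I := 𝓘(ℝ, Eu d)) (I' := 𝓘(ℝ, E)) (I'' := 𝓘(ℝ, G)) p
      ((hf.differentiable (by simp)) (p : E)).mdifferentiableAt hdiff
    have h5 : f ∘ (Subtype.val : {x | x ∈ U ∧ f x = c} → E) = fun _ => c := by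
      ext1 q; exact q.2.2
    rw [h5, mfderiv_const, mfderiv_eq_fderiv] at h4
    exact (DFunLike.congr_fun h4 v).symm
  let D : Eu d →L[ℝ] E :=
    mfderiv 𝓘(ℝ, Eu d) 𝓘(ℝ, E) (Subtype.val : {x | x ∈ U ∧ f x = c} → E) p
  -- The range lies in the kernel because f is constant on the level set; equality holds by
  -- dimension.
  have h6 : LinearMap.range (D : Eu d →ₗ[ℝ] E) = LinearMap.ker (fderiv ℝ f p : E →ₗ[ℝ] G) := by
    apply Submodule.eq_of_le_of_finrank_eq
    · rintro _ ⟨v, rfl⟩; exact h3 v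
    · rw [hd p p.2.1 p.2.2, LinearMap.finrank_range_of_inj (f := (D : Eu d →ₗ[ℝ] E)) hinj]
      simp
  ext w
  exact SetLike.ext_iff.1 h6 w

end LevelSet

/-! ### The Maurer–Cartan equation and closedness -/

section Closed
open Filter Topology

variable (F : Frame κ)

/-- The component `aᵢ` as a continuous linear map. -/
def tripleCLM (i : Fin 3) : MSpace →L[ℝ] su2 := LinearMap.toContinuousLinearMap
  { toFun := fun x => F.triple x i
    map_add' := fun x y => F.triple_add x y i
    map_smul' := fun r x => F.triple_smul r x i }

@[simp] lemma tripleCLM_apply (i : Fin 3) (x : MSpace) : tripleCLM F i x = F.triple x i := rfl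

lemma fderiv_lie_triple (i j : Fin 3) (x v : MSpace) :
    fderiv ℝ (fun x => ⁅F.triple x i, F.triple x j⁆) x v =
      ⁅F.triple v i, F.triple x j⁆ + ⁅F.triple x i, F.triple v j⁆ := by
  have h := lieCLM.hasFDerivAt_of_bilinear ((tripleCLM F i).hasFDerivAt (x := x))
    ((tripleCLM F j).hasFDerivAt (x := x))
  simp only [lieCLM_apply, tripleCLM_apply] at h
  rw [h.fderiv]
  simp [add_comm]

/-- The gradient field is equivariant. -/
lemma fderiv_gradPhi_hat (x : MSpace) (ξ : su2) :
    fderiv ℝ (gradPhi F) x (hat F ξ x) = hat F ξ (gradPhi F x) := by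
  have hd : DifferentiableAt ℝ (gradPhi F) x := (contDiff_gradPhi F).differentiable (by simp) x
  have h : ∀ i, F.triple (fderiv ℝ (gradPhi F) x (hat F ξ x)) i =
      fderiv ℝ (fun x => F.triple (gradPhi F x) i) x (hat F ξ x) := by
    intro i
    have := ((tripleCLM F i).hasFDerivAt.comp x hd.hasFDerivAt).fderiv
    have h2 : (tripleCLM F i) ∘ gradPhi F = fun x => F.triple (gradPhi F x) i := rfl
    rw [h2] at this
    rw [this]; rfl
  refine F.triple_injective fun i => ?_
  rw [h, triple_hat]
  fin_cases i
  · simp only [Fin.zero_eta, triple_gradPhi0, fderiv_lie_triple, triple_hat]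
    exact (leibniz_lie ξ _ _).symm
  · simp only [Fin.mk_one, triple_gradPhi1, fderiv_lie_triple, triple_hat]
    exact (leibniz_lie ξ _ _).symm
  · simp only [Fin.reduceFinMk, triple_gradPhi2, fderiv_lie_triple, triple_hat]
    exact (leibniz_lie ξ _ _).symm

lemma contDiffOn_inv_Phi : ContDiffOn ℝ ∞ (fun x => (Phi F x)⁻¹) (Mo F) :=
  (contDiff_Phi F).contDiffOn.inv fun _ hx => hx

lemma contDiffOn_sigma : ContDiffOn ℝ ∞ (sigma F) (Mo F) := by
  refine contDiffOn_clm_apply.2 fun v => ?_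
  simp only [sigma_apply]
  have h := fun i => (contDiff_triple F i).contDiffOn (s := Mo F)
  refine (contDiffOn_inv_Phi F).smul (((?_ : ContDiffOn _ _ _ _).add ?_).add ?_)
  · exact (contDiffOn_const.su2_pair (h 2)).smul (h 0)
  · exact (contDiffOn_const.su2_pair (h 0)).smul (h 1)
  · exact (contDiffOn_const.su2_pair (h 1)).smul (h 2)

lemma contDiffOn_tau : ContDiffOn ℝ ∞ (tau F) (Mo F) := by
  refine contDiffOn_clm_apply.2 fun v => ?_
  simp only [tau_apply]
  exact (contDiffOn_inv_Phi F).mul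
    (contDiffOn_const.su2_pair (contDiff_triple F 0).contDiffOn)

variable {F}
variable {E : Type} [NormedAddCommGroup E] [NormedSpace ℝ E]
  {y : E → MSpace} {V : Set E} (hV : IsOpen V) (hy : ContDiffOn ℝ ∞ y V)
  (hmo : ∀ u ∈ V, Phi F (y u) ≠ 0) (htan : ∀ u ∈ V, ∀ v, fderiv ℝ y u v ∈ charSpace F (y u))

include hV hy in
lemma contDiffOn_fderiv_of_isOpen : ContDiffOn ℝ ∞ (fderiv ℝ y) V :=
  hy.fderiv_of_isOpen hV (by simp)

include hV hy hmo in
lemma contDiffOn_sigma_fderiv :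
    ContDiffOn ℝ ∞ (fun u => (sigma F (y u)).comp (fderiv ℝ y u)) V :=
  ((contDiffOn_sigma F).comp hy hmo).clm_comp (contDiffOn_fderiv_of_isOpen hV hy)

include hV hy hmo in
lemma contDiffOn_tau_fderiv :
    ContDiffOn ℝ ∞ (fun u => (tau F (y u)).comp (fderiv ℝ y u)) V :=
  ((contDiffOn_tau F).comp hy hmo).clm_comp (contDiffOn_fderiv_of_isOpen hV hy)

include hmo htan in
lemma fderiv_apply_eq {u : E} (hu : u ∈ V) (v : E) (ζ : su2) : fderiv ℝ y u v ζ =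
    -y u ⁅sigma F (y u) (fderiv ℝ y u v), ζ⁆ +
      tau F (y u) (fderiv ℝ y u v) • gradPhi F (y u) ζ := by
  conv_lhs => rw [(mem_charSpace_iff_eq (hmo u hu) _).1 (htan u hu v)]
  rw [gen, add_apply, smul_apply, hat_apply]

include hV hy hmo htan in
/-- The Maurer–Cartan equation on an integral manifold. -/
lemma maurerCartan {u : E} (hu : u ∈ V) (v w : E) :
    fderiv ℝ (fun u => (sigma F (y u)).comp (fderiv ℝ y u)) u w v -
      fderiv ℝ (fun u => (sigma F (y u)).comp (fderiv ℝ y u)) u v w =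
      ⁅sigma F (y u) (fderiv ℝ y u w), sigma F (y u) (fderiv ℝ y u v)⁆ := by
  have hn : V ∈ 𝓝 u := hV.mem_nhds hu
  have hyd : DifferentiableAt ℝ y u := (hy.contDiffAt hn).differentiableAt (by simp)
  have hDy : DifferentiableAt ℝ (fderiv ℝ y) u :=
    ((contDiffOn_fderiv_of_isOpen hV hy).contDiffAt hn).differentiableAt (by simp)
  have hσ : DifferentiableAt ℝ (fun u => (sigma F (y u)).comp (fderiv ℝ y u)) u :=
    ((contDiffOn_sigma_fderiv hV hy hmo).contDiffAt hn).differentiableAt (by simp)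
  have hτ : DifferentiableAt ℝ (fun u => (tau F (y u)).comp (fderiv ℝ y u)) u :=
    ((contDiffOn_tau_fderiv hV hy hmo).contDiffAt hn).differentiableAt (by simp)
  have hX : DifferentiableAt ℝ (fun u => gradPhi F (y u)) u :=
    ((contDiff_gradPhi F).differentiable (by simp) _).comp u hyd
  have hsymm : IsSymmSndFDerivAt ℝ y u :=
    (hy.contDiffAt hn).isSymmSndFDerivAt (by simp; exact ENat.LEInfty.out)
  set σ := fun u => (sigma F (y u)).comp (fderiv ℝ y u) with hσdef
  set τ := fun u => (tau F (y u)).comp (fderiv ℝ y u) with hτdef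
  have hXD : ∀ w ζ, fderiv ℝ (fun u => gradPhi F (y u)) u w ζ =
      -gradPhi F (y u) ⁅σ u w, ζ⁆ +
        τ u w • fderiv ℝ (gradPhi F) (y u) (gradPhi F (y u)) ζ := by
    intro w ζ
    have h1 : fderiv ℝ (fun u => gradPhi F (y u)) u =
        (fderiv ℝ (gradPhi F) (y u)).comp (fderiv ℝ y u) :=
      fderiv_comp u ((contDiff_gradPhi F).differentiable (by simp) _) hyd
    rw [h1, ContinuousLinearMap.comp_apply,
      (mem_charSpace_iff_eq (hmo u hu) _).1 (htan u hu w), gen, map_add, map_smul,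
      fderiv_gradPhi_hat, add_apply, smul_apply, hat_apply]
    rfl
  -- Differentiates dy = σ̂ + τX once more. Equivariance of X evaluates its derivative along the σ̂
  -- part.
  have key : ∀ v w ζ, fderiv ℝ (fderiv ℝ y) u w v ζ =
      (y u ⁅σ u w, ⁅σ u v, ζ⁆⁆ - τ u w • gradPhi F (y u) ⁅σ u v, ζ⁆) - y u ⁅fderiv ℝ σ u w v, ζ⁆ +
      fderiv ℝ τ u w v • gradPhi F (y u) ζ + τ u v • (-gradPhi F (y u) ⁅σ u w, ζ⁆ +
        τ u w • fderiv ℝ (gradPhi F) (y u) (gradPhi F (y u)) ζ) := by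
    intro v w ζ
    have e : (fun u => fderiv ℝ y u v ζ) =ᶠ[𝓝 u] fun u => -y u (lieCLM (σ u v) ζ) +
        τ u v • gradPhi F (y u) ζ := by
      filter_upwards [hn] with t ht using fderiv_apply_eq hmo htan ht v ζ
    have h1 : fderiv ℝ (fun u => fderiv ℝ y u v ζ) u w = fderiv ℝ (fderiv ℝ y) u w v ζ := by
      rw [fderiv_clm_apply (hDy.clm_apply (differentiableAt_const v)) (differentiableAt_const ζ),
        fderiv_clm_apply hDy (differentiableAt_const v)]
      simp
    have hσv : HasFDerivAt (fun u => σ u v) ((fderiv ℝ σ u).flip v) u := by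
      have := hσ.hasFDerivAt.clm_apply (hasFDerivAt_const v u)
      simpa using this
    have hτv : HasFDerivAt (fun u => τ u v) ((fderiv ℝ τ u).flip v) u := by
      have := hτ.hasFDerivAt.clm_apply (hasFDerivAt_const v u)
      simpa using this
    have hl : HasFDerivAt (fun u => lieCLM (σ u v) ζ)
        ((lieCLM.flip ζ).comp ((fderiv ℝ σ u).flip v)) u :=
      (lieCLM.flip ζ).hasFDerivAt.comp u hσv
    have hyl := hyd.hasFDerivAt.clm_apply hl
    have hXζ := hX.hasFDerivAt.clm_apply (hasFDerivAt_const ζ u)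
    have h2 := (hyl.neg.add (hτv.smul hXζ)).fderiv
    rw [← h1, e.fderiv_eq]
    refine (DFunLike.congr_fun h2 w).trans ?_
    simp only [add_apply, neg_apply, smul_apply, ContinuousLinearMap.comp_apply,
      ContinuousLinearMap.flip_apply, ContinuousLinearMap.smulRight_apply, lieCLM_apply, hXD,
      fderiv_apply_eq hmo htan hu]
    simp only [hσdef, hτdef, ContinuousLinearMap.comp_apply, zero_apply, map_zero]
    module
  -- Antisymmetrising in v, w kills the second derivative of y. The terms in τσ and in ττ are
  -- symmetric and cancel, and the Jacobi identity collects the double brackets into [σ w, σ v].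
  -- Injectivity of (ξ, s) ↦ ξ̂ + sX then separates the equation for σ.
  have hzero : gen F (y u) (fderiv ℝ σ u w v - fderiv ℝ σ u v w - ⁅σ u w, σ u v⁆)
      (fderiv ℝ τ u w v - fderiv ℝ τ u v w) = gen F (y u) 0 0 := by
    ext1 ζ
    have h1 := congrArg (fun A : MSpace => A ζ) (hsymm w v)
    simp only [key] at h1
    have h2 : ⁅⁅σ u w, σ u v⁆, ζ⁆ = ⁅σ u w, ⁅σ u v, ζ⁆⁆ - ⁅σ u v, ⁅σ u w, ζ⁆⁆ := lie_lie _ _ _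
    rw [← sub_eq_zero] at h1
    simp only [gen, add_apply, smul_apply, hat_apply, sub_lie, map_sub, h2, zero_lie, map_zero,
      zero_smul, neg_zero, add_zero]
    refine Eq.trans ?_ h1
    module
  have := (gen_injective (hmo u hu) hzero).1
  exact sub_eq_zero.1 this

include hV hy hmo htan in
/-- The two-form `formE` is exact on an integral manifold. -/
lemma formE_eq_dBeta {u : E} (hu : u ∈ V) (v w : E) :
    formE F (y u) (fderiv ℝ y u w) (fderiv ℝ y u v) =
      fderiv ℝ (fun u => (y u).comp ((sigma F (y u)).comp (fderiv ℝ y u))) u w v -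
      fderiv ℝ (fun u => (y u).comp ((sigma F (y u)).comp (fderiv ℝ y u))) u v w := by
  have hn : V ∈ 𝓝 u := hV.mem_nhds hu
  have hyd : DifferentiableAt ℝ y u := (hy.contDiffAt hn).differentiableAt (by simp)
  have hσ : DifferentiableAt ℝ (fun u => (sigma F (y u)).comp (fderiv ℝ y u)) u :=
    ((contDiffOn_sigma_fderiv hV hy hmo).contDiffAt hn).differentiableAt (by simp)
  have h := (hyd.hasFDerivAt.clm_comp hσ.hasFDerivAt).fderiv
  rw [h, formE_apply, ← maurerCartan hV hy hmo htan hu]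
  simp only [add_apply, ContinuousLinearMap.comp_apply, ContinuousLinearMap.compL_apply,
    ContinuousLinearMap.flip_apply, map_sub]
  abel

lemma contDiff_flip (E W : Type) [NormedAddCommGroup E] [NormedSpace ℝ E] [NormedAddCommGroup W]
    [NormedSpace ℝ W] : ContDiff ℝ ∞ (fun B : E →L[ℝ] E →L[ℝ] W => B.flip) :=
  ContinuousLinearMap.contDiff (𝕜 := ℝ) (n := ∞) (E := E →L[ℝ] E →L[ℝ] W)
    (F := E →L[ℝ] E →L[ℝ] W)
    (ContinuousLinearMap.flipₗᵢ ℝ E E W).toContinuousLinearEquiv.toContinuousLinearMap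

lemma fderiv_bilin_apply {W : Type} [NormedAddCommGroup W] [NormedSpace ℝ W]
    {c : E → E →L[ℝ] E →L[ℝ] W} {u : E} (hc : DifferentiableAt ℝ c u) (a v w : E) :
    fderiv ℝ (fun t => c t v w) u a = fderiv ℝ c u a v w := by
  rw [fderiv_clm_apply (hc.clm_apply (differentiableAt_const v)) (differentiableAt_const w),
    fderiv_clm_apply hc (differentiableAt_const v)]
  simp

/-- The exterior derivative of a one-form, as a field of bilinear maps. -/
def extD {W : Type} [NormedAddCommGroup W] [NormedSpace ℝ W] (β : E → E →L[ℝ] W) (u : E) :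
    E →L[ℝ] E →L[ℝ] W :=
  fderiv ℝ β u - (fderiv ℝ β u).flip

lemma contDiffOn_extD {W : Type} [NormedAddCommGroup W] [NormedSpace ℝ W] {β : E → E →L[ℝ] W}
    (hV : IsOpen V) (hβ : ContDiffOn ℝ ∞ β V) : ContDiffOn ℝ ∞ (extD β) V := by
  have h : ContDiffOn ℝ ∞ (fderiv ℝ β) V := hβ.fderiv_of_isOpen hV (by simp)
  have h' : ContDiffOn ℝ ∞ (fun u => (fderiv ℝ β u).flip) V :=
    (contDiff_flip E W).comp_contDiffOn h
  exact h.sub h'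

/-- This is d² = 0: in the cyclic sum the second derivatives of β cancel in pairs by symmetry. -/
lemma extD_closed {W : Type} [NormedAddCommGroup W] [NormedSpace ℝ W] {β : E → E →L[ℝ] W}
    (hV : IsOpen V) (hβ : ContDiffOn ℝ ∞ β V) {u : E} (hu : u ∈ V) (v₁ v₂ v₃ : E) :
    fderiv ℝ (extD β) u v₁ v₂ v₃ + fderiv ℝ (extD β) u v₂ v₃ v₁ +
      fderiv ℝ (extD β) u v₃ v₁ v₂ = 0 := by
  have h : ContDiffOn ℝ ∞ (fderiv ℝ β) V := hβ.fderiv_of_isOpen hV (by simp)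
  have hn := hV.mem_nhds hu
  have hd : DifferentiableAt ℝ (fderiv ℝ β) u := (h.contDiffAt hn).differentiableAt (by simp)
  have hs : IsSymmSndFDerivAt ℝ β u :=
    (hβ.contDiffAt hn).isSymmSndFDerivAt (by simp; exact ENat.LEInfty.out)
  have hd' : DifferentiableAt ℝ (extD β) u :=
    ((contDiffOn_extD hV hβ).contDiffAt hn).differentiableAt (by simp)
  have key : ∀ a b c, fderiv ℝ (extD β) u a b c =
      fderiv ℝ (fderiv ℝ β) u a b c - fderiv ℝ (fderiv ℝ β) u a c b := by
    intro a b c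
    have hb : ∀ b c, DifferentiableAt ℝ (fun t => fderiv ℝ β t b c) u := fun b c =>
      (hd.clm_apply (differentiableAt_const b)).clm_apply (differentiableAt_const c)
    rw [← fderiv_bilin_apply hd', ← fderiv_bilin_apply hd, ← fderiv_bilin_apply hd,
      ← sub_apply, ← fderiv_fun_sub (hb b c) (hb c b)]
    rfl
  rw [key, key, key, hs v₁ v₂, hs v₂ v₃, hs v₃ v₁]
  abel

end Closed

/-! ### Integral manifolds and leaves -/

section Integral
open Filter Topology

variable {F : Frame κ} {d : ℕ} {S : Type} [TopologicalSpace S] [ChartedSpace (Eu d) S]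
  [IsManifold 𝓘(ℝ, Eu d) ∞ S] {ι : S → MSpace}

lemma contDiffOn_chart (hs : ContMDiff 𝓘(ℝ, Eu d) 𝓘(ℝ, MSpace) ∞ ι)
    {e : OpenPartialHomeomorph S (Eu d)} (he : e ∈ atlas (Eu d) S) :
    ContDiffOn ℝ ∞ (fun u => ι (e.symm u)) e.target := by
  rw [← contMDiffOn_iff_contDiffOn]
  exact hs.comp_contMDiffOn
    (contMDiffOn_symm_of_mem_maximalAtlas (IsManifold.subset_maximalAtlas he))

lemma hasFDerivAt_chart (hs : ContMDiff 𝓘(ℝ, Eu d) 𝓘(ℝ, MSpace) ∞ ι)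
    {e : OpenPartialHomeomorph S (Eu d)} (he : e ∈ atlas (Eu d) S) {u : Eu d} (hu : u ∈ e.target)
    (v : Eu d) : fderiv ℝ (fun u => ι (e.symm u)) u v = dmap ι (e.symm u) (chartD e u v) := by
  have : IsManifold 𝓘(ℝ, Eu d) 1 S := .of_le (n := ∞) (by simp)
  have h := mfderiv_comp (I := 𝓘(ℝ, Eu d)) (I' := 𝓘(ℝ, Eu d)) (I'' := 𝓘(ℝ, MSpace)) u
    (hs.mdifferentiable (by simp) (e.symm u)) (mdifferentiableAt_atlas_symm he hu)
  rw [mfderiv_eq_fderiv] at h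
  exact DFunLike.congr_fun h v

/-- Tangent vectors lie in the kernel of `integralsD`, so the integrals are constant on balls in
charts, hence locally constant, and the manifold is connected. -/
lemma integrals_eq_of_integral (h : IsIntegralManifold F d ι) (p q : S) :
    integrals F (ι p) = integrals F (ι q) := by
  have := h.connected
  have hl : IsLocallyConstant fun p => integrals F (ι p) := by
    rw [IsLocallyConstant.iff_eventually_eq]
    intro p
    have he := chart_mem_atlas (Eu d) p
    set e := chartAt (Eu d) p with hedef
    obtain ⟨r, hr, hball⟩ := Metric.isOpen_iff.1 e.open_target (e p) (mem_chart_target _ p)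
    have hy := contDiffOn_chart h.smooth he
    have hconst : ∀ u ∈ Metric.ball (e p) r,
        integrals F (ι (e.symm u)) = integrals F (ι (e.symm (e p))) := by
      intro u hu
      have hd : ∀ v ∈ Metric.ball (e p) r,
          HasFDerivAt (fun u => integrals F (ι (e.symm u))) (0 : Eu d →L[ℝ] _) v := by
        intro v hv
        have h1 : DifferentiableAt ℝ (fun u => ι (e.symm u)) v :=
          (hy.contDiffAt (e.open_target.mem_nhds (hball hv))).differentiableAt (by simp)
        refine ((hasFDerivAt_integrals F _).comp v h1.hasFDerivAt).congr_fderiv ?_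
        ext1 w
        rw [ContinuousLinearMap.comp_apply, hasFDerivAt_chart h.smooth he (hball hv)]
        refine (mem_ker_integralsD (h.mem _) _).2 ?_
        rw [← h.tangent]
        exact mem_range_self _
      refine (convex_ball (e p) r).is_const_of_fderivWithin_eq_zero (𝕜 := ℝ)
        (f := fun u => integrals F (ι (e.symm u)))
        (fun v hv => (hd v hv).differentiableAt.differentiableWithinAt)
        (fun v hv => ?_) hu (Metric.mem_ball_self hr)
      exact (hd v hv).hasFDerivWithinAt.fderivWithin
        (Metric.isOpen_ball.uniqueDiffWithinAt hv)
    have hn : e ⁻¹' Metric.ball (e p) r ∈ 𝓝 p :=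
      (e.continuousAt (mem_chart_source _ p)).preimage_mem_nhds (Metric.ball_mem_nhds _ hr)
    filter_upwards [hn, e.open_source.mem_nhds (mem_chart_source _ p)] with q hq hq'
    have := hconst _ hq
    rwa [e.left_inv hq', e.left_inv (mem_chart_source _ p)] at this
  exact hl.apply_eq_of_preconnectedSpace p q

lemma finrank_ker_integralsD {x : MSpace} (hx : Phi F x ≠ 0) :
    Module.finrank ℝ (LinearMap.ker (fderiv ℝ (integrals F) x : MSpace →ₗ[ℝ] Fin 5 → ℝ)) = 4 := by
  have : LinearMap.ker (fderiv ℝ (integrals F) x : MSpace →ₗ[ℝ] Fin 5 → ℝ) =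
      LinearMap.range (genL F x) := by
    apply SetLike.coe_injective
    rw [range_genL hx]
    ext v
    rw [← mem_ker_integralsD hx, ← (hasFDerivAt_integrals F x).fderiv]
    rfl
  rw [this, finrank_range_genL hx]

/-- Every point of `M_o` lies on a leaf. -/
theorem exists_leaf (F : Frame κ) {x₀ : MSpace} (hx₀ : x₀ ∈ Mo F) :
    ∃ (d : ℕ) (S : Type) (_ : TopologicalSpace S) (_ : ChartedSpace (Eu d) S)
      (_ : IsManifold 𝓘(ℝ, Eu d) ∞ S) (ι : S → MSpace), IsLeaf F d ι ∧ x₀ ∈ Set.range ι := by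
  set c := integrals F x₀ with hc
  have hsurj : ∀ x ∈ Mo F, Function.Surjective (fderiv ℝ (integrals F) x) := fun x hx => by
    rw [(hasFDerivAt_integrals F x).fderiv]; exact integralsD_surjective hx
  obtain ⟨cs, _, _⟩ := exists_manifold_levelSet (c := c) (d := 4) (contDiff_integrals F)
    (isOpen_Mo F) (fun x hx _ => hsurj x hx) (fun x hx _ => finrank_ker_integralsD hx)
  -- Local connectedness makes the component of x₀ open in the level set, so it is cut out by an
  -- open V. The level set theorem over `Mo F ∩ V` then gives the component its manifold structure.
  have hloc : LocallyConnectedSpace {x | x ∈ Mo F ∧ integrals F x = c} :=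
    ChartedSpace.locallyConnectedSpace (Eu 4) _
  let p₀ : {x | x ∈ Mo F ∧ integrals F x = c} := ⟨x₀, hx₀, rfl⟩
  obtain ⟨V, hV, hVC⟩ := isOpen_induced_iff.1 (isOpen_connectedComponent (x := p₀))
  obtain ⟨cs', hm', hsm, hder⟩ := exists_manifold_levelSet (c := c) (d := 4) (U := Mo F ∩ V)
    (contDiff_integrals F) ((isOpen_Mo F).inter hV) (fun x hx _ => hsurj x hx.1)
    (fun x hx _ => finrank_ker_integralsD hx.1)
  have himage : {x | x ∈ Mo F ∩ V ∧ integrals F x = c} = Subtype.val '' connectedComponent p₀ := by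
    rw [← hVC]
    ext x
    constructor
    · rintro ⟨⟨h1, h2⟩, h3⟩
      exact ⟨⟨x, h1, h3⟩, h2, rfl⟩
    · rintro ⟨⟨y, h1, h3⟩, h2, rfl⟩
      exact ⟨⟨h1, h2⟩, h3⟩
  have hconn : ConnectedSpace {x | x ∈ Mo F ∩ V ∧ integrals F x = c} := by
    rw [← isConnected_iff_connectedSpace, himage]
    exact isConnected_connectedComponent.image _ continuous_subtype_val.continuousOn
  refine ⟨4, {x | x ∈ Mo F ∩ V ∧ integrals F x = c}, inferInstance, cs', hm', Subtype.val,
    ⟨⟨hconn, hsm, Subtype.val_injective, fun p => p.2.1.1, fun p => (hder p).1, fun p => ?_⟩, ?_⟩,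
    ?_⟩
  · refine (hder p).2.trans ?_
    ext v
    rw [← mem_ker_integralsD p.2.1.1, ← (hasFDerivAt_integrals F p).fderiv]
    rfl
  · intro d' N _ _ _ j hj hsub
    -- Maximality: an integral manifold through x₀ stays in the level set, and by connectedness in
    -- the component of x₀.
    refine subset_antisymm ?_ hsub
    have hx₀mem : x₀ ∈ range j := by
      apply hsub
      rw [Subtype.range_coe, himage]
      exact ⟨p₀, mem_connectedComponent, rfl⟩
    obtain ⟨q₀, hq₀⟩ := hx₀mem
    have hlev : ∀ q, j q ∈ Mo F ∧ integrals F (j q) = c := fun q =>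
      ⟨hj.mem q, by rw [integrals_eq_of_integral hj q q₀, hq₀]⟩
    let j' : N → {x | x ∈ Mo F ∧ integrals F x = c} := fun q => ⟨j q, hlev q⟩
    have hj' : Continuous j' := hj.smooth.continuous.subtype_mk _
    have := hj.connected
    have hr : range j' ⊆ connectedComponent p₀ :=
      (isPreconnected_range hj').subset_connectedComponent ⟨q₀, Subtype.ext hq₀⟩
    rintro _ ⟨q, rfl⟩
    rw [Subtype.range_coe, himage]
    exact ⟨j' q, hr (mem_range_self q), rfl⟩
  · rw [Subtype.range_coe, himage]
    exact ⟨p₀, mem_connectedComponent, rfl⟩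

end Integral

/-! ### Closed two-forms on manifolds -/

section Forms
open Filter Topology
variable {d : ℕ} {S : Type} [TopologicalSpace S] [ChartedSpace (Eu d) S]

/-- The image of a closed two-form under a linear map of the values is closed. -/
lemma IsClosedTwoForm.comp_clm {V W : Type} [NormedAddCommGroup V] [NormedSpace ℝ V]
    [NormedAddCommGroup W] [NormedSpace ℝ W] {θ : BilField d S V} {θ' : BilField d S W}
    (h : IsClosedTwoForm θ) (L : V →L[ℝ] W) (hL : ∀ p v w, θ' p v w = L (θ p v w)) :
    IsClosedTwoForm θ' := by
  have happ : ∀ (e : OpenPartialHomeomorph S (Eu d)) (u v w : Eu d),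
      inChart θ' e u v w = L (inChart θ e u v w) := fun e u v w => hL _ _ _
  have hsm : ∀ e ∈ atlas (Eu d) S, ContDiffOn ℝ ∞ (inChart θ' e) e.target := by
    intro e he
    refine contDiffOn_clm_apply.2 fun v => contDiffOn_clm_apply.2 fun w => ?_
    refine (L.contDiff.comp_contDiffOn (((h.smooth e he).clm_apply contDiffOn_const).clm_apply
      contDiffOn_const)).congr fun u _ => happ e u v w
  refine ⟨fun p v => by rw [hL, h.alternating, map_zero], hsm, ?_⟩
  intro e he u hu v₁ v₂ v₃
  have hn := e.open_target.mem_nhds hu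
  have hd := ((h.smooth e he).contDiffAt hn).differentiableAt (by simp)
  have hd' := ((hsm e he).contDiffAt hn).differentiableAt (by simp)
  have key : ∀ a b c, fderiv ℝ (inChart θ' e) u a b c = L (fderiv ℝ (inChart θ e) u a b c) := by
    intro a b c
    rw [← fderiv_bilin_apply hd', ← fderiv_bilin_apply hd]
    simp only [happ]
    exact DFunLike.congr_fun (F := Eu d →L[ℝ] W) (L.hasFDerivAt.comp u ((hd.clm_apply
      (differentiableAt_const b)).clm_apply (differentiableAt_const c)).hasFDerivAt).fderiv a
  rw [key, key, key, ← map_add, ← map_add, h.closed e he u hu, map_zero]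

end Forms

/-- The unit ball of a positive definite form on a finite-dimensional space is bounded. -/
lemma isVonNBounded_of_pos {E : Type*} [NormedAddCommGroup E] [NormedSpace ℝ E]
    [FiniteDimensional ℝ E] (B : E →L[ℝ] E →L[ℝ] ℝ) (hB : ∀ v, v ≠ 0 → 0 < B v v) :
    Bornology.IsVonNBounded ℝ {v | B v v < 1} := by
  have hp : ProperSpace E := FiniteDimensional.proper ℝ E
  obtain ⟨m, hm, hle⟩ := (isCompact_sphere (0 : E) 1).exists_forall_le' (f := fun v => B v v)
    (a := 0) (by fun_prop)
    (fun v hv => hB v (by rintro rfl; simp at hv))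
  -- If m > 0 bounds the form from below on the unit sphere, then ‖v‖ > 1 + m⁻¹ forces B(v, v) ≥
  -- m‖v‖² > 1.
  refine NormedSpace.isVonNBounded_iff ℝ |>.2 (Metric.isBounded_closedBall (x := (0 : E))
    (r := 1 + m⁻¹) |>.subset fun v hv => ?_)
  rw [mem_closedBall_zero_iff]
  by_contra! hlt
  have hm' : 0 < m⁻¹ := inv_pos.2 hm
  have hpos : 0 < ‖v‖ := by linarith
  have h1 := hle (‖v‖⁻¹ • v) (by simp [norm_smul, hpos.ne'])
  simp only [map_smul, smul_apply, smul_eq_mul] at h1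
  have h2 : m * ‖v‖ ^ 2 ≤ B v v := by
    have : B v v = ‖v‖ ^ 2 * (‖v‖⁻¹ * (‖v‖⁻¹ * B v v)) := by field_simp
    rw [this]; nlinarith [sq_nonneg ‖v‖]
  have h3 : B v v < 1 := hv
  have h4 : m * m⁻¹ = 1 := mul_inv_cancel₀ hm.ne'
  nlinarith [mul_pos hm hpos]

/-! ### The geometry of an integral manifold -/

section Integral
open Filter Topology

variable {F T : Frame κ} {d : ℕ} {S : Type} [TopologicalSpace S] [ChartedSpace (Eu d) S]
  {ι : S → MSpace}

/-- The derivative of `ι` as a map on the model space. -/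
abbrev modelD (ι : S → MSpace) (p : S) : Eu d →L[ℝ] MSpace := dmap ι p

/-- The `su(2)`-valued two-form `Ω` on an integral manifold. -/
def inducedForm (F : Frame κ) (ι : S → MSpace) : BilField d S su2 := fun p =>
  (formE F (ι p)).bilinearComp (modelD ι p) (modelD ι p)

lemma inducedForm_apply (p : S) (v w : Tg d p) : inducedForm F ι p v w =
    formE F (ι p) (dmap ι p v) (dmap ι p w) := rfl

variable [IsManifold 𝓘(ℝ, Eu d) ∞ S] (h : IsIntegralManifold F d ι)

include h

/-- The two-form `Ω` is closed. -/
lemma isClosedTwoForm_inducedForm : IsClosedTwoForm (inducedForm (d := d) F ι) := by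
  have hext : ∀ e ∈ atlas (Eu d) S, ∃ β : Eu d → Eu d →L[ℝ] su2, ContDiffOn ℝ ∞ β e.target ∧
      ∀ u ∈ e.target, inChart (inducedForm (d := d) F ι) e u = extD β u := by
    intro e he
    have hy := contDiffOn_chart h.smooth he
    have hmo : ∀ u ∈ e.target, Phi F (ι (e.symm u)) ≠ 0 := fun u _ => h.mem _
    have htan : ∀ u ∈ e.target, ∀ v, fderiv ℝ (fun u => ι (e.symm u)) u v ∈
        charSpace F (ι (e.symm u)) := by
      intro u hu v
      rw [hasFDerivAt_chart h.smooth he hu, ← h.tangent]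
      exact mem_range_self _
    refine ⟨_, hy.clm_comp (contDiffOn_sigma_fderiv e.open_target hy hmo), fun u hu => ?_⟩
    ext1 w
    ext1 v
    have := formE_eq_dBeta e.open_target hy hmo htan hu v w
    rw [hasFDerivAt_chart h.smooth he hu, hasFDerivAt_chart h.smooth he hu] at this
    exact this
  refine ⟨fun p v => ?_, fun e he => ?_, fun e he u hu v₁ v₂ v₃ => ?_⟩
  · rw [inducedForm_apply, formE_apply, lie_self, map_zero, sub_self, add_zero]
  · obtain ⟨β, hβ, heq⟩ := hext e he
    exact (contDiffOn_extD e.open_target hβ).congr heq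
  · obtain ⟨β, hβ, heq⟩ := hext e he
    have : inChart (inducedForm (d := d) F ι) e =ᶠ[𝓝 u] extD β := by
      filter_upwards [e.open_target.mem_nhds hu] with t ht using heq t ht
    rw [this.fderiv_eq]
    exact extD_closed e.open_target hβ hu v₁ v₂ v₃

lemma isClosedTwoForm_component (ξ : su2) :
    IsClosedTwoForm (component κ (inducedForm (d := d) F ι) ξ) :=
  (isClosedTwoForm_inducedForm h).comp_clm (pairCLM κ ξ) fun _ _ _ => rfl

lemma nonempty_quatData_integral (hT : T.mu = F.mu) (p : S) :
    Nonempty (QuatData F T (ι p) (modelD (d := d) ι p)) :=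
  nonempty_quatData (h.mem p) (h.immersion p) (h.tangent p) hT

omit h [IsManifold 𝓘(ℝ, Eu d) ∞ S] in
lemma pseudoMetric_inducedForm {p : S} (Q : QuatData F T (ι p) (modelD (d := d) ι p)) :
    pseudoMetric (inducedForm (d := d) F ι) T p = (Q.G : Eu d →L[ℝ] (Eu d →L[ℝ] ℝ)) :=
  Q.pseudoMetric_eq

omit h [IsManifold 𝓘(ℝ, Eu d) ∞ S] in
lemma almostComplex_inducedForm {p : S} (Q : QuatData F T (ι p) (modelD (d := d) ι p))
    (i : Fin 3) : almostComplex (inducedForm (d := d) F ι) T i p = Q.ρ (T.vec i) :=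
  (congrArg (fun G : Eu d →L[ℝ] Eu d →L[ℝ] ℝ => G.inverse.comp
    (formAt F (ι p) (modelD (d := d) ι p) (T.vec i))) Q.pseudoMetric_eq).trans
    (Q.almostComplex_eq _)

/-- An explicit formula for the metric. -/
lemma pseudoMetric_inducedForm_apply (hT : T.mu = F.mu) (p : S) (v w : Tg d p) :
    pseudoMetric (inducedForm (d := d) F ι) T p v w = -(Phi F (ι p))⁻¹ *
      (Phi F (ι p) * tau F (ι p) (dmap ι p v) * (Phi F (ι p) * tau F (ι p) (dmap ι p w)) +
        pair κ (gradPhi F (ι p) (sigma F (ι p) (dmap ι p v)))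
          (gradPhi F (ι p) (sigma F (ι p) (dmap ι p w)))) := by
  obtain ⟨Q⟩ := nonempty_quatData_integral h hT p
  rw [pseudoMetric_inducedForm Q]
  exact Q.metric v w

/-- The explicit formula for g in terms of Φ, τ, σ and X does not involve T. -/
lemma pseudoMetric_eq_of_mu (hT : T.mu = F.mu) : pseudoMetric (inducedForm (d := d) F ι) T =
    pseudoMetric (inducedForm (d := d) F ι) F := by
  funext p
  refine ContinuousLinearMap.ext fun v => ContinuousLinearMap.ext fun w => ?_
  rw [pseudoMetric_inducedForm_apply h hT, pseudoMetric_inducedForm_apply h rfl]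

lemma isHypersymplectic_inducedForm : IsHypersymplectic κ (inducedForm (d := d) F ι) := by
  refine ⟨isClosedTwoForm_inducedForm h, fun ξ hξ p => ?_, fun ξ ξ₁ ξ₂ h0 h1 h2 k₁ k₂ hk p => ?_⟩
  · obtain ⟨Q⟩ := nonempty_quatData_integral h rfl p
    exact (Q.inverse_formAt fun h0 => hξ (F.pair_self_eq_zero h0)).1
  · obtain ⟨Q⟩ := nonempty_quatData_integral h rfl p
    have e : (formAt F (ι p) (modelD (d := d) ι p) ξ).inverse =
        k₁ • (formAt F (ι p) (modelD (d := d) ι p) ξ₁).inverse +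
          k₂ • (formAt F (ι p) (modelD (d := d) ι p) ξ₂).inverse := by
      rw [Q.inverse_formAt_of_unit h0, Q.inverse_formAt_of_unit h1, Q.inverse_formAt_of_unit h2,
        hk, Q.linear]
      ext1 α
      simp
      abel
    exact e

/-- `Φ` has constant sign on an integral manifold. -/
lemma exists_sign : ∃ ε : ℝ, (ε = 1 ∨ ε = -1) ∧ ∀ p, 0 < ε * -(Phi F (ι p))⁻¹ := by
  have := h.connected
  have hc : Continuous fun p => Phi F (ι p) :=
    (contDiff_Phi F).continuous.comp h.smooth.continuous
  have hr := (isPreconnected_range hc).ordConnected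
  by_cases hneg : ∀ p, Phi F (ι p) < 0
  · exact ⟨1, .inl rfl, fun p => by simpa using hneg p⟩
  · push Not at hneg
    obtain ⟨q, hq⟩ := hneg
    refine ⟨-1, .inr rfl, fun p => ?_⟩
    by_contra! hp
    have hp' : Phi F (ι p) ≤ 0 := by simpa using hp
    obtain ⟨r, hr⟩ := hr.out (mem_range_self p) (mem_range_self q) ⟨hp', hq⟩
    exact h.mem r hr

lemma inChart_pseudoMetric_apply {e : OpenPartialHomeomorph S (Eu d)}
    (he : e ∈ atlas (Eu d) S) {u : Eu d} (hu : u ∈ e.target) (v w : Eu d) :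
    inChart (pseudoMetric (inducedForm (d := d) F ι) F) e u v w = -(Phi F (ι (e.symm u)))⁻¹ *
      (Phi F (ι (e.symm u)) *
          (tau F (ι (e.symm u))).comp (fderiv ℝ (fun u => ι (e.symm u)) u) v *
        (Phi F (ι (e.symm u)) *
          (tau F (ι (e.symm u))).comp (fderiv ℝ (fun u => ι (e.symm u)) u) w) +
        pair κ (gradPhi F (ι (e.symm u))
            ((sigma F (ι (e.symm u))).comp (fderiv ℝ (fun u => ι (e.symm u)) u) v))
          (gradPhi F (ι (e.symm u))
            ((sigma F (ι (e.symm u))).comp (fderiv ℝ (fun u => ι (e.symm u)) u) w))) := by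
  simp only [ContinuousLinearMap.comp_apply, hasFDerivAt_chart h.smooth he hu]
  exact pseudoMetric_inducedForm_apply h rfl (e.symm u) (chartD e u v) (chartD e u w)

lemma contDiffOn_inChart_pseudoMetric {e : OpenPartialHomeomorph S (Eu d)}
    (he : e ∈ atlas (Eu d) S) :
    ContDiffOn ℝ ∞ (inChart (pseudoMetric (inducedForm (d := d) F ι) F) e) e.target := by
  have hy := contDiffOn_chart h.smooth he
  have hmo : ∀ u ∈ e.target, Phi F (ι (e.symm u)) ≠ 0 := fun u _ => h.mem _
  refine contDiffOn_clm_apply.2 fun v => contDiffOn_clm_apply.2 fun w => ?_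
  refine ContDiffOn.congr ?_ fun u hu => inChart_pseudoMetric_apply h he hu v w
  have hP : ContDiffOn ℝ ∞ (fun u => Phi F (ι (e.symm u))) e.target :=
    (contDiff_Phi F).comp_contDiffOn hy
  have hτ := contDiffOn_tau_fderiv e.open_target hy hmo
  have hσ := contDiffOn_sigma_fderiv e.open_target hy hmo
  have hX : ContDiffOn ℝ ∞ (fun u => gradPhi F (ι (e.symm u))) e.target :=
    (contDiff_gradPhi F).comp_contDiffOn hy
  refine ContDiffOn.mul (ContDiffOn.neg (ContDiffOn.inv hP hmo)) (ContDiffOn.add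
    (ContDiffOn.mul (hP.mul (hτ.clm_apply contDiffOn_const))
      (hP.mul (hτ.clm_apply contDiffOn_const))) (ContDiffOn.su2_pair ?_ ?_))
  · exact hX.clm_apply (hσ.clm_apply contDiffOn_const)
  · exact hX.clm_apply (hσ.clm_apply contDiffOn_const)

/-- The metric is definite on an integral manifold. -/
lemma exists_rMetric {ε : ℝ} (hε : ∀ p, 0 < ε * -(Phi F (ι p))⁻¹) : ∃ g : RMetric d S,
    ∀ p v w, g.inner p v w = ε * pseudoMetric (inducedForm (d := d) F ι) F p v w := by
  set G := pseudoMetric (inducedForm (d := d) F ι) F with hG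
  have hpos : ∀ p (v : Tg d p), v ≠ 0 → 0 < ε * G p v v := by
    intro p v hv
    have hε0 := hε p
    by_contra! hle
    have hφ : Phi F (ι p) ≠ 0 := h.mem p
    rw [hG, pseudoMetric_inducedForm_apply h rfl, ← mul_assoc] at hle
    have hn := F.pair_self_nonneg (gradPhi F (ι p) (sigma F (ι p) (dmap ι p v)))
    have hsum := nonpos_of_mul_nonpos_right hle hε0
    have hsq := mul_self_nonneg (Phi F (ι p) * tau F (ι p) (dmap ι p v))
    have hX := F.pair_self_eq_zero (le_antisymm (by linarith) hn)
    have hτ : Phi F (ι p) * tau F (ι p) (dmap ι p v) = 0 :=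
      mul_self_eq_zero.1 (le_antisymm (by linarith) hsq)
    have hσ : sigma F (ι p) (dmap ι p v) = 0 := gradPhi_injective hφ (by rw [hX, map_zero])
    have hτ' : tau F (ι p) (dmap ι p v) = 0 := (mul_eq_zero.1 hτ).resolve_left hφ
    have h0 : dmap ι p v = 0 := by
      have := (mem_charSpace_iff_eq hφ (dmap ι p v)).1 (by rw [← h.tangent]; exact mem_range_self v)
      rw [this, hσ, hτ', gen, zero_smul, add_zero]
      ext1 ζ
      rw [hat_apply]; simp
    exact hv (h.immersion p (by rw [h0, map_zero]))
  refine ⟨⟨fun p => ε • G p, fun p v w => ?_, hpos, fun p => ?_, ?_⟩, fun p v w => rfl⟩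
  · change ε * G p v w = ε * G p w v
    rw [hG, pseudoMetric_inducedForm_apply h rfl, pseudoMetric_inducedForm_apply h rfl, pair_comm]
    ring
  · exact isVonNBounded_of_pos (E := Eu d) (ε • (show Eu d →L[ℝ] Eu d →L[ℝ] ℝ from G p)) (hpos p)
  · refine contMDiff_bilField (θ := fun p => ε • G p) fun e he => ?_
    refine ((contDiffOn_inChart_pseudoMetric h he).const_smul ε).congr fun u _ => ?_
    rfl

/-- The relation ρ_jρ_i = ρ_k says ω_k = ω_j(ρ_i ·, ·) with both forms closed, which is the
situation of Hitchin's lemma. -/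
lemma isComplexStructure_almostComplex (hT : T.mu = F.mu) {i j k : Fin 3}
    (hijk : ∀ p, ∀ Q : QuatData F T (ι p) (modelD (d := d) ι p), ∀ v,
      Q.ρ (T.vec j) (Q.ρ (T.vec i) v) = Q.ρ (T.vec k) v) :
    IsComplexStructure (almostComplex (inducedForm (d := d) F ι) T i) := by
  refine isComplexStructure_of_closed (isClosedTwoForm_component h (T.vec j))
    (isClosedTwoForm_component h (T.vec k)) (fun p => ?_) (fun p v w => ?_) (fun p v => ?_)
  · obtain ⟨Q⟩ := nonempty_quatData_integral h hT p
    exact (Q.inverse_formAt (by simp [T.pair_vec])).1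
  · obtain ⟨Q⟩ := nonempty_quatData_integral h hT p
    rw [almostComplex_inducedForm Q]
    have e : ∀ v w : Eu d, formAt F (ι p) (modelD (d := d) ι p) (T.vec k) v w =
        formAt F (ι p) (modelD (d := d) ι p) (T.vec j) (Q.ρ (T.vec i) v) w := by
      intro v w
      rw [Q.form, Q.form]
      simp [hijk p Q]
    exact e v w
  · obtain ⟨Q⟩ := nonempty_quatData_integral h hT p
    rw [almostComplex_inducedForm Q]
    exact Q.square_vec i v

/-- The Kähler form of the i-th structure is εω_i, which is closed because Ω is. -/
lemma isKahler_almostComplex (hT : T.mu = F.mu) {ε : ℝ} {g : RMetric d S}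
    (hg : ∀ p v w, g.inner p v w = ε * pseudoMetric (inducedForm (d := d) F ι) F p v w)
    {i j k : Fin 3} (hijk : ∀ p, ∀ Q : QuatData F T (ι p) (modelD (d := d) ι p), ∀ v,
      Q.ρ (T.vec j) (Q.ρ (T.vec i) v) = Q.ρ (T.vec k) v) :
    IsKahler g (almostComplex (inducedForm (d := d) F ι) T i) := by
  rw [← pseudoMetric_eq_of_mu h hT] at hg
  refine ⟨isComplexStructure_almostComplex h hT hijk, fun p v w => ?_,
    (isClosedTwoForm_component h (T.vec i)).comp_clm (ε • .id ℝ ℝ) fun p v w => ?_⟩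
  · obtain ⟨Q⟩ := nonempty_quatData_integral h hT p
    rw [hg, hg, almostComplex_inducedForm Q, pseudoMetric_inducedForm Q]
    have := Q.isometry (T.vec i) v w
    rw [T.pair_vec, if_pos rfl, one_mul] at this
    exact congrArg (ε * ·) this
  · obtain ⟨Q⟩ := nonempty_quatData_integral h hT p
    refine (hg _ _ _).trans ?_
    rw [almostComplex_inducedForm Q, pseudoMetric_inducedForm Q]
    have e : ∀ v w : Eu d, Q.G (Q.ρ (T.vec i) v) w =
        formAt F (ι p) (modelD (d := d) ι p) (T.vec i) v w := by
      intro v w; rw [Q.form]; rfl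
    exact congrArg (ε * ·) (e v w)

lemma isHyperkahler_almostComplex (hT : T.mu = F.mu) {ε : ℝ} {g : RMetric d S}
    (hg : ∀ p v w, g.inner p v w = ε * pseudoMetric (inducedForm (d := d) F ι) F p v w) :
    IsHyperkahler g (almostComplex (inducedForm (d := d) F ι) T 0)
      (almostComplex (inducedForm (d := d) F ι) T 1)
      (almostComplex (inducedForm (d := d) F ι) T 2) := by
  -- The indices express KI = J, IJ = K and JK = I, all consequences of IJK = -1.
  refine ⟨isKahler_almostComplex h hT hg (j := 2) (k := 1) fun p Q v => ?_,
    isKahler_almostComplex h hT hg (j := 0) (k := 2) fun p Q v => ?_,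
    isKahler_almostComplex h hT hg (j := 1) (k := 0) fun p Q v => ?_, fun p v => ?_⟩
  · have := Q.quaternion' (Q.ρ (T.vec 1) v)
    rw [Q.square_vec] at this
    simpa using this
  · have := Q.quaternion (Q.ρ (T.vec 2) v)
    rw [Q.square_vec] at this
    simpa using this
  · have := congrArg (Q.ρ (T.vec 0)) (Q.quaternion v)
    rw [Q.square_vec] at this
    simpa using this
  · obtain ⟨Q⟩ := nonempty_quatData_integral h hT p
    rw [almostComplex_inducedForm Q, almostComplex_inducedForm Q, almostComplex_inducedForm Q]
    exact Q.quaternion v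

lemma isInducedForm_component (hT : T.mu = F.mu) :
    IsInducedForm T ι (component κ (inducedForm (d := d) F ι) (T.vec 0)) := by
  intro p v w α hα
  exact formAt_induced (D := modelD (d := d) ι p) (h.mem p) (h.tangent p) hT hα

lemma eq_four_of_integral : d = 4 := by
  have := h.connected
  obtain ⟨p⟩ := this.toNonempty
  have := finrank_eq_four (D := modelD (d := d) ι p) (h.mem p) (h.immersion p) (h.tangent p)
  simpa using this

lemma exists_tangent_hat (p : S) (ξ : su2) : ∃ v : Tg d p, dmap ι p v = hat F ξ (ι p) ∧
    pseudoMetric (inducedForm (d := d) F ι) F p v v = -A F (ι p) ξ ξ := by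
  have hx : Phi F (ι p) ≠ 0 := h.mem p
  obtain ⟨v, hv⟩ := exists_eq_gen (D := modelD (d := d) ι p) hx (h.tangent p) ξ 0
  have hv' : dmap ι p v = gen F (ι p) ξ 0 := hv
  refine ⟨v, by rw [hv', gen, zero_smul, add_zero], ?_⟩
  refine (pseudoMetric_inducedForm_apply h rfl p v v).trans ?_
  rw [hv', sigma_gen hx, tau_gen hx, A_eq_gradPhi]
  ring

lemma exists_tangent_gradPhi (p : S) : ∃ v : Tg d p, dmap ι p v = gradPhi F (ι p) ∧
    pseudoMetric (inducedForm (d := d) F ι) F p v v = -Phi F (ι p) := by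
  have hx : Phi F (ι p) ≠ 0 := h.mem p
  obtain ⟨v, hv⟩ := exists_eq_gen (D := modelD (d := d) ι p) hx (h.tangent p) 0 1
  have hv' : dmap ι p v = gen F (ι p) 0 1 := hv
  refine ⟨v, ?_, ?_⟩
  · rw [hv', gen, one_smul]
    ext1 ζ
    rw [add_apply, hat_apply]; simp
  · refine (pseudoMetric_inducedForm_apply h rfl p v v).trans ?_
    rw [hv', sigma_gen hx, tau_gen hx]
    have h0 : pair κ 0 0 = 0 := by simp [pair]
    rw [map_zero, h0]
    field_simp
    simp

/-- Integral manifolds see a bivector only through `Mo` and its characteristic spaces, and frames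
with equal `mu` share both. -/
lemma IsIntegralManifold.of_mu (hT : T.mu = F.mu) : IsIntegralManifold T d ι where
  connected := h.connected
  smooth := h.smooth
  injective := h.injective
  mem p := by rw [Mo_eq hT]; exact h.mem p
  immersion := h.immersion
  tangent p := by rw [charSpace_eq hT (h.mem p)]; exact h.tangent p

omit h in
lemma IsLeaf.of_mu (h : IsLeaf F d ι) (hT : T.mu = F.mu) : IsLeaf T d ι where
  integral := h.integral.of_mu hT
  maximal d' N _ _ _ j hj := h.maximal d' N j (hj.of_mu hT.symm)

end Integral

end HyperLie

end

/-! ### The hyperkähler structure of the leaves -/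

open HyperLie
open scoped ContDiff Manifold

theorem theorem4 (κ : ℝ) (hκ : 0 < κ) (F : Frame κ) :
    -- `M_o` is covered by the leaves of `π_F`
    (∀ x ∈ Mo F, ∃ (d : ℕ) (S : Type) (_ : TopologicalSpace S) (_ : ChartedSpace (Eu d) S)
      (_ : IsManifold 𝓘(ℝ, Eu d) ∞ S) (ι : S → MSpace), IsLeaf F d ι ∧ x ∈ Set.range ι) ∧
    -- every leaf is a 4-dimensional hyperkähler manifold
    ∀ (d : ℕ) (S : Type) [TopologicalSpace S] [ChartedSpace (Eu d) S]
      [IsManifold 𝓘(ℝ, Eu d) ∞ S] (ι : S → MSpace), IsLeaf F d ι →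
      d = 4 ∧
      (∀ T : Frame κ, F.SameOrientation T → IsLeaf T d ι) ∧
      ∃ Ω : BilField d S su2,
        (∀ T : Frame κ, F.SameOrientation T → IsInducedForm T ι (component κ Ω (T.vec 0))) ∧
        IsHypersymplectic κ Ω ∧
        (∀ T : Frame κ, F.SameOrientation T → pseudoMetric Ω T = pseudoMetric Ω F) ∧
        (∀ p (ξ : su2), ∃ v : Tg d p, dmap ι p v = hat F ξ (ι p) ∧
          pseudoMetric Ω F p v v = -A F (ι p) ξ ξ) ∧
        (∀ p, ∃ v : Tg d p, dmap ι p v = gradPhi F (ι p) ∧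
          pseudoMetric Ω F p v v = -Phi F (ι p)) ∧
        ∃ ε : ℝ, (ε = 1 ∨ ε = -1) ∧ ∃ h : RMetric d S,
          (∀ p v w, h.inner p v w = ε * pseudoMetric Ω F p v w) ∧
          ∀ T : Frame κ, F.SameOrientation T →
            IsHyperkahler h (almostComplex Ω T 0) (almostComplex Ω T 1) (almostComplex Ω T 2) := by
  refine ⟨fun x hx => exists_leaf F hx, fun d S _ _ _ ι hl => ?_⟩
  -- The geometry needs only a connected integral manifold; maximality enters only in the claim that
  -- the leaves of the frames agree.
  have h := hl.integral
  obtain ⟨ε, hε, hsign⟩ := exists_sign h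
  obtain ⟨g, hg⟩ := exists_rMetric h hsign
  exact ⟨eq_four_of_integral h, fun T hT => hl.of_mu (Frame.mu_eq_of_sameOrientation hT),
    inducedForm F ι, fun T hT => isInducedForm_component h (Frame.mu_eq_of_sameOrientation hT),
    isHypersymplectic_inducedForm h,
    fun T hT => pseudoMetric_eq_of_mu h (Frame.mu_eq_of_sameOrientation hT),
    exists_tangent_hat h, exists_tangent_gradPhi h, ε, hε, g, hg,
    fun T hT => isHyperkahler_almostComplex h (Frame.mu_eq_of_sameOrientation hT) hg⟩
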